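/- For $\varepsilon>0$ let $\Pi_\varepsilon=\{x\in\mathbb R^2:|x|>\varepsilon\}$. For $1<p<\infty$ let $L^p_\sigma(\Pi_\varepsilon)$ be the space of $L^p$ vector fields on $\Pi_\varepsilon$ that are divergence free and tangent to $\partial\Pi_\varepsilon$ (in the weak sense), let $\mathbb P_\varepsilon$ be the Leray projector, i.e. the orthogonal projection of $L^2(\Pi_\varepsilon)$ onto $L^2_\sigma(\Pi_\varepsilon)$, extended by density to $L^p(\Pi_\varepsilon)$, and let $\mathbb A_\varepsilon=-\mathbb P_\varepsilon\Delta$, with domain $W^{2,p}(\Pi_\varepsilon)\cap W^{1,p}_0(\Pi_\varepsilon)\cap L^p_\sigma(\Pi_\varepsilon)$, be the Stokes operator on $L^p_\sigma(\Pi_\varepsilon)$ with homogeneous Dirichlet boundary conditions. Let $$H(x)=\frac{x^\perp}{2\pi|x|^2},\qquad x^\perp=(-x_2,x_1),$$ which belongs to $L^p_\sigma(\Pi_\varepsilon)$ for all $2<p<\infty$. For $\alpha>0$ let $\mathcal G_\alpha(x)=\frac1\alpha\,\mathcal J_2\!\left(\frac{x}{\sqrt\alpha}\right)$ with $\mathcal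 J_2(x)=\int_0^\infty e^{-t}\,\frac{1}{4\pi t}\,e^{-|x|^2/(4t)}\,dt$ (the kernel of $(1-\alpha\Delta)^{-1}$ on $\mathbb R^2$), and let $K^\alpha=\mathcal G_\alpha*H$. Then for every $\alpha>0$ there is a constant $C>0$, depending only on $\alpha$, such that for every $0<\varepsilon\le\frac12$ the field $u=(1+\alpha\mathbb A_\varepsilon)^{-1}H$ is well defined (there is one field $u$ which, for every $2<p<\infty$, is the unique element of the domain of $\mathbb A_\varepsilon$ in $L^p_\sigma(\Pi_\varepsilon)$ with $u+\alpha\mathbb A_\varepsilon u=H$), and $$\bigl\|(1+\alpha\mathbb A_\varepsilon)^{-1}H-K^\alpha\bigr\|_{H^1(\Pi_\varepsilon)}\le C\,\varepsilon\,|\log\varepsilon| .$$ -/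

import Mathlib

open MeasureTheory Filter Topology
open scoped ENNReal ContDiff

noncomputable section

namespace StokesExterior

/-- The Euclidean plane. -/
abbrev Plane : Type := EuclideanSpace ℝ (Fin 2)

/-- The `i`-th vector of the standard basis. -/
def stdVec (i : Fin 2) : Plane := EuclideanSpace.single i 1

/-- Rotation by a right angle: `(x₁, x₂)^⊥ = (-x₂, x₁)`. -/
def perp (x : Plane) : Plane := !₂[-x 1, x 0]

/-- The exterior of the closed disk of radius `ε` centred at the origin. -/
def extDisk (ε : ℝ) : Set Plane := {x | ε < ‖x‖}

/-- The harmonic vector field `H = x^⊥ / (2π|x|²)`. -/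
def harmonicField (x : Plane) : Plane := (1 / (2 * Real.pi * ‖x‖ ^ 2)) • perp x

/-! ### The Bessel potential -/

/-- The Bessel kernel of order two in the plane, i.e. the kernel of `(1 - Δ)⁻¹`, written as the
Laplace transform `∫₀^∞ e^{-t} (4πt)⁻¹ e^{-|x|²/(4t)} dt` of the heat kernel. -/
def besselKernel (x : Plane) : ℝ :=
  ∫ t in Set.Ioi (0 : ℝ), Real.exp (-t) * ((4 * Real.pi * t)⁻¹ * Real.exp (-(‖x‖ ^ 2 / (4 * t))))

/-- The kernel `G_α(x) = α⁻¹ J₂(x / √α)` of `(1 - αΔ)⁻¹` in the plane. -/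
def greenKernel (α : ℝ) (x : Plane) : ℝ := α⁻¹ * besselKernel ((Real.sqrt α)⁻¹ • x)

/-- `K^α = G_α ∗ H`. -/
def smoothedField (α : ℝ) : Plane → Plane :=
  convolution (greenKernel α) harmonicField (ContinuousLinearMap.lsmul ℝ ℝ) volume

/-! ### Sobolev spaces of vector fields on an open set -/

/-- `g` is the weak partial derivative `∂ᵢ u` on the open set `Ω`. -/
def HasWeakPartial (Ω : Set Plane) (i : Fin 2) (u g : Plane → Plane) : Prop :=
  LocallyIntegrableOn u Ω volume ∧ LocallyIntegrableOn g Ω volume ∧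
    ∀ φ : Plane → ℝ, ContDiff ℝ ∞ φ → HasCompactSupport φ → tsupport φ ⊆ Ω →
      ∫ x in Ω, (fderiv ℝ φ x (stdVec i)) • u x = -∫ x in Ω, φ x • g x

/-- The norm `(‖w‖²_{L²} + ‖∂₁w‖²_{L²} + ‖∂₂w‖²_{L²})^{1/2}` of `H¹(Ω)`. It is `∞` when `w` has no weak
gradient on `Ω` (infimum over the empty set), or when `w` or its gradient is not in `L²(Ω)`; the
weak gradient is unique almost everywhere, so otherwise the infimum is over a single value. -/
def h1Norm (Ω : Set Plane) (w : Plane → Plane) : ℝ≥0∞ :=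
  ⨅ (D : Fin 2 → Plane → Plane) (_ : ∀ i, HasWeakPartial Ω i w (D i)),
    ((eLpNorm w 2 (volume.restrict Ω)) ^ 2 +
      ∑ i, (eLpNorm (D i) 2 (volume.restrict Ω)) ^ 2) ^ (1 / 2 : ℝ)

/-- `u ∈ W^{1,p}_0(Ω)`: the closure in `W^{1,p}(Ω)` of the smooth fields with compact support in `Ω`. -/
def MemW1Zero (Ω : Set Plane) (p : ℝ≥0∞) (u : Plane → Plane) : Prop :=
  ∃ D : Fin 2 → Plane → Plane,
    (∀ i, HasWeakPartial Ω i u (D i)) ∧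
    MemLp u p (volume.restrict Ω) ∧ (∀ i, MemLp (D i) p (volume.restrict Ω)) ∧
    ∃ φ : ℕ → Plane → Plane,
      (∀ n, ContDiff ℝ ∞ (φ n) ∧ HasCompactSupport (φ n) ∧ tsupport (φ n) ⊆ Ω) ∧
      Tendsto (fun n => eLpNorm (fun x => φ n x - u x) p (volume.restrict Ω)) atTop (𝓝 0) ∧
      ∀ i, Tendsto (fun n => eLpNorm (fun x => fderiv ℝ (φ n) x (stdVec i) - D i x) p
        (volume.restrict Ω)) atTop (𝓝 0)

/-- `u ∈ W^{2,p}(Ω)`, and `L` is its Laplacian. -/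
def MemW2WithLaplacian (Ω : Set Plane) (p : ℝ≥0∞) (u L : Plane → Plane) : Prop :=
  ∃ (D : Fin 2 → Plane → Plane) (D₂ : Fin 2 → Fin 2 → Plane → Plane),
    (∀ i, HasWeakPartial Ω i u (D i)) ∧ (∀ i j, HasWeakPartial Ω j (D i) (D₂ i j)) ∧
    MemLp u p (volume.restrict Ω) ∧ (∀ i, MemLp (D i) p (volume.restrict Ω)) ∧
    (∀ i j, MemLp (D₂ i j) p (volume.restrict Ω)) ∧
    L = fun x => ∑ i, D₂ i i x

/-! ### Solenoidal fields, the Leray projector, the Stokes operator -/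

/-- `u ∈ L^p_σ(Π_ε)`: an `L^p` field that is divergence free in `Π_ε` and tangent to its boundary, both in
the weak sense that `∫ u · ∇φ = 0` for all test functions `φ` on the plane (whose support may meet
the boundary of `Π_ε`). -/
def MemLpSigma (ε : ℝ) (p : ℝ≥0∞) (u : Plane → Plane) : Prop :=
  MemLp u p (volume.restrict (extDisk ε)) ∧
    ∀ φ : Plane → ℝ, ContDiff ℝ ∞ φ → HasCompactSupport φ →
      ∫ x in extDisk ε, fderiv ℝ φ x (u x) = 0

/-- `g` is the orthogonal projection of `f ∈ L²(Π_ε)` onto `L²_σ(Π_ε)`. -/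
def IsLerayTwo (ε : ℝ) (f g : Plane → Plane) : Prop :=
  MemLp f 2 (volume.restrict (extDisk ε)) ∧ MemLpSigma ε 2 g ∧
    ∀ h, MemLpSigma ε 2 h → ∫ x in extDisk ε, inner ℝ (f x - g x) (h x) = 0

/-- `g` is the Leray projection of `f ∈ L^p(Π_ε)`, by density: `f` and `g` are the limits in `L^p` of
`fₙ ∈ L² ∩ L^p` and of the orthogonal projections `gₙ` of `fₙ`. -/
def IsLeray (ε : ℝ) (p : ℝ≥0∞) (f g : Plane → Plane) : Prop :=
  MemLp f p (volume.restrict (extDisk ε)) ∧ MemLp g p (volume.restrict (extDisk ε)) ∧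
    ∃ F G : ℕ → Plane → Plane,
      (∀ n, IsLerayTwo ε (F n) (G n) ∧ MemLp (F n) p (volume.restrict (extDisk ε)) ∧
        MemLp (G n) p (volume.restrict (extDisk ε))) ∧
      Tendsto (fun n => eLpNorm (fun x => F n x - f x) p (volume.restrict (extDisk ε))) atTop (𝓝 0) ∧
      Tendsto (fun n => eLpNorm (fun x => G n x - g x) p (volume.restrict (extDisk ε))) atTop (𝓝 0)

/-- `u` is in the domain `W^{2,p} ∩ W^{1,p}_0 ∩ L^p_σ` of the Stokes operator `A_ε = -P_ε Δ` on
`L^p_σ(Π_ε)`, and `A_ε u = v`. -/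
def IsStokes (ε : ℝ) (p : ℝ≥0∞) (u v : Plane → Plane) : Prop :=
  MemLpSigma ε p u ∧ MemW1Zero (extDisk ε) p u ∧
    ∃ L, MemW2WithLaplacian (extDisk ε) p u L ∧ IsLeray ε p L (fun x => -v x)

/-- `u = (1 + α A_ε)⁻¹ f` for `f ∈ L^p_σ(Π_ε)`, i.e. `u` is in the domain of `A_ε` and `u + α A_ε u = f`. -/
def IsStokesResolvent (α ε : ℝ) (p : ℝ≥0∞) (f u : Plane → Plane) : Prop :=
  MemLpSigma ε p f ∧ ∃ v, IsStokes ε p u v ∧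
    (fun x => u x + α • v x) =ᵐ[volume.restrict (extDisk ε)] f

end StokesExterior

end

open StokesExterior

/-!
Write `ρ = |x|²`, and let `A_m` be the integral `besselInt m α⁻¹`, a modified Bessel function of
order `m - 1` times a power of `|x|`.

*The solution.* An azimuthal field `f(|x|) x^⊥` is divergence free and tangent to every circle, so the
Leray projector fixes it (`isLeray_azimuthal`) and no pressure appears. On such fields the resolvent
equation is a Bessel equation, with the explicit solution `u = (1/(2πρ) - κ A₂(ρ)) x^⊥`
(`resolventField`), where the constant `κ` (`boundaryCoeff`) makes `u` vanish on the circle of radius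
`ε`. Its Laplacian is `α⁻¹ (u - H)` (`laplacian_resolventField`), and this gives
`isStokesResolvent_resolventField`.

*The estimate.* In complex notation `H` is the conjugate of a multiple of `1/z`, and the kernel `G_α`
is radial. By Newton's theorem for the kernel `1/z`, `K^α = (1/(2πρ) - A₂(ρ)/(8π)) x^⊥`
(`smoothedField_eq`). Hence `u - K^α = -(κ - 1/(8π)) A₂(ρ) x^⊥`. Here `κ - 1/(8π)` is of size
`ε² |log ε|` (`exists_boundaryCoeff_sub_le`), and the `H¹` norm of `A₂(ρ) x^⊥` is of size `1/ε`, because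
the field and its gradient are bounded by a multiple of `|x|⁻²` (`exists_norm_besselInt_perp_le`,
`exists_eLpNorm_inv_sq_eq`).

*Uniqueness.* This is proved by transposition. The difference `w` of two solutions is orthogonal to
`h - α Δh` for every smooth, decaying, divergence free field `h` that vanishes on the circle
(`IsStokesResolvent.integral_test`), and to gradients because it is solenoidal. Explicit fields
`h = F(ρ) c z^{m+2} + G(ρ) c̄ z̄^m` built from the integrals `A_m^l = besselInt m l`, together with
explicit gradients, show that the moments of `w` against `z^m A_{m+1}^l(ρ)` and `z̄^m A_{m+1}^l(ρ)` vanish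
for all `m` and all positive `l ≠ α⁻¹` (`moment_besselInt_eq_zero`). As a function of `l` such a moment
is a Laplace transform, whose injectivity (`ae_eq_zero_of_laplace_eq_zero`) turns this into the
vanishing of the Gaussian moments of `w` (`gaussian_moment_eq_zero`). All polynomial moments of
`e^{-|x|²} w` are then zero, hence so is its Fourier transform, and `w = 0`
(`ae_eq_zero_of_moments_eq_zero`).
-/

namespace StokesExterior

/-! ### Bessel-type integrals -/

/-- The integrals `A_m^l(ρ) = ∫₀^∞ e^{-lt - ρ/(4t)} t^{-m} dt`. With `ρ = r²` and `m = n + 1` this is, up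
to a constant and the factor `r^{-n}`, the modified Bessel function `K_n(√l r)`, so that
`zⁿ * besselInt (n + 1) l |z|²` is a decaying solution of `Δ Φ = l Φ` in the punctured plane. The
squared variable makes differentiation a shift of the index `m`. -/
noncomputable def besselInt (m : ℕ) (l ρ : ℝ) : ℝ :=
  ∫ t in Set.Ioi (0 : ℝ), Real.exp (-(l * t) - ρ / (4 * t)) * (t ^ m)⁻¹

lemma integrableOn_pow_mul_exp_neg (k : ℕ) {l : ℝ} (hl : 0 < l) :
    IntegrableOn (fun t : ℝ => t ^ k * Real.exp (-(l * t))) (Set.Ioi 0) := by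
  have h := integrableOn_rpow_mul_exp_neg_mul_rpow (p := 1) (s := k) (b := l)
    (by have : (0 : ℝ) ≤ k := by positivity
        linarith) one_pos hl
  refine h.congr_fun (fun t _ => ?_) measurableSet_Ioi
  simp [Real.rpow_natCast]

lemma exp_neg_div_le {ρ t : ℝ} (hρ : 0 < ρ) (ht : 0 < t) (N : ℕ) :
    Real.exp (-(ρ / (4 * t))) ≤ N.factorial * 4 ^ N * (ρ ^ N)⁻¹ * t ^ N := by
  have h := Real.pow_div_factorial_le_exp (ρ / (4 * t)) (by positivity) N
  rw [Real.exp_neg]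
  calc (Real.exp (ρ / (4 * t)))⁻¹ ≤ ((ρ / (4 * t)) ^ N / N.factorial)⁻¹ :=
        inv_anti₀ (by positivity) h
    _ = _ := by
        rw [div_pow, mul_pow]
        field_simp

lemma besselInt_integrand_le {l ρ t : ℝ} (hρ : 0 < ρ) (ht : 0 < t) {m N : ℕ}
    (hN : m ≤ N) : Real.exp (-(l * t) - ρ / (4 * t)) * (t ^ m)⁻¹ ≤
      N.factorial * 4 ^ N * (ρ ^ N)⁻¹ * (t ^ (N - m) * Real.exp (-(l * t))) := by
  have h := exp_neg_div_le hρ ht N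
  have e : t ^ N = t ^ (N - m) * t ^ m := by rw [← pow_add, Nat.sub_add_cancel hN]
  rw [sub_eq_add_neg, Real.exp_add]
  calc Real.exp (-(l * t)) * Real.exp (-(ρ / (4 * t))) * (t ^ m)⁻¹
      ≤ Real.exp (-(l * t)) * (N.factorial * 4 ^ N * (ρ ^ N)⁻¹ * t ^ N) * (t ^ m)⁻¹ := by gcongr
    _ = _ := by
      rw [e]
      field_simp

lemma continuousOn_besselInt_integrand (m : ℕ) (l ρ : ℝ) :
    ContinuousOn (fun t : ℝ => Real.exp (-(l * t) - ρ / (4 * t)) * (t ^ m)⁻¹) (Set.Ioi 0) := by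
  have h : ∀ t ∈ Set.Ioi (0 : ℝ), t ≠ 0 := fun t ht => ne_of_gt ht
  refine ContinuousOn.mul ?_ (ContinuousOn.inv₀ (by fun_prop) fun t ht => pow_ne_zero _ (h t ht))
  refine Real.continuous_exp.comp_continuousOn (ContinuousOn.sub (by fun_prop) ?_)
  exact ContinuousOn.div (by fun_prop) (by fun_prop) fun t ht => mul_ne_zero four_ne_zero (h t ht)

lemma integrableOn_besselInt_integrand (m : ℕ) {l ρ : ℝ} (hl : 0 < l) (hρ : 0 < ρ) :
    IntegrableOn (fun t : ℝ => Real.exp (-(l * t) - ρ / (4 * t)) * (t ^ m)⁻¹) (Set.Ioi 0) := by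
  refine Integrable.mono' ((integrableOn_pow_mul_exp_neg (m - m) hl).const_mul
    (m.factorial * 4 ^ m * (ρ ^ m)⁻¹))
    ((continuousOn_besselInt_integrand m l ρ).aestronglyMeasurable measurableSet_Ioi) ?_
  refine (ae_restrict_iff' measurableSet_Ioi).2 (ae_of_all _ fun t (ht : 0 < t) => ?_)
  rw [Real.norm_of_nonneg (by positivity)]
  exact besselInt_integrand_le hρ ht le_rfl

lemma besselInt_nonneg (m : ℕ) (l ρ : ℝ) : 0 ≤ besselInt m l ρ :=
  setIntegral_nonneg measurableSet_Ioi fun t (ht : 0 < t) => by positivity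

lemma besselInt_pos (m : ℕ) {l ρ : ℝ} (hl : 0 < l) (hρ : 0 < ρ) : 0 < besselInt m l ρ := by
  refine (setIntegral_pos_iff_support_of_nonneg_ae ?_ (integrableOn_besselInt_integrand m hl hρ)).2 ?_
  · exact (ae_restrict_iff' measurableSet_Ioi).2 (ae_of_all _ fun t (ht : 0 < t) => by
      simp only [Pi.zero_apply]; positivity)
  · have : Set.Ioi (0 : ℝ) ⊆ Function.support
        (fun t : ℝ => Real.exp (-(l * t) - ρ / (4 * t)) * (t ^ m)⁻¹) := by
      intro t (ht : 0 < t)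
      simp only [Function.mem_support]
      positivity
    rw [Set.inter_eq_right.2 this]
    simp

/-- Decay faster than any power: `e^{-ρ/(4t)}` is at most a multiple of `(t/ρ)^N`, and `N ≥ m` makes
`t^{N-m} e^{-lt}` integrable. -/
lemma besselInt_le (m : ℕ) {N : ℕ} (hN : m ≤ N) {l : ℝ} (hl : 0 < l) :
    ∃ C, 0 < C ∧ ∀ ρ, 0 < ρ → besselInt m l ρ ≤ C * (ρ ^ N)⁻¹ := by
  set I := ∫ t in Set.Ioi (0 : ℝ), t ^ (N - m) * Real.exp (-(l * t)) with hI
  have hI0 : 0 ≤ I := setIntegral_nonneg measurableSet_Ioi fun t (ht : 0 < t) => by positivity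
  refine ⟨N.factorial * 4 ^ N * I + 1, by positivity, fun ρ hρ => ?_⟩
  have h : besselInt m l ρ ≤ N.factorial * 4 ^ N * (ρ ^ N)⁻¹ * I := by
    rw [hI, ← integral_const_mul]
    refine setIntegral_mono_on (integrableOn_besselInt_integrand m hl hρ)
      ((integrableOn_pow_mul_exp_neg (N - m) hl).const_mul _) measurableSet_Ioi ?_
    exact fun t ht => besselInt_integrand_le hρ ht hN
  have : 0 < (ρ ^ N)⁻¹ := by positivity
  nlinarith

lemma hasDerivAt_besselInt (m : ℕ) {l ρ : ℝ} (hl : 0 < l) (hρ : 0 < ρ) :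
    HasDerivAt (besselInt m l) (-(besselInt (m + 1) l ρ / 4)) ρ := by
  have key := hasDerivAt_integral_of_dominated_loc_of_deriv_le (μ := volume.restrict (Set.Ioi (0:ℝ)))
    (F := fun ρ t => Real.exp (-(l * t) - ρ / (4 * t)) * (t ^ m)⁻¹)
    (F' := fun ρ t => -(Real.exp (-(l * t) - ρ / (4 * t)) * (t ^ (m + 1))⁻¹ / 4))
    (x₀ := ρ) (s := Set.Ioi (ρ / 2))
    (bound := fun t => Real.exp (-(l * t) - (ρ / 2) / (4 * t)) * (t ^ (m + 1))⁻¹ / 4)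
    (Ioi_mem_nhds (by linarith))
    (Eventually.of_forall fun ρ' =>
      (continuousOn_besselInt_integrand m l ρ').aestronglyMeasurable measurableSet_Ioi)
    (integrableOn_besselInt_integrand m hl hρ)
    (((continuousOn_besselInt_integrand (m + 1) l ρ).aestronglyMeasurable
      measurableSet_Ioi).mul_const (4⁻¹)).neg
    ((ae_restrict_iff' measurableSet_Ioi).2 (ae_of_all _ fun t (ht : 0 < t) ρ' hρ' => ?_))
    ((integrableOn_besselInt_integrand (m + 1) hl (half_pos hρ)).div_const 4)
    ((ae_restrict_iff' measurableSet_Ioi).2 (ae_of_all _ fun t (ht : 0 < t) ρ' hρ' => ?_))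
  · have h := key.2
    rw [integral_neg, integral_div] at h
    exact h
  · have h0 : ρ / 2 < ρ' := hρ'
    rw [norm_neg, Real.norm_of_nonneg (by positivity)]
    gcongr
  · have h1 : HasDerivAt (fun ρ' => Real.exp (-(l * t) - ρ' / (4 * t)) * (t ^ m)⁻¹)
        (Real.exp (-(l * t) - ρ' / (4 * t)) * (-(1 / (4 * t))) * (t ^ m)⁻¹) ρ' :=
      ((((hasDerivAt_id ρ').div_const (4 * t)).const_sub (-(l * t))).exp).mul_const _
    refine h1.congr_deriv ?_
    rw [pow_succ]
    field_simp

lemma contDiffOn_besselInt (m : ℕ) {l : ℝ} (hl : 0 < l) :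
    ContDiffOn ℝ ∞ (besselInt m l) (Set.Ioi 0) := by
  rw [contDiffOn_infty]
  intro n
  induction n generalizing m with
  | zero =>
    exact contDiffOn_zero.2 fun ρ hρ => (hasDerivAt_besselInt m hl hρ).continuousAt.continuousWithinAt
  | succ n ih =>
    -- the derivative has the same form with `m + 1` in place of `m`
    rw [show ((n + 1 : ℕ) : WithTop ℕ∞) = (n : WithTop ℕ∞) + 1 by push_cast; rfl,
      contDiffOn_succ_iff_deriv_of_isOpen isOpen_Ioi]
    refine ⟨fun ρ hρ => (hasDerivAt_besselInt m hl hρ).differentiableAt.differentiableWithinAt,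
      by simp, ?_⟩
    exact ((ih (m + 1)).div_const 4).neg.congr fun ρ hρ => (hasDerivAt_besselInt m hl hρ).deriv

/-- The three-term recurrence, obtained by integrating `d/dt (e^{-lt - ρ/(4t)} t^{-m})`. -/
lemma besselInt_recurrence (m : ℕ) {l ρ : ℝ} (hl : 0 < l) (hρ : 0 < ρ) :
    ρ / 4 * besselInt (m + 2) l ρ = m * besselInt (m + 1) l ρ + l * besselInt m l ρ := by
  -- the value of the primitive at `0` is set to its limit
  set f : ℝ → ℝ := fun t => if t ≤ 0 then 0 else Real.exp (-(l * t) - ρ / (4 * t)) * (t ^ m)⁻¹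
    with hf
  set f' : ℝ → ℝ := fun t => -(l * (Real.exp (-(l * t) - ρ / (4 * t)) * (t ^ m)⁻¹)) +
    ρ / 4 * (Real.exp (-(l * t) - ρ / (4 * t)) * (t ^ (m + 2))⁻¹) -
    m * (Real.exp (-(l * t) - ρ / (4 * t)) * (t ^ (m + 1))⁻¹) with hf'
  have i0 := (integrableOn_besselInt_integrand m hl hρ).const_mul l
  have i1 := (integrableOn_besselInt_integrand (m + 1) hl hρ).const_mul (m : ℝ)
  have i2 := (integrableOn_besselInt_integrand (m + 2) hl hρ).const_mul (ρ / 4)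
  have hder : ∀ t ∈ Set.Ioi (0 : ℝ), HasDerivAt f (f' t) t := by
    intro t (ht : 0 < t)
    have e : f =ᶠ[𝓝 t] fun t => Real.exp (-(l * t) - ρ / (4 * t)) * (t ^ m)⁻¹ := by
      filter_upwards [Ioi_mem_nhds ht] with s hs
      simp [hf, not_le.2 (show 0 < s from hs)]
    refine HasDerivAt.congr_of_eventuallyEq ?_ e
    have h1 : HasDerivAt (fun t : ℝ => -(l * t) - ρ / (4 * t))
        (-(l * 1) - (0 * (4 * t) - ρ * (4 * 1)) / (4 * t) ^ 2) t :=
      (((hasDerivAt_id t).const_mul l).neg).sub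
        ((hasDerivAt_const t ρ).div ((hasDerivAt_id t).const_mul 4) (by positivity))
    have h2 := h1.exp.mul ((hasDerivAt_pow m t).inv (by positivity))
    refine h2.congr_deriv ?_
    rw [hf']
    rcases m with _ | k
    · simp; field_simp; ring
    · simp only [Nat.add_sub_cancel, Pi.inv_apply]
      field_simp
      ring
  have hzero : Tendsto f (𝓝[>] 0) (𝓝 0) := by
    have hb : ∀ t ∈ Set.Ioi (0 : ℝ), ‖f t‖ ≤ (m + 1).factorial * 4 ^ (m + 1) * (ρ ^ (m + 1))⁻¹ * t := by
      intro t (ht : 0 < t)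
      have h := besselInt_integrand_le (l := l) hρ ht (Nat.le_succ m)
      simp only [hf, not_le.2 ht, if_false]
      rw [Real.norm_of_nonneg (by positivity)]
      refine h.trans ?_
      have : m.succ - m = 1 := by omega
      rw [this, pow_one]
      have h1 : Real.exp (-(l * t)) ≤ 1 := Real.exp_le_one_iff.2 (by nlinarith)
      have h2 : t * Real.exp (-(l * t)) ≤ t := by nlinarith
      gcongr
    refine squeeze_zero_norm' (eventually_nhdsWithin_of_forall hb) ?_
    have : Tendsto (fun t : ℝ => (m + 1).factorial * 4 ^ (m + 1) * (ρ ^ (m + 1))⁻¹ * t) (𝓝 0)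
        (𝓝 (((m + 1).factorial * 4 ^ (m + 1) * (ρ ^ (m + 1))⁻¹ * 0 : ℝ))) :=
      (continuous_const.mul continuous_id).tendsto 0
    rw [mul_zero] at this
    exact this.mono_left nhdsWithin_le_nhds
  have hinf : Tendsto f atTop (𝓝 0) := by
    have h0 : Tendsto (fun t : ℝ => Real.exp (-(l * t))) atTop (𝓝 0) :=
      Real.tendsto_exp_neg_atTop_nhds_zero.comp (tendsto_id.const_mul_atTop hl)
    refine squeeze_zero_norm' ?_ h0
    filter_upwards [eventually_ge_atTop 1] with t ht
    have ht0 : 0 < t := by linarith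
    simp only [hf, not_le.2 ht0, if_false]
    rw [Real.norm_of_nonneg (by positivity)]
    have h1 : (t ^ m)⁻¹ ≤ 1 := inv_le_one_of_one_le₀ (one_le_pow₀ ht)
    have h2 : Real.exp (-(l * t) - ρ / (4 * t)) ≤ Real.exp (-(l * t)) :=
      Real.exp_le_exp.2 (by have : 0 < ρ / (4 * t) := by positivity
                            linarith)
    calc _ ≤ Real.exp (-(l * t)) * 1 := by gcongr
      _ = _ := mul_one _
  have hcont : ContinuousWithinAt f (Set.Ici 0) 0 := by
    rw [← continuousWithinAt_Ioi_iff_Ici]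
    have : f 0 = 0 := by simp [hf]
    rw [ContinuousWithinAt, this]
    exact hzero
  have key := integral_Ioi_of_hasDerivAt_of_tendsto hcont hder ((i0.neg.add i2).sub i1) hinf
  have : f 0 = 0 := by simp [hf]
  rw [this, sub_zero] at key
  have e : ∫ t in Set.Ioi (0 : ℝ), f' t = -(l * besselInt m l ρ) + ρ / 4 * besselInt (m + 2) l ρ -
      m * besselInt (m + 1) l ρ := by
    simp only [hf', besselInt]
    have i0' : IntegrableOn (fun t : ℝ => -(l * (Real.exp (-(l * t) - ρ / (4 * t)) * (t ^ m)⁻¹)))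
      (Set.Ioi 0) := i0.neg
    have i3 : IntegrableOn (fun t : ℝ => -(l * (Real.exp (-(l * t) - ρ / (4 * t)) * (t ^ m)⁻¹)) +
      ρ / 4 * (Real.exp (-(l * t) - ρ / (4 * t)) * (t ^ (m + 2))⁻¹)) (Set.Ioi 0) := i0'.add i2
    rw [integral_sub i3 i1, integral_add i0' i2, integral_neg, integral_const_mul, integral_const_mul, integral_const_mul]
  linarith

/-! ### The plane as the complex line -/

/-- The identification of the Euclidean plane with `ℂ`. -/
noncomputable def toC : Plane ≃ₗᵢ[ℝ] ℂ := Complex.orthonormalBasisOneI.repr.symm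

lemma toC_apply (x : Plane) : toC x = x 0 + x 1 * Complex.I :=
  Complex.orthonormalBasisOneI_repr_symm_apply x

lemma norm_toC (x : Plane) : ‖toC x‖ = ‖x‖ := toC.norm_map x

lemma toC_perp (x : Plane) : toC (perp x) = Complex.I * toC x := by
  rw [toC_apply, toC_apply]
  simp only [perp, PiLp.toLp_apply, Matrix.cons_val_zero, Matrix.cons_val_one]
  push_cast
  linear_combination -(x 1 : ℂ) * Complex.I_sq

lemma integral_comp_toC {F : Type*} [NormedAddCommGroup F] [NormedSpace ℝ F] (f : ℂ → F) :
    ∫ x, f (toC x) = ∫ z, f z :=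
  toC.measurePreserving.integral_comp toC.toHomeomorph.measurableEmbedding f

lemma integrable_comp_toC {F : Type*} [NormedAddCommGroup F] {f : ℂ → F} :
    Integrable (fun x => f (toC x)) ↔ Integrable f :=
  toC.measurePreserving.integrable_comp_emb toC.toHomeomorph.measurableEmbedding

/-! ### Integration in polar coordinates -/

lemma integrableOn_polarCoord_target {F : Type*} [NormedAddCommGroup F] [NormedSpace ℝ F]
    {f : ℂ → F} (hf : Integrable f) :
    IntegrableOn (fun p : ℝ × ℝ => p.1 • f (Complex.polarCoord.symm p)) polarCoord.target := by
  have h1 : Integrable (fun p => f (Complex.measurableEquivRealProd.symm p)) :=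
    (Complex.volume_preserving_equiv_real_prod.symm).integrable_comp_emb
      (g := f) Complex.measurableEquivRealProd.symm.measurableEmbedding |>.2 hf
  have h2 : IntegrableOn (fun p => f (Complex.measurableEquivRealProd.symm p))
    (polarCoord.symm '' polarCoord.target) := h1.integrableOn
  rw [integrableOn_image_iff_integrableOn_abs_det_fderiv_smul volume
    polarCoord.open_target.measurableSet
    (fun p _ => (hasFDerivAt_polarCoord_symm p).hasFDerivWithinAt) polarCoord.symm.injOn] at h2
  refine h2.congr_fun (fun p hp => ?_) polarCoord.open_target.measurableSet
  simp only [det_fderivPolarCoordSymm]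
  rw [abs_of_pos hp.1]
  rfl

/-- Integration in polar coordinates, with the angular integral expressed by circle averages. -/
lemma integral_eq_integral_circleAverage {F : Type*} [NormedAddCommGroup F] [NormedSpace ℝ F]
    {f : ℂ → F} (hf : Integrable f) :
    ∫ z, f z = ∫ r in Set.Ioi (0 : ℝ), r • ((2 * Real.pi) • Real.circleAverage f 0 r) := by
  rw [← Complex.integral_comp_polarCoord_symm]
  have h := integrableOn_polarCoord_target hf
  rw [polarCoord_target] at h ⊢
  rw [Measure.volume_eq_prod, setIntegral_prod _ h]
  refine setIntegral_congr_fun measurableSet_Ioi fun r _ => ?_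
  simp only
  rw [integral_smul, Real.circleAverage_eq_integral_add (-Real.pi),
    smul_inv_smul₀ (by positivity),
    intervalIntegral.integral_comp_add_right (fun θ => f (circleMap 0 r θ)),
    show (0 : ℝ) + -Real.pi = -Real.pi by ring, show 2 * Real.pi + -Real.pi = Real.pi by ring,
    intervalIntegral.integral_of_le (by linarith [Real.pi_pos]), integral_Ioc_eq_integral_Ioo]
  congr 1
  refine setIntegral_congr_fun measurableSet_Ioo fun θ _ => ?_
  simp only [Complex.polarCoord_symm_apply, circleMap, zero_add, Complex.exp_mul_I,
    Complex.ofReal_cos, Complex.ofReal_sin]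

/-! ### The convolution of a radial kernel with the harmonic field -/

/-- Mean value property: the integrand is holomorphic in the disk. -/
lemma circleAverage_inv_sub_of_lt {z : ℂ} {r : ℝ} (hr : 0 < r) (h : r < ‖z‖) :
    Real.circleAverage (fun w => (z - w)⁻¹) 0 r = z⁻¹ := by
  have hd : DiffContOnCl ℂ (fun w => (z - w)⁻¹) (Metric.ball 0 |r|) := by
    have hne : ∀ w ∈ Metric.closedBall (0 : ℂ) r, z - w ≠ 0 := by
      intro w hw h0
      rw [sub_eq_zero] at h0
      rw [mem_closedBall_zero_iff, ← h0] at hw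
      linarith
    rw [abs_of_pos hr]
    refine DifferentiableOn.diffContOnCl ?_
    rw [closure_ball _ hr.ne']
    exact DifferentiableOn.inv (by fun_prop) hne
  rw [hd.circleAverage, sub_zero]

/-- On the circle `1/(z - w) = z⁻¹ (1 - w/(w - z))`, and the average of `w/(w - z)` is `1` by the
Cauchy formula. -/
lemma circleAverage_inv_sub_of_gt {z : ℂ} {r : ℝ} (hz : z ≠ 0) (h : ‖z‖ < r) :
    Real.circleAverage (fun w => (z - w)⁻¹) 0 r = 0 := by
  have hr : 0 < r := (norm_nonneg z).trans_lt h
  have hne : ∀ w ∈ Metric.sphere (0 : ℂ) r, w - z ≠ 0 := by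
    intro w hw h0
    rw [sub_eq_zero] at h0
    rw [mem_sphere_zero_iff_norm, h0] at hw
    linarith
  have h1 : Real.circleAverage (fun w => ((w - 0) / (w - z)) • (1 : ℂ)) 0 r = 1 :=
    (diffContOnCl_const (c := (1 : ℂ))).circleAverage_smul_div (by
      rw [abs_of_pos hr, mem_ball_zero_iff]; exact h)
  have hci : CircleIntegrable (fun w => ((w - 0) / (w - z)) • (1 : ℂ)) 0 r := by
    refine ContinuousOn.circleIntegrable hr.le ?_
    refine ContinuousOn.smul (ContinuousOn.div (by fun_prop) (by fun_prop) hne) (by fun_prop)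
  have e : Set.EqOn (fun w => (z - w)⁻¹)
      (fun w => z⁻¹ • ((1 : ℂ) - ((w - 0) / (w - z)) • (1 : ℂ))) (Metric.sphere 0 |r|) := by
    intro w hw
    rw [abs_of_pos hr] at hw
    have h1 := hne w hw
    have h2 : z - w ≠ 0 := by rw [← neg_sub]; exact neg_ne_zero.2 h1
    simp only [smul_eq_mul, sub_zero, mul_one]
    field_simp
    ring
  rw [Real.circleAverage_congr_sphere e, Real.circleAverage_fun_smul,
    Real.circleAverage_fun_sub (circleIntegrable_const _ _ _) hci, h1, Real.circleAverage_const,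
    sub_self, smul_zero]

/-- Newton's theorem for the kernel `1 / z`: only the mass inside the circle through `z` counts. -/
lemma integral_radial_smul_inv_sub {g : ℝ → ℝ} {z : ℂ} (hz : z ≠ 0)
    (hg : Integrable (fun w : ℂ => g ‖w‖ • (z - w)⁻¹)) :
    ∫ w : ℂ, g ‖w‖ • (z - w)⁻¹ = (2 * Real.pi * ∫ r in (0 : ℝ)..‖z‖, r * g r) • z⁻¹ := by
  have hz0 : 0 < ‖z‖ := norm_pos_iff.2 hz
  rw [integral_eq_integral_circleAverage hg]
  have hc : ∀ r, 0 < r → Real.circleAverage (fun w : ℂ => g ‖w‖ • (z - w)⁻¹) 0 r =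
      g r • Real.circleAverage (fun w : ℂ => (z - w)⁻¹) 0 r := by
    intro r hr
    rw [← Real.circleAverage_fun_smul]
    refine Real.circleAverage_congr_sphere fun w hw => ?_
    rw [abs_of_pos hr, mem_sphere_zero_iff_norm] at hw
    simp only [hw]
  have e : ∫ r in Set.Ioi (0 : ℝ),
        r • ((2 * Real.pi) • Real.circleAverage (fun w : ℂ => g ‖w‖ • (z - w)⁻¹) 0 r) =
      ∫ r in Set.Ioi (0 : ℝ), (Set.Ioc 0 ‖z‖).indicator
        (fun r => (r * g r) • ((2 * Real.pi) • z⁻¹)) r := by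
    refine setIntegral_congr_ae measurableSet_Ioi ?_
    have : ∀ᵐ r : ℝ, r ≠ ‖z‖ := by
      rw [ae_iff]; simp
    filter_upwards [this] with r hr (hr0 : 0 < r)
    rw [hc r hr0]
    rcases lt_or_gt_of_ne hr with h | h
    · rw [circleAverage_inv_sub_of_lt hr0 h, Set.indicator_of_mem (by exact ⟨hr0, h.le⟩)]
      module
    · rw [circleAverage_inv_sub_of_gt hz h, Set.indicator_of_notMem (by
        intro h'; exact absurd h'.2 (not_le.2 h))]
      simp
  rw [e, setIntegral_indicator measurableSet_Ioc,
    Set.inter_eq_right.2 Set.Ioc_subset_Ioi_self, integral_smul_const,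
    ← intervalIntegral.integral_of_le hz0.le, smul_smul, mul_comm]

/-! ### The Bessel potential of the harmonic field -/

lemma besselInt_zero_zero {l : ℝ} (hl : 0 < l) : besselInt 0 l 0 = l⁻¹ := by
  have h := integral_exp_mul_Ioi (neg_lt_zero.2 hl) 0
  simp only [besselInt, zero_div, sub_zero, pow_zero, inv_one, mul_one]
  simp only [neg_mul] at h
  rw [h]
  simp

lemma continuousOn_besselInt_zero {l : ℝ} (hl : 0 < l) :
    ContinuousOn (besselInt 0 l) (Set.Ici 0) := by
  refine continuousOn_of_dominated (bound := fun t => t ^ 0 * Real.exp (-(l * t)))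
    (fun ρ _ => (continuousOn_besselInt_integrand 0 l ρ).aestronglyMeasurable measurableSet_Ioi)
    (fun ρ (hρ : 0 ≤ ρ) => (ae_restrict_iff' measurableSet_Ioi).2
      (ae_of_all _ fun t (ht : 0 < t) => ?_))
    (integrableOn_pow_mul_exp_neg 0 hl) (ae_of_all _ fun t => ?_)
  · rw [Real.norm_of_nonneg (by positivity), pow_zero, inv_one, mul_one, one_mul]
    have : 0 ≤ ρ / (4 * t) := by positivity
    exact Real.exp_le_exp.2 (by linarith)
  · fun_prop

/-- The primitive of `r A₁(r²)` is `-2 A₀(r²)`, which is continuous up to `r = 0` while `A₁` has a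
logarithmic singularity there. -/
lemma integral_mul_besselInt_one {l R : ℝ} (hl : 0 < l) (hR : 0 < R) :
    (∫ r in (0 : ℝ)..R, r * besselInt 1 l (r ^ 2)) = 2 * (l⁻¹ - besselInt 0 l (R ^ 2)) ∧
    IntegrableOn (fun r => r * besselInt 1 l (r ^ 2)) (Set.Ioc 0 R) := by
  have hcont : ContinuousOn (fun r : ℝ => -(2 * besselInt 0 l (r ^ 2))) (Set.Icc 0 R) := by
    refine (continuousOn_const.mul ?_).neg
    exact (continuousOn_besselInt_zero hl).comp (by fun_prop) fun r _ => sq_nonneg r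
  have hder : ∀ r ∈ Set.Ioo 0 R, HasDerivAt (fun r : ℝ => -(2 * besselInt 0 l (r ^ 2)))
      (r * besselInt 1 l (r ^ 2)) r := by
    intro r hr
    have hr2 : 0 < r ^ 2 := pow_pos hr.1 2
    have h0 : HasDerivAt (besselInt 0 l) (-(besselInt (0 + 1) l (r ^ 2) / 4))
      ((fun r : ℝ => r ^ 2) r) := hasDerivAt_besselInt 0 hl hr2
    have h := ((HasDerivAt.comp (h := fun r : ℝ => r ^ 2) r h0 (hasDerivAt_pow 2 r)).const_mul 2).neg
    refine h.congr_deriv ?_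
    push_cast
    ring
  have hint := intervalIntegral.integrableOn_deriv_of_nonneg hcont hder
    fun r hr => mul_nonneg hr.1.le (besselInt_nonneg _ _ _)
  refine ⟨?_, hint⟩
  rw [intervalIntegral.integral_eq_sub_of_hasDerivAt_of_le hR.le hcont hder
    ((intervalIntegrable_iff_integrableOn_Ioc_of_le hR.le).2 hint)]
  simp only [ne_eq, OfNat.ofNat_ne_zero, not_false_eq_true, zero_pow, besselInt_zero_zero hl]
  ring

lemma integrable_besselInt_one_norm {l : ℝ} (hl : 0 < l) :
    Integrable (fun w : ℂ => besselInt 1 l (‖w‖ ^ 2)) := by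
  rw [integrable_fun_norm_addHaar (μ := volume) (E := ℂ) (f := fun r => besselInt 1 l (r ^ 2))]
  have hu : Set.Ioi (0 : ℝ) = Set.Ioc 0 1 ∪ Set.Ioi 1 := (Set.Ioc_union_Ioi_eq_Ioi zero_le_one).symm
  simp only [Complex.finrank_real_complex, Nat.add_one_sub_one, pow_one, smul_eq_mul]
  rw [hu]
  refine (integral_mul_besselInt_one hl one_pos).2.union ?_
  -- near infinity `A₁(r²) ≤ C r⁻⁴`
  obtain ⟨C, hC, hb⟩ := besselInt_le 1 (N := 2) (by norm_num) hl
  have h1 : IntegrableOn (fun r : ℝ => C * r ^ (-3 : ℝ)) (Set.Ioi 1) :=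
    (integrableOn_Ioi_rpow_of_lt (by norm_num) one_pos).const_mul C
  refine Integrable.mono' h1 ?_ ((ae_restrict_iff' measurableSet_Ioi).2
    (ae_of_all _ fun r (hr : 1 < r) => ?_))
  · refine (ContinuousOn.mul continuousOn_id ?_).aestronglyMeasurable measurableSet_Ioi
    exact (contDiffOn_besselInt 1 hl).continuousOn.comp (by fun_prop)
      fun r (hr : 1 < r) => pow_pos (by linarith : 0 < r) 2
  · have hr0 : 0 < r := by linarith
    rw [Real.norm_of_nonneg (mul_nonneg hr0.le (besselInt_nonneg _ _ _))]
    calc r * besselInt 1 l (r ^ 2) ≤ r * (C * ((r ^ 2) ^ 2)⁻¹) := by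
          gcongr; exact hb _ (by positivity)
      _ = C * r ^ (-3 : ℝ) := by
          rw [show (-3 : ℝ) = -((3 : ℕ) : ℝ) by norm_num, Real.rpow_neg hr0.le, Real.rpow_natCast]
          field_simp

/-- Near `z` the Bessel integral is bounded and `1/|z - w|` is integrable; away from `z` the factor
`1/|z - w|` is bounded and the Bessel integral is integrable. -/
lemma integrable_besselInt_one_smul_inv_sub {l : ℝ} (hl : 0 < l) {z : ℂ} (hz : z ≠ 0) :
    Integrable (fun w : ℂ => besselInt 1 l (‖w‖ ^ 2) • (z - w)⁻¹) := by
  set δ := ‖z‖ / 2 with hδ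
  have hz0 : 0 < ‖z‖ := norm_pos_iff.2 hz
  have hδ0 : 0 < δ := by positivity
  obtain ⟨C, hC, hb⟩ := besselInt_le 1 (N := 1) le_rfl hl
  have h1 := (integrable_besselInt_one_norm hl).const_mul δ⁻¹
  have h2 : Integrable (fun w : ℂ => (Set.Iio δ).indicator (fun r : ℝ => r⁻¹) ‖w‖) := by
    rw [integrable_fun_norm_addHaar (μ := volume) (E := ℂ)]
    have : IntegrableOn ((Set.Ioo 0 δ).indicator fun _ : ℝ => (1 : ℝ)) (Set.Ioi 0) :=
      (integrableOn_const (by simp)).integrable_indicator measurableSet_Ioo |>.integrableOn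
    refine this.congr_fun (fun r (hr : 0 < r) => ?_) measurableSet_Ioi
    by_cases h : r < δ
    · simp [h, hr, hr.ne']
    · simp [h]
  have h3 : Integrable (fun w : ℂ => (Set.Iio δ).indicator (fun r : ℝ => r⁻¹) ‖z - w‖) :=
    h2.comp_sub_left z
  refine Integrable.mono' (h1.add (h3.const_mul (C * (δ ^ 2)⁻¹))) ?_ (ae_of_all _ fun w => ?_)
  · refine AEStronglyMeasurable.smul (integrable_besselInt_one_norm hl).aestronglyMeasurable ?_
    exact (by fun_prop : Measurable fun w : ℂ => (z - w)⁻¹).aestronglyMeasurable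
  · rw [norm_smul, Real.norm_of_nonneg (besselInt_nonneg _ _ _), norm_inv, Pi.add_apply]
    have hnn := besselInt_nonneg 1 l (‖w‖ ^ 2)
    by_cases h : ‖z - w‖ < δ
    · rw [Set.indicator_of_mem (by exact h)]
      have hw : δ ≤ ‖w‖ := by
        have := norm_sub_norm_le z w
        rw [hδ] at *
        linarith
      have h4 : besselInt 1 l (‖w‖ ^ 2) ≤ C * (δ ^ 2)⁻¹ := by
        refine (hb _ (by have : 0 < ‖w‖ := by linarith
                         positivity)).trans ?_
        rw [pow_one]
        gcongr
      have : besselInt 1 l (‖w‖ ^ 2) * ‖z - w‖⁻¹ ≤ C * (δ ^ 2)⁻¹ * ‖z - w‖⁻¹ := by gcongr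
      have : 0 ≤ δ⁻¹ * besselInt 1 l (‖w‖ ^ 2) := by positivity
      linarith
    · rw [Set.indicator_of_notMem (by exact h)]
      have : ‖z - w‖⁻¹ ≤ δ⁻¹ := inv_anti₀ hδ0 (not_lt.1 h)
      nlinarith

/-- The substitution `t ↦ l t`; for `m = 1` the measure `dt / t` is scale invariant. -/
lemma besselInt_one_one_mul {l : ℝ} (hl : 0 < l) (ρ : ℝ) :
    besselInt 1 1 (l * ρ) = besselInt 1 l ρ := by
  have h := integral_comp_mul_left_Ioi
    (fun t => Real.exp (-(1 * t) - l * ρ / (4 * t)) * (t ^ 1)⁻¹) 0 hl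
  rw [mul_zero] at h
  rw [besselInt, besselInt]
  have h2 : ∫ t in Set.Ioi (0 : ℝ), Real.exp (-(1 * t) - l * ρ / (4 * t)) * (t ^ 1)⁻¹ =
    l • ∫ t in Set.Ioi (0 : ℝ),
      Real.exp (-(1 * (l * t)) - l * ρ / (4 * (l * t))) * ((l * t) ^ 1)⁻¹ := by
    rw [h, smul_smul, mul_inv_cancel₀ hl.ne', one_smul]
  rw [h2, smul_eq_mul, ← integral_const_mul]
  refine setIntegral_congr_fun measurableSet_Ioi fun t (ht : 0 < t) => ?_
  have e1 : -(1 * (l * t)) - l * ρ / (4 * (l * t)) = -(l * t) - ρ / (4 * t) := by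
    field_simp
  simp only [e1]
  field_simp

/-- The kernel of `(1 - α Δ)⁻¹` is a multiple of `A₁^{1/α}(|x|²)`. -/
lemma greenKernel_eq {α : ℝ} (hα : 0 < α) (x : Plane) :
    greenKernel α x = α⁻¹ / (4 * Real.pi) * besselInt 1 α⁻¹ (‖x‖ ^ 2) := by
  rw [greenKernel, besselKernel, ← besselInt_one_one_mul (inv_pos.2 hα), besselInt, mul_comm_div,
    ← integral_div]
  congr 1
  refine setIntegral_congr_fun measurableSet_Ioi fun t (ht : 0 < t) => ?_
  have e : ‖(Real.sqrt α)⁻¹ • x‖ ^ 2 = α⁻¹ * ‖x‖ ^ 2 := by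
    rw [norm_smul, mul_pow, norm_inv, inv_pow, Real.norm_of_nonneg (Real.sqrt_nonneg _),
      Real.sq_sqrt hα.le]
  simp only [e]
  rw [sub_eq_add_neg, Real.exp_add, one_mul]
  field_simp

lemma toC_harmonicField (x : Plane) :
    toC (harmonicField x) = (Complex.I / (2 * Real.pi)) * (starRingEnd ℂ) (toC x)⁻¹ := by
  rw [harmonicField, map_smul, toC_perp, ← norm_toC, Complex.real_smul]
  rcases eq_or_ne (toC x) 0 with h | h
  · simp [h]
  have h2 : ((‖toC x‖ : ℂ)) ^ 2 = toC x * (starRingEnd ℂ) (toC x) := by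
    rw [Complex.mul_conj, Complex.normSq_eq_norm_sq]; norm_cast
  have h3 : (starRingEnd ℂ) (toC x) ≠ 0 := (map_ne_zero _).2 h
  have hpi : (Real.pi : ℂ) ≠ 0 := by exact_mod_cast Real.pi_ne_zero
  push_cast
  rw [h2, map_inv₀]
  field_simp

/-- `K^α = (1/(2πρ) - A(ρ)/(8π)) x^⊥` with `ρ = |x|²` and `A` the integral `besselInt 2 α⁻¹`. -/
lemma smoothedField_eq {α : ℝ} (hα : 0 < α) {x : Plane} (hx : x ≠ 0) :
    smoothedField α x = (1 / (2 * Real.pi * ‖x‖ ^ 2) -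
      besselInt 2 α⁻¹ (‖x‖ ^ 2) / (8 * Real.pi)) • perp x := by
  set l := α⁻¹ with hl
  have hl0 : 0 < l := inv_pos.2 hα
  have hx0 : 0 < ‖x‖ := norm_pos_iff.2 hx
  have hz : toC x ≠ 0 := (map_ne_zero_iff toC toC.injective).2 hx
  apply toC.injective
  have e1 : toC (smoothedField α x) = ∫ y, toC (greenKernel α y • harmonicField (x - y)) := by
    rw [smoothedField, convolution_def]
    simp only [ContinuousLinearMap.lsmul_apply]
    exact (toC.toContinuousLinearEquiv.integral_comp_comm _).symm
  have e2 : ∀ y, toC (greenKernel α y • harmonicField (x - y)) =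
      (fun w : ℂ => (l / (4 * Real.pi) * (Complex.I / (2 * Real.pi))) *
        (starRingEnd ℂ) (besselInt 1 l (‖w‖ ^ 2) • (toC x - w)⁻¹)) (toC y) := by
    intro y
    simp only
    rw [map_smul, toC_harmonicField, greenKernel_eq hα, ← hl, map_sub, norm_toC, Complex.real_smul,
      Complex.real_smul, map_mul, Complex.conj_ofReal]
    push_cast
    ring
  rw [e1]
  simp_rw [e2]
  rw [integral_comp_toC (fun w : ℂ => (l / (4 * Real.pi) * (Complex.I / (2 * Real.pi))) *
        (starRingEnd ℂ) (besselInt 1 l (‖w‖ ^ 2) • (toC x - w)⁻¹)), integral_const_mul,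
    integral_conj, integral_radial_smul_inv_sub (g := fun r => besselInt 1 l (r ^ 2)) hz
      (integrable_besselInt_one_smul_inv_sub hl0 hz),
    norm_toC, (integral_mul_besselInt_one hl0 hx0).1, toC.map_smul, toC_perp, Complex.real_smul,
    Complex.real_smul, map_mul, Complex.conj_ofReal, map_inv₀]
  have h2 : ((‖x‖ : ℂ)) ^ 2 = toC x * (starRingEnd ℂ) (toC x) := by
    rw [Complex.mul_conj, Complex.normSq_eq_norm_sq, norm_toC]; norm_cast
  have h3 : (starRingEnd ℂ) (toC x) ≠ 0 := (map_ne_zero _).2 hz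
  have hpi : (Real.pi : ℂ) ≠ 0 := by exact_mod_cast Real.pi_ne_zero
  have hlc : (l : ℂ) ≠ 0 := by exact_mod_cast hl0.ne'
  have hrec := besselInt_recurrence 0 hl0 (pow_pos hx0 2)
  simp only [Nat.cast_zero, zero_mul, zero_add] at hrec
  have hrec' : (besselInt 0 l (‖x‖ ^ 2) : ℂ) =
      ((toC x * (starRingEnd ℂ) (toC x)) / 4 * besselInt 2 l (‖x‖ ^ 2)) / l := by
    rw [← h2, eq_div_iff hlc, mul_comm]
    exact_mod_cast hrec.symm
  push_cast
  rw [hrec', h2]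
  field_simp
  ring

/-! ### Azimuthal fields -/

/-- An azimuthal field `f(|x|) x^⊥` is divergence free and tangent to all circles: on each circle, the
pairing with `∇φ` is `f` times the angular derivative of `φ`, which has mean zero. -/
lemma integral_fderiv_smul_perp (φ : Plane → ℝ) (hφ : ContDiff ℝ ∞ φ) (f : ℝ → ℝ)
    (hf : Integrable (fun x => fderiv ℝ φ x (f ‖x‖ • perp x))) :
    ∫ x, fderiv ℝ φ x (f ‖x‖ • perp x) = 0 := by
  set F : ℂ → ℝ := fun z => fderiv ℝ φ (toC.symm z) (f ‖toC.symm z‖ • perp (toC.symm z)) with hF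
  have e : ∀ x, fderiv ℝ φ x (f ‖x‖ • perp x) = F (toC x) := by intro x; simp [hF]
  simp_rw [e] at hf ⊢
  rw [integral_comp_toC F, integral_eq_integral_circleAverage (integrable_comp_toC.1 hf)]
  refine setIntegral_eq_zero_of_forall_eq_zero fun r (hr : 0 < r) => ?_
  have hc : Real.circleAverage F 0 r = 0 := by
    rw [Real.circleAverage_def]
    have hd : ∀ θ ∈ Set.uIcc 0 (2 * Real.pi), HasDerivAt
        (fun θ => f r * φ (toC.symm (circleMap 0 r θ))) (F (circleMap 0 r θ)) θ := by
      intro θ _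
      have h1 := toC.symm.toContinuousLinearEquiv.toContinuousLinearMap.hasFDerivAt.comp_hasDerivAt θ
        (hasDerivAt_circleMap 0 r θ)
      have h2 := ((hφ.differentiable (by simp) _).hasFDerivAt.comp_hasDerivAt θ h1).const_mul (f r)
      refine h2.congr_deriv ?_
      simp only [hF, LinearIsometryEquiv.norm_map, norm_circleMap_zero, abs_of_pos hr, map_smul,
        smul_eq_mul]
      congr 2
      apply toC.injective
      rw [toC_perp]
      simp [mul_comm]
    rw [intervalIntegral.integral_eq_sub_of_hasDerivAt hd]
    · simp [circleMap]
    · refine Continuous.intervalIntegrable ?_ _ _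
      have : (fun θ => F (circleMap 0 r θ)) = fun θ =>
          fderiv ℝ φ (toC.symm (circleMap 0 r θ)) (f r • toC.symm (Complex.I * circleMap 0 r θ)) := by
        funext θ
        simp only [hF, LinearIsometryEquiv.norm_map, norm_circleMap_zero, abs_of_pos hr]
        congr 2
        apply toC.injective
        rw [toC_perp]
        simp
      rw [this]
      have hcm : Continuous fun θ => toC.symm (circleMap 0 r θ) :=
        toC.symm.continuous.comp (continuous_circleMap 0 r)
      refine Continuous.clm_apply ((hφ.continuous_fderiv (by simp)).comp hcm) ?_
      exact (toC.symm.continuous.comp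
        (continuous_const.mul (continuous_circleMap 0 r))).const_smul (f r)
  rw [hc]
  simp

/-! ### Integrability in the exterior of a disk -/

lemma isOpen_extDisk (ε : ℝ) : IsOpen (extDisk ε) := isOpen_lt continuous_const continuous_norm

lemma measurableSet_extDisk (ε : ℝ) : MeasurableSet (extDisk ε) := (isOpen_extDisk ε).measurableSet

lemma ne_zero_of_mem_extDisk {ε : ℝ} (hε : 0 < ε) {x : Plane} (hx : x ∈ extDisk ε) : x ≠ 0 :=
  norm_pos_iff.1 (hε.trans hx)

lemma extDisk_subset {ε : ℝ} (hε : 0 < ε) : extDisk ε ⊆ ({0}ᶜ : Set Plane) :=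
  fun _ hx => ne_zero_of_mem_extDisk hε hx

lemma isOpen_punctured : IsOpen ({0}ᶜ : Set Plane) := isOpen_compl_singleton

/-- Outside the disk, `|x|^{-s}` is comparable to `(1 + |x|)^{-s}`. -/
lemma memLp_inv_norm_pow {ε : ℝ} (hε : 0 < ε) {s : ℕ} {q : ℝ≥0∞} (hq : q ≠ ⊤)
    (hsq : 2 < s * q.toReal) :
    MemLp (fun x : Plane => (‖x‖ ^ s)⁻¹) q (volume.restrict (extDisk ε)) := by
  have hq0 : 0 < q.toReal := by
    by_contra h
    have : q.toReal = 0 := le_antisymm (not_lt.1 h) ENNReal.toReal_nonneg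
    rw [this] at hsq; simp at hsq; linarith
  have hm : Measurable (fun x : Plane => (‖x‖ ^ s)⁻¹) := by fun_prop
  rw [← integrable_norm_rpow_iff hm.aestronglyMeasurable (ENNReal.toReal_pos_iff.1 hq0).1.ne' hq]
  have h1 : Integrable (fun x : Plane => (1 + ‖x‖) ^ (-(s * q.toReal))) :=
    integrable_one_add_norm (by simpa using hsq)
  refine Integrable.mono' ((h1.const_mul ((1 + ε⁻¹) ^ (s * q.toReal))).restrict (s := extDisk ε))
    (hm.norm.pow_const _).aestronglyMeasurable
    ((ae_restrict_iff' (measurableSet_extDisk ε)).2 (ae_of_all _ fun x hx => ?_))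
  have hx0 : 0 < ‖x‖ := hε.trans hx
  rw [Real.norm_of_nonneg (by positivity), Real.norm_of_nonneg (by positivity),
    Real.rpow_neg (by positivity), Real.inv_rpow (by positivity), ← Real.rpow_natCast,
    ← Real.rpow_mul hx0.le]
  have h2 : 1 + ‖x‖ ≤ (1 + ε⁻¹) * ‖x‖ := by
    have : 1 ≤ ε⁻¹ * ‖x‖ := by
      rw [inv_mul_eq_div, one_le_div hε]; exact le_of_lt hx
    linarith
  have h3 : (1 + ‖x‖) ^ (s * q.toReal) ≤ (1 + ε⁻¹) ^ (s * q.toReal) * ‖x‖ ^ (s * q.toReal) := by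
    rw [← Real.mul_rpow (by positivity) hx0.le]
    exact Real.rpow_le_rpow (by positivity) h2 (by positivity)
  rw [inv_le_iff_one_le_mul₀ (by positivity), mul_right_comm,
    ← div_eq_mul_inv, one_le_div (by positivity)]
  exact h3

lemma memLp_of_decay {F : Type*} [NormedAddCommGroup F] {ε : ℝ} (hε : 0 < ε) {s : ℕ}
    {q : ℝ≥0∞} (hq : q ≠ ⊤) (hsq : 2 < s * q.toReal) {f : Plane → F}
    (hf : AEStronglyMeasurable f (volume.restrict (extDisk ε))) {C : ℝ}
    (hb : ∀ x ∈ extDisk ε, ‖f x‖ ≤ C * (‖x‖ ^ s)⁻¹) :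
    MemLp f q (volume.restrict (extDisk ε)) :=
  ((memLp_inv_norm_pow hε hq hsq).const_mul C).mono' hf
    ((ae_restrict_iff' (measurableSet_extDisk ε)).2 (ae_of_all _ hb))

/-- Dominated convergence in `L^q`. -/
lemma tendsto_eLpNorm_sub_of_dominated {X F : Type*} [MeasurableSpace X] {μ : Measure X}
    [NormedAddCommGroup F] {q : ℝ≥0∞} (hq0 : q ≠ 0) (hq : q ≠ ⊤) {f : ℕ → X → F} {g : X → F}
    {b : X → ℝ} (hf : ∀ n, AEStronglyMeasurable (f n) μ) (hg : AEStronglyMeasurable g μ)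
    (hb : MemLp b q μ) (hfb : ∀ n, ∀ᵐ x ∂μ, ‖f n x‖ ≤ b x)
    (hlim : ∀ᵐ x ∂μ, Tendsto (fun n => f n x) atTop (𝓝 (g x))) :
    Tendsto (fun n => eLpNorm (fun x => f n x - g x) q μ) atTop (𝓝 0) := by
  have hqr : 0 < q.toReal := ENNReal.toReal_pos hq0 hq
  have hgb : ∀ᵐ x ∂μ, ‖g x‖ ≤ b x := by
    filter_upwards [hlim, ae_all_iff.2 hfb] with x h1 h2
    exact le_of_tendsto h1.norm (Eventually.of_forall h2)
  have hb2 : MemLp (fun x => 2 * b x) q μ := hb.const_mul 2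
  have key : Tendsto (fun n => ∫⁻ x, ‖f n x - g x‖ₑ ^ q.toReal ∂μ) atTop
      (𝓝 (∫⁻ _, 0 ∂μ)) := by
    refine tendsto_lintegral_of_dominated_convergence' (fun x => ‖2 * b x‖ₑ ^ q.toReal)
      (fun n => (((hf n).sub hg).enorm).pow_const _) (fun n => ?_) ?_ ?_
    · filter_upwards [hfb n, hgb] with x h1 h2
      refine ENNReal.rpow_le_rpow ?_ hqr.le
      rw [enorm_le_iff_norm_le]
      refine (norm_sub_le _ _).trans (le_trans (by linarith) (le_abs_self _))
    · have := lintegral_rpow_enorm_lt_top_of_eLpNorm_lt_top hq0 hq hb2.2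
      exact this.ne
    · filter_upwards [hlim] with x hx
      have h0 : Tendsto (fun n => ‖f n x - g x‖ₑ) atTop (𝓝 0) := by
        have := (hx.sub_const (g x)).enorm
        rwa [sub_self, enorm_zero] at this
      have := (ENNReal.continuous_rpow_const (y := q.toReal)).tendsto 0
      rw [ENNReal.zero_rpow_of_pos hqr] at this
      exact this.comp h0
  rw [lintegral_zero] at key
  have h2 := (ENNReal.continuous_rpow_const (y := 1 / q.toReal)).tendsto 0
  rw [ENNReal.zero_rpow_of_pos (by positivity)] at h2
  refine (h2.comp key).congr fun n => ?_
  rw [eLpNorm_eq_lintegral_rpow_enorm_toReal hq0 hq]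
  rfl

section Pairing

variable {X : Type*} [MeasurableSpace X] {μ : Measure X} {p q : ℝ≥0∞}

lemma integrable_inner_of_memLp [ENNReal.HolderConjugate p q] {f g : X → Plane}
    (hf : MemLp f p μ) (hg : MemLp g q μ) : Integrable (fun x => inner ℝ (f x) (g x)) μ := by
  refine Integrable.mono' (hf.norm.integrable_mul hg.norm) (hf.1.inner hg.1) (ae_of_all _ fun x => ?_)
  exact norm_inner_le_norm _ _

lemma norm_integral_inner_le [ENNReal.HolderConjugate p q] {f g : X → Plane}
    (hf : MemLp f p μ) (hg : MemLp g q μ) :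
    ‖∫ x, inner ℝ (f x) (g x) ∂μ‖ₑ ≤ eLpNorm f p μ * eLpNorm g q μ := by
  refine (enorm_integral_le_lintegral_enorm _).trans ?_
  rw [← eLpNorm_one_eq_lintegral_enorm]
  have := eLpNorm_le_eLpNorm_mul_eLpNorm'_of_norm (p := p) (q := q) (r := 1) hf.1 hg.1
    (fun a b => (inner ℝ a b : ℝ)) 1
    (ae_of_all _ fun x => by simpa using norm_inner_le_norm (𝕜 := ℝ) (f x) (g x))
  simpa using this

lemma tendsto_integral_inner_of_tendsto_eLpNorm [ENNReal.HolderConjugate p q] {f : ℕ → X → Plane}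
    {f₀ g : X → Plane} (hf : ∀ n, MemLp (f n) p μ) (hf₀ : MemLp f₀ p μ) (hg : MemLp g q μ)
    (hlim : Tendsto (fun n => eLpNorm (fun x => f n x - f₀ x) p μ) atTop (𝓝 0)) :
    Tendsto (fun n => ∫ x, inner ℝ (f n x) (g x) ∂μ) atTop (𝓝 (∫ x, inner ℝ (f₀ x) (g x) ∂μ)) := by
  rw [tendsto_iff_edist_tendsto_0]
  have h1 : Tendsto (fun n => eLpNorm (fun x => f n x - f₀ x) p μ * eLpNorm g q μ) atTop (𝓝 0) := by
    have := ENNReal.Tendsto.mul_const (b := eLpNorm g q μ) hlim (Or.inr hg.2.ne)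
    rwa [zero_mul] at this
  refine tendsto_of_tendsto_of_tendsto_of_le_of_le tendsto_const_nhds h1 (fun _ => zero_le) fun n => ?_
  rw [edist_eq_enorm_sub, ← integral_sub (integrable_inner_of_memLp (hf n) hg)
    (integrable_inner_of_memLp hf₀ hg)]
  simp_rw [← inner_sub_left]
  exact norm_integral_inner_le ((hf n).sub hf₀) hg

end Pairing

/-- Passing to the limit in a pairing with an `L^p` field under the bound `C |x|^{-s}`. -/
lemma tendsto_integral_inner_of_decay {ε : ℝ} (hε : 0 < ε) {s : ℕ} {p q : ℝ≥0∞}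
    [ENNReal.HolderConjugate p q] (hq : q ≠ ⊤) (hsq : 2 < s * q.toReal) {w : Plane → Plane}
    (hw : MemLp w p (volume.restrict (extDisk ε))) {g : ℕ → Plane → Plane} {g₀ : Plane → Plane}
    (hg : ∀ n, AEStronglyMeasurable (g n) (volume.restrict (extDisk ε))) {C : ℝ}
    (hb : ∀ n, ∀ x ∈ extDisk ε, ‖g n x‖ ≤ C * (‖x‖ ^ s)⁻¹)
    (hlim : ∀ x ∈ extDisk ε, Tendsto (fun n => g n x) atTop (𝓝 (g₀ x))) :
    Tendsto (fun n => ∫ x in extDisk ε, inner ℝ (w x) (g n x)) atTop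
      (𝓝 (∫ x in extDisk ε, inner ℝ (w x) (g₀ x))) := by
  refine tendsto_integral_of_dominated_convergence (fun x => ‖w x‖ * (C * (‖x‖ ^ s)⁻¹))
    (fun n => hw.1.inner (hg n))
    (hw.norm.integrable_mul ((memLp_inv_norm_pow hε hq hsq).const_mul C)) (fun n => ?_) ?_
  · refine (ae_restrict_iff' (measurableSet_extDisk ε)).2 (ae_of_all _ fun x hx => ?_)
    refine (norm_inner_le_norm _ _).trans ?_
    gcongr
    exact hb n x hx
  · refine (ae_restrict_iff' (measurableSet_extDisk ε)).2 (ae_of_all _ fun x hx => ?_)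
    exact tendsto_const_nhds.inner (hlim x hx)

/-! ### Integration by parts and weak derivatives -/

/-- The classical partial derivative `∂ᵢ u`. -/
noncomputable def pderiv {F : Type*} [NormedAddCommGroup F] [NormedSpace ℝ F] (i : Fin 2)
    (u : Plane → F) (x : Plane) : F := fderiv ℝ u x (stdVec i)

lemma contDiffOn_pderiv {F : Type*} [NormedAddCommGroup F] [NormedSpace ℝ F] {u : Plane → F}
    {s : Set Plane} (hs : IsOpen s) (hu : ContDiffOn ℝ ∞ u s) (i : Fin 2) :
    ContDiffOn ℝ ∞ (pderiv i u) s :=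
  (hu.fderiv_of_isOpen hs (by simp)).clm_apply contDiffOn_const

/-- Integration by parts for a bilinear pairing, one factor being a test function on `Ω` and the
other smooth on `Ω` only. -/
lemma integral_bilin_pderiv {F G W : Type*} [NormedAddCommGroup F] [NormedSpace ℝ F]
    [NormedAddCommGroup G] [NormedSpace ℝ G] [NormedAddCommGroup W] [NormedSpace ℝ W]
    (B : F →L[ℝ] G →L[ℝ] W) {Ω : Set Plane} (hΩ : IsOpen Ω) {φ : Plane → F} {g : Plane → G}
    (hφ : ContDiff ℝ ∞ φ) (hc : HasCompactSupport φ) (hs : tsupport φ ⊆ Ω)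
    (hg : ContDiffOn ℝ ∞ g Ω) (i : Fin 2) :
    ∫ x in Ω, B (pderiv i φ x) (g x) = -∫ x in Ω, B (φ x) (pderiv i g x) := by
  have hφ' : ContDiff ℝ ∞ (pderiv i φ) := by
    rw [← contDiffOn_univ] at hφ ⊢
    exact contDiffOn_pderiv isOpen_univ hφ i
  have hsup : ∀ x, x ∉ tsupport φ → pderiv i φ x = 0 := fun x hx => by
    rw [pderiv, fderiv_of_notMem_tsupport ℝ hx]; rfl
  have hint : ∀ {ψ : Plane → F} {γ : Plane → G}, Continuous ψ → ContinuousOn γ Ω →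
      (∀ x, x ∉ tsupport φ → ψ x = 0) → Integrable (fun x => B (ψ x) (γ x)) := by
    intro ψ γ hψ hγ h0
    rw [← integrableOn_iff_integrable_of_support_subset (s := tsupport φ)]
    · refine ContinuousOn.integrableOn_compact hc ?_
      exact (B.continuous.comp_continuousOn hψ.continuousOn).clm_apply (hγ.mono hs)
    · intro x hx
      by_contra h
      exact hx (by simp [h0 x h])
  have hset : ∀ {ψ : Plane → F} {γ : Plane → G}, (∀ x, x ∉ tsupport φ → ψ x = 0) →
      ∫ x in Ω, B (ψ x) (γ x) = ∫ x, B (ψ x) (γ x) := by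
    intro ψ γ h0
    refine setIntegral_eq_integral_of_forall_compl_eq_zero fun x hx => ?_
    simp [h0 x fun h => hx (hs h)]
  have hg' := contDiffOn_pderiv hΩ hg i
  have h0 : ∀ x, x ∉ tsupport φ → φ x = 0 := fun x hx => image_eq_zero_of_notMem_tsupport hx
  rw [hset hsup, hset h0]
  have := integral_bilinear_hasFDerivAt_right_eq_neg_left_of_integrable (μ := volume) (B := B)
    (f := φ) (f' := fderiv ℝ φ) (g := g) (g' := fderiv ℝ g) (v := stdVec i)
    (hint hφ'.continuous hg.continuousOn hsup) (hint hφ.continuous hg'.continuousOn h0)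
    (hint hφ.continuous hg.continuousOn h0)
    (fun x _ => (hφ.differentiable (by simp) x).hasFDerivAt)
    (fun x hx => ((hg.contDiffAt (hΩ.mem_nhds (hs hx))).differentiableAt (by simp)).hasFDerivAt)
  exact (neg_eq_iff_eq_neg.2 this).symm

lemma hasWeakPartial_pderiv {Ω : Set Plane} (hΩ : IsOpen Ω) {u : Plane → Plane}
    (hu : ContDiffOn ℝ ∞ u Ω) (i : Fin 2) : HasWeakPartial Ω i u (pderiv i u) := by
  refine ⟨hu.continuousOn.locallyIntegrableOn hΩ.measurableSet,
    (contDiffOn_pderiv hΩ hu i).continuousOn.locallyIntegrableOn hΩ.measurableSet, ?_⟩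
  intro φ hφ hc hs
  exact integral_bilin_pderiv (ContinuousLinearMap.lsmul ℝ ℝ) hΩ hφ hc hs hu i

lemma HasWeakPartial.congr {Ω : Set Plane} (hΩ : MeasurableSet Ω) {i : Fin 2}
    {u u' g : Plane → Plane} (h : HasWeakPartial Ω i u g) (hu' : LocallyIntegrableOn u' Ω)
    (hu : Set.EqOn u' u Ω) : HasWeakPartial Ω i u' g := by
  refine ⟨hu', h.2.1, fun φ h1 h2 h3 => ?_⟩
  rw [← h.2.2 φ h1 h2 h3]
  exact setIntegral_congr_fun hΩ fun x hx => by simp only [hu hx]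

/-- The `j`-th coordinate as a continuous linear functional. -/
noncomputable abbrev coord (j : Fin 2) : Plane →L[ℝ] ℝ := EuclideanSpace.proj j

lemma stdVec_apply (i j : Fin 2) : stdVec i j = if j = i then 1 else 0 := by
  simp [stdVec]

lemma pderiv_apply {u : Plane → Plane} {x : Plane} (hu : DifferentiableAt ℝ u x) (i j : Fin 2) :
    pderiv i (fun y => u y j) x = pderiv i u x j := by
  have h := (coord j).hasFDerivAt.comp x
    hu.hasFDerivAt
  have h2 : HasFDerivAt (fun y => u y j)
    ((coord j).comp (fderiv ℝ u x)) x := h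
  rw [pderiv, h2.fderiv]
  rfl

lemma fderiv_apply_eq_sum (φ : Plane → ℝ) (x v : Plane) :
    fderiv ℝ φ x v = ∑ i, v i * pderiv i φ x := by
  have h : v = ∑ i, v i • stdVec i := by
    ext j
    fin_cases j <;> simp [Fin.sum_univ_two, stdVec_apply]
  conv_lhs => rw [h]
  rw [map_sum]
  simp [pderiv]

/-- A weak partial derivative may be tested against compactly supported vector fields. -/
lemma HasWeakPartial.integral_inner {Ω : Set Plane} {i : Fin 2}
    {u g φ : Plane → Plane} (h : HasWeakPartial Ω i u g)
    (hφ : ContDiff ℝ ∞ φ) (hc : HasCompactSupport φ) (hs : tsupport φ ⊆ Ω) :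
    ∫ x in Ω, inner ℝ (g x) (φ x) = -∫ x in Ω, inner ℝ (u x) (pderiv i φ x) := by
  have hint : ∀ {ψ : Plane → ℝ} {v : Plane → Plane}, Continuous ψ → LocallyIntegrableOn v Ω →
      (∀ x, x ∉ tsupport φ → ψ x = 0) → Integrable (fun x => ψ x • v x) (volume.restrict Ω) := by
    intro ψ v hψ hv h0
    have h1 : IntegrableOn (fun x => ψ x • v x) (tsupport φ) :=
      (hv.integrableOn_compact_subset hs hc).continuousOn_smul hψ.continuousOn hc
    have h2 : Integrable (fun x => ψ x • v x) :=
      (integrableOn_iff_integrable_of_support_subset fun x hx => by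
        by_contra h; exact hx (by simp [h0 x h])).1 h1
    exact h2.restrict
  have hj : ∀ j, ContDiff ℝ ∞ (fun x => φ x j) := fun j => by
    exact (coord j).contDiff.comp hφ
  have hz : ∀ x, x ∉ tsupport φ → φ x = 0 := fun x hx => image_eq_zero_of_notMem_tsupport hx
  have hz' : ∀ x, x ∉ tsupport φ → pderiv i φ x = 0 := fun x hx => by
    rw [pderiv, fderiv_of_notMem_tsupport ℝ hx]; rfl
  have hd : ∀ x, DifferentiableAt ℝ φ x := hφ.differentiable (by simp)
  have hφ' : ContDiff ℝ ∞ (pderiv i φ) := by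
    rw [← contDiffOn_univ] at hφ ⊢
    exact contDiffOn_pderiv isOpen_univ hφ i
  -- the definition of the weak derivative, applied to the `j`-th coordinate of `φ` and read off in
  -- the `j`-th coordinate of the vector-valued identity
  have hcomp : ∀ j, ∫ x in Ω, pderiv i φ x j * u x j = -∫ x in Ω, φ x j * g x j := by
    intro j
    have hsub : tsupport (fun x => φ x j) ⊆ tsupport φ :=
      closure_mono fun x hx h => hx (by simp [h])
    have h1 := h.2.2 (fun x => φ x j) (hj j) (hc.of_isClosed_subset (isClosed_tsupport _) hsub)
      (hsub.trans hs)
    have h2 := congrArg (coord j) h1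
    have e : ∀ x, fderiv ℝ (fun y => φ y j) x (stdVec i) = pderiv i φ x j :=
      fun x => pderiv_apply (hd x) i j
    simp_rw [e] at h2
    have hcj : Continuous fun x => pderiv i φ x j :=
      (coord j).continuous.comp hφ'.continuous
    rw [map_neg, ← ContinuousLinearMap.integral_comp_comm _
      (hint hcj h.1 fun x hx => by simp [hz' x hx]),
      ← ContinuousLinearMap.integral_comp_comm _
      (hint (hj j).continuous h.2.1 fun x hx => by simp [hz x hx])] at h2
    simpa using h2
  have hi : ∀ {ψ v : Plane → Plane}, Continuous ψ → LocallyIntegrableOn v Ω →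
      (∀ x, x ∉ tsupport φ → ψ x = 0) → ∀ j, Integrable (fun x => ψ x j * v x j)
        (volume.restrict Ω) := by
    intro ψ v hψ hv h0 j
    have hcj : Continuous fun x => ψ x j :=
      (coord j).continuous.comp hψ
    exact (coord j).integrable_comp
      (hint hcj hv fun x hx => by simp [h0 x hx])
  have hin : ∀ a b : Plane, inner ℝ a b = b 0 * a 0 + b 1 * a 1 := fun a b => by
    simp [PiLp.inner_apply, Fin.sum_univ_two]
  simp_rw [hin]
  rw [integral_add (hi hφ.continuous h.2.1 hz 0) (hi hφ.continuous h.2.1 hz 1),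
    integral_add (hi hφ'.continuous h.1 hz' 0) (hi hφ'.continuous h.1 hz' 1), hcomp 0, hcomp 1]
  ring

/-- Weak derivatives are unique almost everywhere. -/
lemma HasWeakPartial.ae_unique {Ω : Set Plane} (hΩ : IsOpen Ω) {i : Fin 2}
    {u g g' : Plane → Plane} (h : HasWeakPartial Ω i u g) (h' : HasWeakPartial Ω i u g') :
    g =ᵐ[volume.restrict Ω] g' := by
  have key := hΩ.ae_eq_zero_of_integral_contDiff_smul_eq_zero (μ := volume)
    (f := fun x => g x - g' x) (h.2.1.sub h'.2.1) (fun φ hφ hc hs => ?_)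
  · refine (ae_restrict_iff' hΩ.measurableSet).2 ?_
    filter_upwards [key] with x hx hxΩ
    exact sub_eq_zero.1 (hx hxΩ)
  · have hint : ∀ {v : Plane → Plane}, LocallyIntegrableOn v Ω →
        Integrable (fun x => φ x • v x) (volume.restrict Ω) := by
      intro v hv
      have h1 : IntegrableOn (fun x => φ x • v x) (tsupport φ) :=
        (hv.integrableOn_compact_subset hs hc).continuousOn_smul hφ.continuous.continuousOn hc
      exact ((integrableOn_iff_integrable_of_support_subset fun x hx => by
        by_contra h
        exact hx (by simp [image_eq_zero_of_notMem_tsupport h])).1 h1).restrict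
    have e := (h.2.2 φ hφ hc hs).symm.trans (h'.2.2 φ hφ hc hs)
    rw [neg_inj] at e
    rw [← setIntegral_eq_integral_of_forall_compl_eq_zero (s := Ω)]
    · simp_rw [smul_sub]
      rw [integral_sub (hint h.2.1) (hint h'.2.1), e, sub_self]
    · intro x hx
      rw [image_eq_zero_of_notMem_tsupport fun h => hx (hs h), zero_smul]

/-! ### Smooth fields vanishing on the boundary -/

/-- A field that is smooth in the punctured plane, decays like `|x|^{-s}` in the exterior of the disk
of radius `ε` together with its first and second derivatives, and vanishes on the boundary. The
latter is recorded through what it is used for: approximation by test fields which eventually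
coincide with the field near each point and obey the same decay bounds up to first order. -/
structure VanishingField (ε : ℝ) (s : ℕ) (h : Plane → Plane) : Prop where
  smooth : ContDiffOn ℝ ∞ h {0}ᶜ
  bound : ∃ C, ∀ x ∈ extDisk ε, ‖h x‖ ≤ C * (‖x‖ ^ s)⁻¹ ∧
    (∀ i, ‖pderiv i h x‖ ≤ C * (‖x‖ ^ s)⁻¹) ∧
    ∀ i j, ‖pderiv j (pderiv i h) x‖ ≤ C * (‖x‖ ^ s)⁻¹
  approx : ∃ (φ : ℕ → Plane → Plane) (C : ℝ),
    (∀ n, ContDiff ℝ ∞ (φ n) ∧ HasCompactSupport (φ n) ∧ tsupport (φ n) ⊆ extDisk ε) ∧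
    (∀ n, ∀ x ∈ extDisk ε, ‖φ n x‖ ≤ C * (‖x‖ ^ s)⁻¹ ∧ ∀ i, ‖pderiv i (φ n) x‖ ≤ C * (‖x‖ ^ s)⁻¹) ∧
    ∀ x ∈ extDisk ε, ∀ᶠ n in atTop, φ n =ᶠ[𝓝 x] h

lemma VanishingField.add {ε : ℝ} (hε : 0 < ε) {s : ℕ} {h k : Plane → Plane}
    (hh : VanishingField ε s h) (hk : VanishingField ε s k) :
    VanishingField ε s (fun x => h x + k x) := by
  have hsub := extDisk_subset hε
  have padd : ∀ {a b : Plane → Plane} {x : Plane}, DifferentiableAt ℝ a x → DifferentiableAt ℝ b x →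
      ∀ i, pderiv i (fun y => a y + b y) x = pderiv i a x + pderiv i b x := by
    intro a b x ha hb i
    simp only [pderiv]
    rw [fderiv_fun_add ha hb]
    rfl
  have dAt : ∀ {a : Plane → Plane}, ContDiffOn ℝ ∞ a {0}ᶜ → ∀ x ∈ ({0}ᶜ : Set Plane),
      DifferentiableAt ℝ a x := fun ha x hx =>
    (ha.contDiffAt (isOpen_punctured.mem_nhds hx)).differentiableAt (by simp)
  obtain ⟨C, hC⟩ := hh.bound
  obtain ⟨D, hD⟩ := hk.bound
  obtain ⟨φ, A, h1, h2, h3⟩ := hh.approx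
  obtain ⟨ψ, B, k1, k2, k3⟩ := hk.approx
  refine ⟨hh.smooth.add hk.smooth, ⟨C + D, fun x hx => ⟨?_, fun i => ?_, fun i j => ?_⟩⟩,
    fun n x => φ n x + ψ n x, A + B, fun n => ⟨(h1 n).1.add (k1 n).1, (h1 n).2.1.add (k1 n).2.1, ?_⟩,
    fun n x hx => ⟨?_, fun i => ?_⟩, fun x hx => ?_⟩
  · rw [add_mul]
    exact (norm_add_le _ _).trans (add_le_add (hC x hx).1 (hD x hx).1)
  · rw [add_mul, padd (dAt hh.smooth x (hsub hx)) (dAt hk.smooth x (hsub hx))]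
    exact (norm_add_le _ _).trans (add_le_add ((hC x hx).2.1 i) ((hD x hx).2.1 i))
  · have e : pderiv i (fun y => h y + k y) =ᶠ[𝓝 x] fun y => pderiv i h y + pderiv i k y := by
      filter_upwards [isOpen_punctured.mem_nhds (hsub hx)] with y hy
      exact padd (dAt hh.smooth y hy) (dAt hk.smooth y hy) i
    have e2 : pderiv j (pderiv i (fun y => h y + k y)) x =
        pderiv j (fun y => pderiv i h y + pderiv i k y) x := by
      rw [pderiv, e.fderiv_eq]; rfl
    rw [e2, padd (dAt (contDiffOn_pderiv isOpen_punctured hh.smooth i) x (hsub hx))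
      (dAt (contDiffOn_pderiv isOpen_punctured hk.smooth i) x (hsub hx)), add_mul]
    exact (norm_add_le _ _).trans (add_le_add ((hC x hx).2.2 i j) ((hD x hx).2.2 i j))
  · exact (tsupport_add _ _).trans (Set.union_subset (h1 n).2.2 (k1 n).2.2)
  · rw [add_mul]
    exact (norm_add_le _ _).trans (add_le_add (h2 n x hx).1 (k2 n x hx).1)
  · rw [add_mul, padd ((h1 n).1.differentiable (by simp) x) ((k1 n).1.differentiable (by simp) x)]
    exact (norm_add_le _ _).trans (add_le_add ((h2 n x hx).2 i) ((k2 n x hx).2 i))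
  · filter_upwards [h3 x hx, k3 x hx] with n a b
    exact a.add b

section Consequences

variable {ε : ℝ} {s : ℕ} {h : Plane → Plane}

lemma aestronglyMeasurable_extDisk {F : Type*} [NormedAddCommGroup F] [NormedSpace ℝ F]
    {f : Plane → F} (hε : 0 < ε) (hf : ContDiffOn ℝ ∞ f {0}ᶜ) :
    AEStronglyMeasurable f (volume.restrict (extDisk ε)) :=
  (hf.continuousOn.mono (extDisk_subset hε)).aestronglyMeasurable (measurableSet_extDisk ε)

lemma VanishingField.memLp (hh : VanishingField ε s h) (hε : 0 < ε) {q : ℝ≥0∞} (hq : q ≠ ⊤)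
    (hsq : 2 < s * q.toReal) : MemLp h q (volume.restrict (extDisk ε)) := by
  obtain ⟨C, hC⟩ := hh.bound
  exact memLp_of_decay hε hq hsq (aestronglyMeasurable_extDisk hε hh.smooth) fun x hx => (hC x hx).1

lemma VanishingField.memLp_pderiv (hh : VanishingField ε s h) (hε : 0 < ε) {q : ℝ≥0∞} (hq : q ≠ ⊤)
    (hsq : 2 < s * q.toReal) (i : Fin 2) : MemLp (pderiv i h) q (volume.restrict (extDisk ε)) := by
  obtain ⟨C, hC⟩ := hh.bound
  exact memLp_of_decay hε hq hsq
    (aestronglyMeasurable_extDisk hε (contDiffOn_pderiv isOpen_punctured hh.smooth i))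
    fun x hx => (hC x hx).2.1 i

lemma VanishingField.memLp_pderiv_pderiv (hh : VanishingField ε s h) (hε : 0 < ε) {q : ℝ≥0∞}
    (hq : q ≠ ⊤) (hsq : 2 < s * q.toReal) (i j : Fin 2) :
    MemLp (pderiv j (pderiv i h)) q (volume.restrict (extDisk ε)) := by
  obtain ⟨C, hC⟩ := hh.bound
  exact memLp_of_decay hε hq hsq (aestronglyMeasurable_extDisk hε
    (contDiffOn_pderiv isOpen_punctured (contDiffOn_pderiv isOpen_punctured hh.smooth i) j))
    fun x hx => (hC x hx).2.2 i j

/-- The approximating fields converge in `W^{1,p}` by dominated convergence, the bound being in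
`L^p`. -/
lemma VanishingField.memW1Zero (hh : VanishingField ε s h) (hε : 0 < ε) {p : ℝ≥0∞} (hp : p ≠ ⊤)
    (hsp : 2 < s * p.toReal) : MemW1Zero (extDisk ε) p h := by
  obtain ⟨φ, C, h1, h2, h3⟩ := hh.approx
  have hsm := hh.smooth.mono (extDisk_subset hε)
  have hp0 : p ≠ 0 := by
    rintro rfl
    simp at hsp
    linarith
  have hpow := (memLp_inv_norm_pow hε hp hsp).const_mul C
  refine ⟨fun i => pderiv i h, hasWeakPartial_pderiv (isOpen_extDisk ε) hsm, hh.memLp hε hp hsp,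
    hh.memLp_pderiv hε hp hsp, φ, h1, ?_, fun i => ?_⟩
  · refine tendsto_eLpNorm_sub_of_dominated hp0 hp
      (fun n => (h1 n).1.continuous.aestronglyMeasurable) (hh.memLp hε hp hsp).1 hpow
      (fun n => (ae_restrict_iff' (measurableSet_extDisk ε)).2 (ae_of_all _ fun x hx => (h2 n x hx).1))
      ((ae_restrict_iff' (measurableSet_extDisk ε)).2 (ae_of_all _ fun x hx => ?_))
    refine tendsto_const_nhds.congr' ?_
    filter_upwards [h3 x hx] with n hn
    exact hn.eq_of_nhds.symm
  · refine tendsto_eLpNorm_sub_of_dominated hp0 hp (fun n => ?_) (hh.memLp_pderiv hε hp hsp i).1 hpow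
      (fun n => (ae_restrict_iff' (measurableSet_extDisk ε)).2
        (ae_of_all _ fun x hx => (h2 n x hx).2 i))
      ((ae_restrict_iff' (measurableSet_extDisk ε)).2 (ae_of_all _ fun x hx => ?_))
    · exact (((h1 n).1.continuous_fderiv (by simp)).clm_apply continuous_const).aestronglyMeasurable
    · refine tendsto_const_nhds.congr' ?_
      filter_upwards [h3 x hx] with n hn
      rw [hn.fderiv_eq]
      rfl

lemma VanishingField.memW2WithLaplacian (hh : VanishingField ε s h) (hε : 0 < ε) {p : ℝ≥0∞}
    (hp : p ≠ ⊤) (hsp : 2 < s * p.toReal) :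
    MemW2WithLaplacian (extDisk ε) p h (fun x => ∑ i, pderiv i (pderiv i h) x) := by
  have hsm := hh.smooth.mono (extDisk_subset hε)
  exact ⟨fun i => pderiv i h, fun i j => pderiv j (pderiv i h),
    hasWeakPartial_pderiv (isOpen_extDisk ε) hsm,
    fun i => hasWeakPartial_pderiv (isOpen_extDisk ε) (contDiffOn_pderiv (isOpen_extDisk ε) hsm i),
    hh.memLp hε hp hsp, hh.memLp_pderiv hε hp hsp, hh.memLp_pderiv_pderiv hε hp hsp, rfl⟩

/-- A divergence free field vanishing on the boundary is weakly divergence free and tangent. -/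
lemma VanishingField.integral_fderiv_eq_zero (hh : VanishingField ε s h) (hε : 0 < ε)
    (hdiv : ∀ x ∈ extDisk ε, ∑ i, pderiv i h x i = 0) {φ : Plane → ℝ} (hφ : ContDiff ℝ ∞ φ)
    (hc : HasCompactSupport φ) : ∫ x in extDisk ε, fderiv ℝ φ x (h x) = 0 := by
  obtain ⟨ψ, C, h1, h2, h3⟩ := hh.approx
  have hae : ∀ {P : Plane → Prop}, (∀ x ∈ extDisk ε, P x) → ∀ᵐ x ∂(volume.restrict (extDisk ε)), P x :=
    fun hP => (ae_restrict_iff' (measurableSet_extDisk ε)).2 (ae_of_all _ hP)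
  have hb : ∀ x ∈ extDisk ε, C * (‖x‖ ^ s)⁻¹ ≤ |C| * (ε ^ s)⁻¹ := fun x hx => by
    have hx' : ε ≤ ‖x‖ := le_of_lt hx
    calc C * (‖x‖ ^ s)⁻¹ ≤ |C| * (‖x‖ ^ s)⁻¹ := by
          have : 0 ≤ (‖x‖ ^ s)⁻¹ := by positivity
          exact mul_le_mul_of_nonneg_right (le_abs_self C) this
      _ ≤ _ := by gcongr
  have hdφ : Continuous (fderiv ℝ φ) := hφ.continuous_fderiv (by simp)
  -- the compactly supported approximations `ψ n` of `h` satisfy the identity of integration by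
  -- parts `e` below; both of its sides converge
  have lim1 : Tendsto (fun n => ∫ x in extDisk ε, fderiv ℝ φ x (ψ n x)) atTop
      (𝓝 (∫ x in extDisk ε, fderiv ℝ φ x (h x))) := by
    refine tendsto_integral_of_dominated_convergence (fun x => ‖fderiv ℝ φ x‖ * (|C| * (ε ^ s)⁻¹))
      (fun n => (hdφ.clm_apply (h1 n).1.continuous).aestronglyMeasurable) ?_ (fun n => hae fun x hx => ?_)
      (hae fun x hx => ?_)
    · have : Integrable (fun x => ‖fderiv ℝ φ x‖) :=
        hdφ.norm.integrable_of_hasCompactSupport (hc.fderiv ℝ).norm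
      exact (this.mul_const _).restrict
    · refine (ContinuousLinearMap.le_opNorm _ _).trans ?_
      gcongr
      exact (h2 n x hx).1.trans (hb x hx)
    · refine tendsto_const_nhds.congr' ?_
      filter_upwards [h3 x hx] with n hn
      rw [hn.eq_of_nhds]
  have lim2 : Tendsto (fun n => ∫ x in extDisk ε, φ x * ∑ i, pderiv i (ψ n) x i) atTop
      (𝓝 (∫ x in extDisk ε, φ x * ∑ i, pderiv i h x i)) := by
    refine tendsto_integral_of_dominated_convergence (fun x => ‖φ x‖ * (2 * (|C| * (ε ^ s)⁻¹)))
      (fun n => ?_) ?_ (fun n => hae fun x hx => ?_) (hae fun x hx => ?_)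
    · have : ∀ i, Continuous fun x => pderiv i (ψ n) x i := fun i =>
        (coord i).continuous.comp (((h1 n).1.continuous_fderiv (by simp)).clm_apply continuous_const)
      exact (hφ.continuous.mul (continuous_finsetSum _ fun i _ => this i)).aestronglyMeasurable
    · have : Integrable (fun x => ‖φ x‖) := hφ.continuous.norm.integrable_of_hasCompactSupport hc.norm
      exact (this.mul_const _).restrict
    · rw [norm_mul]
      gcongr
      have hi : ∀ i, ‖pderiv i (ψ n) x i‖ ≤ |C| * (ε ^ s)⁻¹ := fun i =>
        (PiLp.norm_apply_le _ i).trans (((h2 n x hx).2 i).trans (hb x hx))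
      rw [Fin.sum_univ_two]
      refine (norm_add_le _ _).trans ?_
      linarith [hi 0, hi 1]
    · refine tendsto_const_nhds.congr' ?_
      filter_upwards [h3 x hx] with n hn
      simp only [pderiv, hn.fderiv_eq]
  have e : ∀ n, ∫ x in extDisk ε, fderiv ℝ φ x (ψ n x) =
      -∫ x in extDisk ε, φ x * ∑ i, pderiv i (ψ n) x i := by
    intro n
    have hj : ∀ j, ContDiff ℝ ∞ (fun x => ψ n x j) := fun j => by
      exact (coord j).contDiff.comp (h1 n).1
    have hsub : ∀ j, tsupport (fun x => ψ n x j) ⊆ tsupport (ψ n) := fun j =>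
      closure_mono fun x hx h => hx (by simp [h])
    have hcj : ∀ j, HasCompactSupport (fun x => ψ n x j) := fun j =>
      (h1 n).2.1.of_isClosed_subset (isClosed_tsupport _) (hsub j)
    have hpj : ∀ i, Continuous (pderiv i φ) := fun i => hdφ.clm_apply continuous_const
    have hpψ : ∀ i, Continuous fun x => pderiv i (ψ n) x i := fun i =>
      (coord i).continuous.comp (((h1 n).1.continuous_fderiv (by simp)).clm_apply continuous_const)
    have i1 : ∀ i, Integrable (fun x => ψ n x i * pderiv i φ x) (volume.restrict (extDisk ε)) :=
      fun i => (((hj i).continuous.mul (hpj i)).integrable_of_hasCompactSupport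
        (hcj i).mul_right).restrict
    have i2 : ∀ i, Integrable (fun x => φ x * pderiv i (ψ n) x i) (volume.restrict (extDisk ε)) :=
      fun i => ((hφ.continuous.mul (hpψ i)).integrable_of_hasCompactSupport hc.mul_right).restrict
    have ibp : ∀ i, ∫ x in extDisk ε, ψ n x i * pderiv i φ x =
        -∫ x in extDisk ε, φ x * pderiv i (ψ n) x i := by
      intro i
      have := integral_bilin_pderiv (ContinuousLinearMap.mul ℝ ℝ) (isOpen_extDisk ε) (hj i) (hcj i)
        ((hsub i).trans (h1 n).2.2) hφ.contDiffOn i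
      simp only [ContinuousLinearMap.mul_apply'] at this
      rw [eq_comm, neg_eq_iff_eq_neg] at this
      rw [this]
      congr 1
      refine integral_congr_ae (ae_of_all _ fun x => ?_)
      simp only
      rw [pderiv_apply ((h1 n).1.differentiable (by simp) x), mul_comm]
    simp_rw [fderiv_apply_eq_sum, Finset.mul_sum]
    rw [integral_finsetSum _ fun i _ => i1 i, integral_finsetSum _ fun i _ => i2 i,
      ← Finset.sum_neg_distrib]
    exact Finset.sum_congr rfl fun i _ => ibp i
  have lim3 := (lim2.neg).congr fun n => (e n).symm
  rw [tendsto_nhds_unique lim1 lim3, neg_eq_zero]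
  exact setIntegral_eq_zero_of_forall_eq_zero fun x hx => by rw [hdiv x hx, mul_zero]

/-- Green's formula between `W^{2,p} ∩ W^{1,p}_0` and the smooth fields vanishing on the boundary. -/
lemma VanishingField.integral_laplacian (hh : VanishingField ε s h) (hε : 0 < ε) {p q : ℝ≥0∞}
    [ENNReal.HolderConjugate p q] (hq : q ≠ ⊤) (hsq : 2 < s * q.toReal) {v L : Plane → Plane}
    (hv : MemW1Zero (extDisk ε) p v) (hL : MemW2WithLaplacian (extDisk ε) p v L) :
    ∫ x in extDisk ε, inner ℝ (L x) (h x) =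
      ∫ x in extDisk ε, inner ℝ (v x) (∑ i, pderiv i (pderiv i h) x) := by
  obtain ⟨D, D₂, hD, hD₂, -, mD, mD₂, rfl⟩ := hL
  obtain ⟨D', hD', mv, mD', φ, hφ, lim, limD⟩ := hv
  obtain ⟨ψ, C, h1, h2, h3⟩ := hh.approx
  have hsub := extDisk_subset hε
  have mh := hh.memLp hε hq hsq
  have mh' := hh.memLp_pderiv hε hq hsq
  have mh'' := hh.memLp_pderiv_pderiv hε hq hsq
  have memφ : ∀ {χ : Plane → Plane}, Continuous χ → HasCompactSupport χ →
      MemLp χ p (volume.restrict (extDisk ε)) := fun h1 h2 =>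
    (h1.memLp_of_hasCompactSupport h2).restrict _
  have hpd : ∀ {χ : Plane → Plane}, ContDiff ℝ ∞ χ → ∀ i, Continuous (pderiv i χ) := fun hχ i =>
    (hχ.continuous_fderiv (by simp)).clm_apply continuous_const
  -- the outer derivative of `v` is moved to `h` through the test fields `ψ n` approximating `h`
  have step1 : ∀ i, ∫ x in extDisk ε, inner ℝ (D₂ i i x) (h x) =
      -∫ x in extDisk ε, inner ℝ (D i x) (pderiv i h x) := by
    intro i
    have l1 := tendsto_integral_inner_of_decay hε hq hsq (mD₂ i i) (g := ψ) (g₀ := h)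
      (fun n => (h1 n).1.continuous.aestronglyMeasurable) (fun n x hx => (h2 n x hx).1) (fun x hx => by
        refine tendsto_const_nhds.congr' ?_
        filter_upwards [h3 x hx] with n hn
        exact hn.eq_of_nhds.symm)
    have l2 := tendsto_integral_inner_of_decay hε hq hsq (mD i) (g := fun n => pderiv i (ψ n))
      (g₀ := pderiv i h) (fun n => (hpd (h1 n).1 i).aestronglyMeasurable)
      (fun n x hx => (h2 n x hx).2 i) (fun x hx => by
        refine tendsto_const_nhds.congr' ?_
        filter_upwards [h3 x hx] with n hn
        simp only [pderiv, hn.fderiv_eq])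
    refine tendsto_nhds_unique l1 (l2.neg.congr fun n => ?_)
    exact ((hD₂ i i).integral_inner (h1 n).1 (h1 n).2.1 (h1 n).2.2).symm
  -- the inner derivative is moved through the test fields `φ n` approximating `v`; the weak
  -- gradients of `v` in the two hypotheses agree almost everywhere
  have step2 : ∀ i, ∫ x in extDisk ε, inner ℝ (D i x) (pderiv i h x) =
      -∫ x in extDisk ε, inner ℝ (v x) (pderiv i (pderiv i h) x) := by
    intro i
    have e : ∫ x in extDisk ε, inner ℝ (D i x) (pderiv i h x) =
        ∫ x in extDisk ε, inner ℝ (D' i x) (pderiv i h x) := by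
      refine integral_congr_ae ?_
      filter_upwards [(hD i).ae_unique (isOpen_extDisk ε) (hD' i)] with x hx
      rw [hx]
    rw [e]
    have l1 := tendsto_integral_inner_of_tendsto_eLpNorm
      (fun n => memφ (hpd (hφ n).1 i) ((hφ n).2.1.fderiv_apply ℝ (stdVec i))) (mD' i) (mh' i) (limD i)
    have l2 := tendsto_integral_inner_of_tendsto_eLpNorm
      (fun n => memφ (hφ n).1.continuous (hφ n).2.1) mv (mh'' i i) lim
    refine tendsto_nhds_unique l1 (l2.neg.congr fun n => ?_)
    exact (integral_bilin_pderiv (innerSL ℝ) (isOpen_extDisk ε) (hφ n).1 (hφ n).2.1 (hφ n).2.2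
      ((contDiffOn_pderiv isOpen_punctured hh.smooth i).mono hsub) i).symm
  simp_rw [sum_inner, inner_sum]
  rw [integral_finsetSum _ fun i _ => integrable_inner_of_memLp (mD₂ i i) mh,
    integral_finsetSum _ fun i _ => integrable_inner_of_memLp mv (mh'' i i)]
  refine Finset.sum_congr rfl fun i _ => ?_
  rw [step1, step2, neg_neg]

end Consequences

/-- The Leray projection leaves pairings with solenoidal fields unchanged. -/
lemma IsLeray.integral_inner_eq {ε : ℝ} {p q : ℝ≥0∞} [ENNReal.HolderConjugate p q]
    {f g h : Plane → Plane} (hfg : IsLeray ε p f g) (h2 : MemLpSigma ε 2 h)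
    (hq : MemLp h q (volume.restrict (extDisk ε))) :
    ∫ x in extDisk ε, inner ℝ (f x) (h x) = ∫ x in extDisk ε, inner ℝ (g x) (h x) := by
  obtain ⟨mf, mg, F, G, hFG, limF, limG⟩ := hfg
  have l1 := tendsto_integral_inner_of_tendsto_eLpNorm (fun n => (hFG n).2.1) mf hq limF
  have l2 := tendsto_integral_inner_of_tendsto_eLpNorm (fun n => (hFG n).2.2) mg hq limG
  refine tendsto_nhds_unique l1 (l2.congr fun n => ?_)
  have h := (hFG n).1.2.2 h h2
  simp_rw [inner_sub_left] at h
  rw [integral_sub (integrable_inner_of_memLp (hFG n).2.1 hq)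
    (integrable_inner_of_memLp (hFG n).2.2 hq), sub_eq_zero] at h
  exact h.symm

/-- Any solution of the resolvent equation, tested with a smooth solenoidal field vanishing on the
boundary: the operator is moved to the test field, so that the right side does not depend on the
solution. -/
lemma IsStokesResolvent.integral_test {α ε : ℝ} (hε : 0 < ε) {p q : ℝ≥0∞}
    [ENNReal.HolderConjugate p q] (hq : q ≠ ⊤) (hq1 : 1 < q.toReal) {f v h : Plane → Plane}
    (hv : IsStokesResolvent α ε p f v) (hh : VanishingField ε 2 h)
    (hdiv : ∀ x ∈ extDisk ε, ∑ i, pderiv i h x i = 0) :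
    ∫ x in extDisk ε, inner ℝ (v x) (h x - α • ∑ i, pderiv i (pderiv i h) x) =
      ∫ x in extDisk ε, inner ℝ (f x) (h x) := by
  obtain ⟨hf, A, ⟨hvσ, hv0, L, hL, hP⟩, heq⟩ := hv
  have hsq : 2 < ((2 : ℕ) : ℝ) * q.toReal := by push_cast; linarith
  have hs2 : 2 < ((2 : ℕ) : ℝ) * (2 : ℝ≥0∞).toReal := by norm_num
  have mh := hh.memLp hε hq hsq
  have h2 : MemLpSigma ε 2 h :=
    ⟨hh.memLp hε (by norm_num) hs2, fun φ hφ hc => hh.integral_fderiv_eq_zero hε hdiv hφ hc⟩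
  have e1 := hP.integral_inner_eq h2 mh
  rw [hh.integral_laplacian hε hq hsq hv0 hL] at e1
  have mA : MemLp A p (volume.restrict (extDisk ε)) := by
    have := hP.2.1.neg
    refine this.ae_eq (ae_of_all _ fun x => ?_)
    simp
  have e2 : ∫ x in extDisk ε, inner ℝ (f x) (h x) =
      ∫ x in extDisk ε, (inner ℝ (v x) (h x) + α * inner ℝ (A x) (h x)) := by
    refine integral_congr_ae ?_
    filter_upwards [heq] with x hx
    rw [← hx, inner_add_left, real_inner_smul_left]
  have mL : MemLp (fun x => ∑ i, pderiv i (pderiv i h) x) q (volume.restrict (extDisk ε)) :=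
    memLp_finsetSum _ fun i _ => hh.memLp_pderiv_pderiv hε hq hsq i i
  rw [e2, integral_add (integrable_inner_of_memLp hvσ.1 mh)
    ((integrable_inner_of_memLp mA mh).const_mul α), integral_const_mul]
  simp_rw [inner_sub_right, real_inner_smul_right]
  rw [integral_sub (integrable_inner_of_memLp hvσ.1 mh)
    ((integrable_inner_of_memLp hvσ.1 mL).const_mul α), integral_const_mul, e1]
  simp_rw [inner_neg_left]
  rw [integral_neg]
  ring

/-! ### Radial profiles and their cutoffs -/

/-- A profile `F`, a function of `ρ = |x|²`, which is smooth on `(0, ∞)` and decays on `[a, ∞)` like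
`ρ^{-N}`, with a gain of one power of `ρ` for each of two derivatives. -/
structure RadialDecay (a : ℝ) (N : ℕ) (F : ℝ → ℝ) : Prop where
  smooth : ContDiffOn ℝ ∞ F (Set.Ioi 0)
  bound : ∃ M, ∀ ρ, a ≤ ρ → |F ρ| ≤ M * (ρ ^ N)⁻¹ ∧ |deriv F ρ| ≤ M * (ρ ^ (N + 1))⁻¹ ∧
    |deriv (deriv F) ρ| ≤ M * (ρ ^ (N + 2))⁻¹

lemma differentiableAt_of_smooth {F : ℝ → ℝ} (hF : ContDiffOn ℝ ∞ F (Set.Ioi 0)) {ρ : ℝ}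
    (hρ : 0 < ρ) : DifferentiableAt ℝ F ρ :=
  (hF.contDiffAt (Ioi_mem_nhds hρ)).differentiableAt (by simp)

lemma contDiffOn_deriv {F : ℝ → ℝ} (hF : ContDiffOn ℝ ∞ F (Set.Ioi 0)) :
    ContDiffOn ℝ ∞ (deriv F) (Set.Ioi 0) :=
  ((contDiffOn_infty_iff_deriv_of_isOpen isOpen_Ioi).1 hF).2

lemma RadialDecay.add {a : ℝ} (ha : 0 < a) {N : ℕ} {F G : ℝ → ℝ} (hF : RadialDecay a N F)
    (hG : RadialDecay a N G) : RadialDecay a N (fun ρ => F ρ + G ρ) := by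
  obtain ⟨A, hA⟩ := hF.bound
  obtain ⟨B, hB⟩ := hG.bound
  have d1 : ∀ ρ, 0 < ρ → deriv (fun ρ => F ρ + G ρ) ρ = deriv F ρ + deriv G ρ := fun ρ hρ =>
    deriv_fun_add (differentiableAt_of_smooth hF.smooth hρ) (differentiableAt_of_smooth hG.smooth hρ)
  refine ⟨hF.smooth.add hG.smooth, A + B, fun ρ hρ => ?_⟩
  have hρ0 : 0 < ρ := ha.trans_le hρ
  have d2 : deriv (deriv fun ρ => F ρ + G ρ) ρ = deriv (deriv F) ρ + deriv (deriv G) ρ := by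
    have : deriv (fun ρ => F ρ + G ρ) =ᶠ[𝓝 ρ] fun ρ => deriv F ρ + deriv G ρ := by
      filter_upwards [Ioi_mem_nhds hρ0] with y hy
      exact d1 y hy
    rw [this.deriv_eq, deriv_fun_add (differentiableAt_of_smooth (contDiffOn_deriv hF.smooth) hρ0)
      (differentiableAt_of_smooth (contDiffOn_deriv hG.smooth) hρ0)]
  rw [d1 ρ hρ0, d2]
  obtain ⟨a1, a2, a3⟩ := hA ρ hρ
  obtain ⟨b1, b2, b3⟩ := hB ρ hρ
  simp only [add_mul]
  exact ⟨(abs_add_le _ _).trans (add_le_add a1 b1), (abs_add_le _ _).trans (add_le_add a2 b2),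
    (abs_add_le _ _).trans (add_le_add a3 b3)⟩

lemma RadialDecay.const_mul {a : ℝ} {N : ℕ} {F : ℝ → ℝ} (hF : RadialDecay a N F) (b : ℝ) :
    RadialDecay a N (fun ρ => b * F ρ) := by
  obtain ⟨A, hA⟩ := hF.bound
  refine ⟨contDiffOn_const.mul hF.smooth, |b| * A, fun ρ hρ => ?_⟩
  have e : deriv (fun ρ => b * F ρ) = fun ρ => b * deriv F ρ := by
    funext y; rw [deriv_const_mul_field]
  rw [e, deriv_const_mul_field]
  simp only [abs_mul, mul_assoc]
  obtain ⟨a1, a2, a3⟩ := hA ρ hρ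
  exact ⟨by gcongr, by gcongr, by gcongr⟩

lemma deriv_besselInt (m : ℕ) {l ρ : ℝ} (hl : 0 < l) (hρ : 0 < ρ) :
    deriv (besselInt m l) ρ = -(besselInt (m + 1) l ρ / 4) := (hasDerivAt_besselInt m hl hρ).deriv

lemma deriv_deriv_besselInt (m : ℕ) {l ρ : ℝ} (hl : 0 < l) (hρ : 0 < ρ) :
    deriv (deriv (besselInt m l)) ρ = besselInt (m + 2) l ρ / 16 := by
  have : deriv (besselInt m l) =ᶠ[𝓝 ρ] fun ρ => -(besselInt (m + 1) l ρ / 4) := by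
    filter_upwards [Ioi_mem_nhds hρ] with y hy
    exact deriv_besselInt m hl hy
  rw [this.deriv_eq, deriv.fun_neg, deriv_div_const, deriv_besselInt (m + 1) hl hρ]
  ring

lemma besselInt_decay {a : ℝ} (ha : 0 < a) (m N : ℕ) {l : ℝ} (hl : 0 < l) :
    ∃ M, 0 ≤ M ∧ ∀ ρ, a ≤ ρ → besselInt m l ρ ≤ M * (ρ ^ N)⁻¹ := by
  obtain ⟨C, hC, h⟩ := besselInt_le m (N := N + m) (by omega) hl
  refine ⟨C * (a ^ m)⁻¹, by positivity, fun ρ hρ => (h ρ (ha.trans_le hρ)).trans ?_⟩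
  have hρ0 : 0 < ρ := ha.trans_le hρ
  rw [pow_add, mul_inv, mul_assoc, mul_comm (a ^ m)⁻¹]
  gcongr

lemma radialDecay_besselInt {a : ℝ} (ha : 0 < a) (m N : ℕ) {l : ℝ} (hl : 0 < l) :
    RadialDecay a N (besselInt m l) := by
  obtain ⟨A, hA, h0⟩ := besselInt_decay ha m N hl
  obtain ⟨B, hB, h1⟩ := besselInt_decay ha (m + 1) (N + 1) hl
  obtain ⟨C, hC, h2⟩ := besselInt_decay ha (m + 2) (N + 2) hl
  refine ⟨contDiffOn_besselInt m hl, A + B + C, fun ρ hρ => ?_⟩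
  have hρ0 : 0 < ρ := ha.trans_le hρ
  have n0 := besselInt_nonneg m l ρ
  have n1 := besselInt_nonneg (m + 1) l ρ
  have n2 := besselInt_nonneg (m + 2) l ρ
  rw [deriv_besselInt m hl hρ0, deriv_deriv_besselInt m hl hρ0, abs_neg, abs_of_nonneg n0,
    abs_of_nonneg (by positivity), abs_of_nonneg (by positivity)]
  have p0 : 0 ≤ (ρ ^ N)⁻¹ := by positivity
  have p1 : 0 ≤ (ρ ^ (N + 1))⁻¹ := by positivity
  have p2 : 0 ≤ (ρ ^ (N + 2))⁻¹ := by positivity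
  refine ⟨(h0 ρ hρ).trans ?_, le_trans (by linarith) ((h1 ρ hρ).trans ?_),
    le_trans (by linarith) ((h2 ρ hρ).trans ?_)⟩ <;>
  exact mul_le_mul_of_nonneg_right (by linarith) (by assumption)

lemma hasDerivAt_inv_pow (N : ℕ) {ρ : ℝ} (hρ : 0 < ρ) :
    HasDerivAt (fun ρ : ℝ => (ρ ^ N)⁻¹) (-(N * (ρ ^ (N + 1))⁻¹)) ρ := by
  have h := (hasDerivAt_pow N ρ).fun_inv (by positivity)
  refine h.congr_deriv ?_
  rcases N with _ | N
  · simp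
  · rw [Nat.add_sub_cancel]
    field_simp
    ring

lemma deriv_deriv_inv_pow (N : ℕ) {ρ : ℝ} (hρ : 0 < ρ) :
    deriv (deriv fun ρ : ℝ => (ρ ^ N)⁻¹) ρ = N * (N + 1) * (ρ ^ (N + 2))⁻¹ := by
  have : deriv (fun ρ : ℝ => (ρ ^ N)⁻¹) =ᶠ[𝓝 ρ] fun ρ => -(N * (ρ ^ (N + 1))⁻¹) := by
    filter_upwards [Ioi_mem_nhds hρ] with y hy
    exact (hasDerivAt_inv_pow N hy).deriv
  rw [this.deriv_eq]
  rw [(((hasDerivAt_inv_pow (N + 1) hρ).const_mul (N : ℝ)).fun_neg).deriv]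
  push_cast
  ring

lemma radialDecay_inv_pow {a : ℝ} (ha : 0 < a) (N : ℕ) : RadialDecay a N fun ρ => (ρ ^ N)⁻¹ := by
  refine ⟨ContDiffOn.inv (by fun_prop) fun ρ (hρ : 0 < ρ) => by positivity,
    (N + 1) * (N + 1), fun ρ hρ => ?_⟩
  have hρ0 : 0 < ρ := ha.trans_le hρ
  rw [(hasDerivAt_inv_pow N hρ0).deriv, deriv_deriv_inv_pow N hρ0, abs_neg,
    abs_of_nonneg (by positivity), abs_of_nonneg (by positivity), abs_of_nonneg (by positivity)]
  have hN : (0 : ℝ) ≤ N := by positivity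
  refine ⟨?_, ?_, ?_⟩
  · have : 0 ≤ (ρ ^ N)⁻¹ := by positivity
    nlinarith [mul_nonneg hN this, mul_nonneg (mul_nonneg hN hN) this]
  · exact mul_le_mul_of_nonneg_right (by nlinarith) (by positivity)
  · exact mul_le_mul_of_nonneg_right (by nlinarith) (by positivity)

lemma exists_deriv_smoothTransition_le :
    ∃ S, 0 ≤ S ∧ ∀ y, |deriv Real.smoothTransition y| ≤ S ∧
      (y ≤ 0 ∨ 1 ≤ y → deriv Real.smoothTransition y = 0) := by
  have hz : ∀ y, (y ≤ 0 ∨ 1 ≤ y → deriv Real.smoothTransition y = 0) := by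
    rintro y (hy | hy)
    · refine IsLocalMin.deriv_eq_zero (Eventually.of_forall fun z => ?_)
      rw [Real.smoothTransition.zero_of_nonpos hy]
      exact Real.smoothTransition.nonneg z
    · refine IsLocalMax.deriv_eq_zero (Eventually.of_forall fun z => ?_)
      rw [Real.smoothTransition.one_of_one_le hy]
      exact Real.smoothTransition.le_one z
  have hc : Continuous (deriv Real.smoothTransition) :=
    (Real.smoothTransition.contDiff (n := 1)).continuous_deriv le_rfl
  obtain ⟨S, hS⟩ := isCompact_Icc.exists_bound_of_continuousOn (s := Set.Icc (0 : ℝ) 1) hc.continuousOn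
  refine ⟨|S|, abs_nonneg _, fun y => ⟨?_, hz y⟩⟩
  by_cases hy : y ≤ 0 ∨ 1 ≤ y
  · rw [hz y hy]; simp
  · rw [not_or, not_le, not_le] at hy
    exact (hS y ⟨hy.1.le, hy.2.le⟩).trans (le_abs_self S)

/-- The outer cutoffs: equal to `1` for `ρ ≤ n + 1` and to `0` for `ρ ≥ 2 (n + 1)`. -/
noncomputable def outerCutoff (n : ℕ) (ρ : ℝ) : ℝ := 1 - Real.smoothTransition (ρ / (n + 1) - 1)

/-- The inner cutoffs: equal to `0` for `ρ ≤ a + 1 / (n + 1)` and to `1` for `ρ ≥ a + 2 / (n + 1)`. -/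
noncomputable def innerCutoff (a : ℝ) (n : ℕ) (ρ : ℝ) : ℝ :=
  Real.smoothTransition ((n + 1) * (ρ - a) - 1)

lemma contDiff_outerCutoff (n : ℕ) : ContDiff ℝ ∞ (outerCutoff n) :=
  contDiff_const.sub (Real.smoothTransition.contDiff.comp
    ((contDiff_id.div_const _).sub contDiff_const))

lemma contDiff_innerCutoff (a : ℝ) (n : ℕ) : ContDiff ℝ ∞ (innerCutoff a n) :=
  Real.smoothTransition.contDiff.comp
    ((contDiff_const.mul (contDiff_id.sub contDiff_const)).sub contDiff_const)

lemma abs_outerCutoff_le (n : ℕ) (ρ : ℝ) : |outerCutoff n ρ| ≤ 1 := by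
  have h1 := Real.smoothTransition.nonneg (ρ / (n + 1) - 1)
  have h2 := Real.smoothTransition.le_one (ρ / (n + 1) - 1)
  rw [outerCutoff, abs_of_nonneg (by linarith)]
  linarith

lemma abs_innerCutoff_le (a : ℝ) (n : ℕ) (ρ : ℝ) : |innerCutoff a n ρ| ≤ 1 := by
  rw [innerCutoff, abs_of_nonneg (Real.smoothTransition.nonneg _)]
  exact Real.smoothTransition.le_one _

/-- The derivatives of the cutoffs live where `ρ` is comparable to `n`, respectively `ρ - a` to `1 /
n`, so that they are bounded uniformly in `n` by multiples of `1 / ρ` and `1 / (ρ - a)`. -/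
lemma exists_deriv_cutoff_le (a : ℝ) : ∃ S, 0 ≤ S ∧
    (∀ n ρ, 0 < ρ → |deriv (outerCutoff n) ρ| ≤ S / ρ) ∧
    ∀ n ρ, a < ρ → |deriv (innerCutoff a n) ρ| ≤ S / (ρ - a) := by
  obtain ⟨S, hS, h⟩ := exists_deriv_smoothTransition_le
  have hd : Differentiable ℝ Real.smoothTransition :=
    (Real.smoothTransition.contDiff (n := 1)).differentiable (by simp)
  refine ⟨2 * S, by positivity, fun n ρ hρ => ?_, fun n ρ hρ => ?_⟩
  · have hn : (0 : ℝ) < n + 1 := by positivity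
    have e : HasDerivAt (outerCutoff n)
        (-(deriv Real.smoothTransition (ρ / (n + 1) - 1) * (1 / (n + 1)))) ρ := by
      have h1 : HasDerivAt (fun ρ : ℝ => ρ / (n + 1) - 1) (1 / (n + 1)) ρ :=
        ((hasDerivAt_id ρ).div_const _).sub_const 1
      exact ((hd _).hasDerivAt.comp ρ h1).const_sub 1
    rw [e.deriv, abs_neg, abs_mul, abs_of_nonneg (by positivity : (0 : ℝ) ≤ 1 / (n + 1))]
    by_cases h2 : 2 * ((n : ℝ) + 1) ≤ ρ
    · rw [(h _).2 (Or.inr _)]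
      · simp only [abs_zero, zero_mul]; positivity
      · rw [le_sub_iff_add_le, le_div_iff₀ hn]; linarith
    · rw [not_le] at h2
      calc _ ≤ S * (1 / (n + 1)) := by gcongr; exact (h _).1
        _ ≤ S * (2 / ρ) := by
          gcongr S * ?_
          rw [div_le_div_iff₀ hn hρ]; linarith
        _ = _ := by ring
  · have hn : (0 : ℝ) < n + 1 := by positivity
    have hρ' : 0 < ρ - a := by linarith
    have e : HasDerivAt (innerCutoff a n)
        (deriv Real.smoothTransition ((n + 1) * (ρ - a) - 1) * ((n + 1) * 1)) ρ := by
      have h1 : HasDerivAt (fun ρ : ℝ => (n + 1) * (ρ - a) - 1) (((n : ℝ) + 1) * 1) ρ :=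
        (((hasDerivAt_id ρ).sub_const a).const_mul _).sub_const 1
      exact (hd _).hasDerivAt.comp ρ h1
    rw [e.deriv, abs_mul, mul_one, abs_of_pos hn]
    by_cases h2 : 2 ≤ ((n : ℝ) + 1) * (ρ - a)
    · rw [(h _).2 (Or.inr (by linarith))]
      simp only [abs_zero, zero_mul]; positivity
    · rw [not_le] at h2
      calc _ ≤ S * (n + 1) := by gcongr; exact (h _).1
        _ ≤ S * (2 / (ρ - a)) := by
          gcongr S * ?_
          rw [le_div_iff₀ hρ']; exact h2.le
        _ = _ := by ring

lemma outerCutoff_eq_one {n : ℕ} {ρ : ℝ} (h : ρ ≤ n + 1) : outerCutoff n ρ = 1 := by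
  have hn : (0 : ℝ) < n + 1 := by positivity
  rw [outerCutoff, Real.smoothTransition.zero_of_nonpos, sub_zero]
  rw [sub_nonpos, div_le_one hn]; exact h

lemma outerCutoff_eq_zero {n : ℕ} {ρ : ℝ} (h : 2 * (n + 1) ≤ ρ) : outerCutoff n ρ = 0 := by
  have hn : (0 : ℝ) < n + 1 := by positivity
  rw [outerCutoff, Real.smoothTransition.one_of_one_le, sub_self]
  rw [le_sub_iff_add_le, le_div_iff₀ hn]; linarith

lemma eventually_outerCutoff (ρ : ℝ) : ∀ᶠ n : ℕ in atTop, ∀ᶠ y in 𝓝 ρ, outerCutoff n y = 1 := by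
  obtain ⟨m, hm⟩ := exists_nat_gt ρ
  filter_upwards [eventually_ge_atTop m] with n hn
  have : (m : ℝ) ≤ n := by exact_mod_cast hn
  filter_upwards [Iio_mem_nhds (show ρ < (n : ℝ) + 1 by linarith)] with y hy
  exact outerCutoff_eq_one (le_of_lt hy)

lemma eventually_innerCutoff {a ρ : ℝ} (h : a < ρ) :
    ∀ᶠ n : ℕ in atTop, ∀ᶠ y in 𝓝 ρ, innerCutoff a n y = 1 := by
  have hd : 0 < ρ - a := sub_pos.2 h
  obtain ⟨m, hm⟩ := exists_nat_gt (4 / (ρ - a))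
  filter_upwards [eventually_ge_atTop m] with n hn
  have h1 : (m : ℝ) ≤ n := by exact_mod_cast hn
  have h2 : 4 / (ρ - a) < n + 1 := by linarith
  rw [div_lt_iff₀ hd] at h2
  filter_upwards [Ioi_mem_nhds (show (ρ + a) / 2 < ρ by linarith)] with y (hy : _ < y)
  refine Real.smoothTransition.one_of_one_le ?_
  have hn0 : (0 : ℝ) < n + 1 := by positivity
  nlinarith

/-- A profile vanishing at `a` is at most a multiple of `(ρ - a) ρ^{-N-1}`: by the mean value inequality
if `ρ ≤ 2a`, and because `ρ ≤ 2 (ρ - a)` otherwise. -/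
lemma RadialDecay.abs_le_of_vanish {a : ℝ} (ha : 0 < a) {N : ℕ} {F : ℝ → ℝ} (hF : RadialDecay a N F)
    (h0 : F a = 0) : ∃ M, ∀ ρ, a ≤ ρ → |F ρ| ≤ M * ((ρ - a) * (ρ ^ (N + 1))⁻¹) := by
  obtain ⟨M, hM⟩ := hF.bound
  have hM0 : 0 ≤ M := by
    have h1 := (hM a le_rfl).2.1
    have h2 : 0 < (a ^ (N + 1))⁻¹ := by positivity
    by_contra h
    have := mul_neg_of_neg_of_pos (not_le.1 h) h2
    linarith [abs_nonneg (deriv F a)]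
  refine ⟨M * 2 ^ (N + 1), fun ρ hρ => ?_⟩
  have hρ0 : 0 < ρ := ha.trans_le hρ
  have hd : 0 ≤ ρ - a := sub_nonneg.2 hρ
  rcases le_total ρ (2 * a) with h | h
  · have mv : ‖F ρ - F a‖ ≤ (M * (a ^ (N + 1))⁻¹) * ‖ρ - a‖ := by
      refine Convex.norm_image_sub_le_of_norm_deriv_le (s := Set.Icc a ρ) (fun y hy =>
        differentiableAt_of_smooth hF.smooth (ha.trans_le hy.1)) (fun y hy => ?_)
        (convex_Icc a ρ) ⟨le_rfl, hρ⟩ ⟨hρ, le_rfl⟩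
      refine (hM y hy.1).2.1.trans ?_
      have := hy.1
      gcongr
    rw [h0, sub_zero, Real.norm_eq_abs, Real.norm_of_nonneg hd] at mv
    refine mv.trans ?_
    have : (a ^ (N + 1))⁻¹ ≤ 2 ^ (N + 1) * (ρ ^ (N + 1))⁻¹ := by
      rw [← div_eq_mul_inv, le_div_iff₀ (by positivity), inv_mul_le_iff₀ (by positivity), ← mul_pow]
      gcongr
      linarith
    calc _ ≤ (M * (2 ^ (N + 1) * (ρ ^ (N + 1))⁻¹)) * (ρ - a) := by gcongr
      _ = _ := by ring
  · refine (hM ρ hρ).1.trans ?_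
    have h1 : (1 : ℝ) ≤ 2 ^ N := one_le_pow₀ (by norm_num)
    have h2 : ρ ≤ 2 ^ N * (2 * (ρ - a)) := by nlinarith
    calc M * (ρ ^ N)⁻¹ = M * (ρ * (ρ ^ (N + 1))⁻¹) := by rw [pow_succ]; field_simp
      _ ≤ M * ((2 ^ N * (2 * (ρ - a))) * (ρ ^ (N + 1))⁻¹) := by gcongr
      _ = _ := by ring

/-- A profile vanishing at `a` is a limit of profiles with compact support in `(a, ∞)` that obey the
same decay bounds: the derivative of the inner cutoff, of size `1 / (ρ - a)`, is compensated by the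
vanishing of `F`. -/
lemma RadialDecay.exists_cutoff_of_vanish {a : ℝ} (ha : 0 < a) {N : ℕ} {F : ℝ → ℝ}
    (hF : RadialDecay a N F) (h0 : F a = 0) : ∃ (G : ℕ → ℝ → ℝ) (M : ℝ),
    (∀ n, ContDiff ℝ ∞ (G n) ∧ ∃ b d, a < b ∧ ∀ ρ, ρ ∉ Set.Icc b d → G n ρ = 0) ∧
    (∀ n ρ, a < ρ → |G n ρ| ≤ M * (ρ ^ N)⁻¹ ∧ |deriv (G n) ρ| ≤ M * (ρ ^ (N + 1))⁻¹) ∧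
    ∀ ρ, a < ρ → ∀ᶠ n in atTop, G n =ᶠ[𝓝 ρ] F := by
  obtain ⟨M, hM⟩ := hF.bound
  obtain ⟨M', hM'⟩ := hF.abs_le_of_vanish ha h0
  obtain ⟨S, hS, hS1, hS2⟩ := exists_deriv_cutoff_le a
  have hzero : ∀ n : ℕ, ∀ ρ, ρ ≤ a + 1 / (n + 1) → innerCutoff a n ρ = 0 := by
    intro n ρ h
    refine Real.smoothTransition.zero_of_nonpos ?_
    have hn0 : (0 : ℝ) < n + 1 := by positivity
    have : ρ - a ≤ 1 / (n + 1) := by linarith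
    rw [le_div_iff₀ hn0] at this
    linarith
  refine ⟨fun n ρ => innerCutoff a n ρ * outerCutoff n ρ * F ρ, |M| + (S * |M| + S * |M'|) + |M|,
    fun n => ⟨?_, a + 1 / (n + 1), 2 * (n + 1), by
      have : (0 : ℝ) < 1 / (n + 1) := by positivity
      linarith, fun ρ hρ => ?_⟩, fun n ρ hρ => ?_, fun ρ hρ => ?_⟩
  · rw [contDiff_iff_contDiffAt]
    intro ρ
    rcases le_or_gt ρ a with h | h
    · have : (fun ρ => innerCutoff a n ρ * outerCutoff n ρ * F ρ) =ᶠ[𝓝 ρ] fun _ => 0 := by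
        have : ρ < a + 1 / (n + 1) := by
          have : (0 : ℝ) < 1 / (n + 1) := by positivity
          linarith
        filter_upwards [Iio_mem_nhds this] with y hy
        rw [hzero n y (le_of_lt hy), zero_mul, zero_mul]
      exact contDiffAt_const.congr_of_eventuallyEq this
    · exact ((contDiff_innerCutoff a n).contDiffAt.mul (contDiff_outerCutoff n).contDiffAt).mul
        (hF.smooth.contDiffAt (Ioi_mem_nhds (ha.trans h)))
  · rw [Set.mem_Icc, not_and_or, not_le, not_le] at hρ
    beta_reduce
    rcases hρ with h | h
    · rw [hzero n ρ h.le, zero_mul, zero_mul]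
    · rw [outerCutoff_eq_zero h.le, mul_zero, zero_mul]
  · have hρ0 : 0 < ρ := ha.trans hρ
    have hd : 0 < ρ - a := sub_pos.2 hρ
    have p0 : 0 ≤ (ρ ^ N)⁻¹ := by positivity
    have p1 : 0 ≤ (ρ ^ (N + 1))⁻¹ := by positivity
    have bI := abs_innerCutoff_le a n ρ
    have bO := abs_outerCutoff_le n ρ
    have nI := abs_nonneg (innerCutoff a n ρ)
    have nO := abs_nonneg (outerCutoff n ρ)
    have bF : |F ρ| ≤ |M| * (ρ ^ N)⁻¹ :=
      (hM ρ hρ.le).1.trans (mul_le_mul_of_nonneg_right (le_abs_self M) p0)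
    have bF' : |deriv F ρ| ≤ |M| * (ρ ^ (N + 1))⁻¹ :=
      (hM ρ hρ.le).2.1.trans (mul_le_mul_of_nonneg_right (le_abs_self M) p1)
    have bV : |F ρ| ≤ |M'| * ((ρ - a) * (ρ ^ (N + 1))⁻¹) :=
      (hM' ρ hρ.le).trans (mul_le_mul_of_nonneg_right (le_abs_self M') (by positivity))
    constructor
    · rw [abs_mul, abs_mul]
      calc |innerCutoff a n ρ| * |outerCutoff n ρ| * |F ρ| ≤ 1 * 1 * (|M| * (ρ ^ N)⁻¹) := by gcongr
        _ ≤ _ := by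
          rw [one_mul, one_mul]
          refine mul_le_mul_of_nonneg_right ?_ p0
          have := mul_nonneg hS (abs_nonneg M)
          have := mul_nonneg hS (abs_nonneg M')
          linarith [abs_nonneg M]
    · have dI : HasDerivAt (innerCutoff a n) (deriv (innerCutoff a n) ρ) ρ :=
        ((contDiff_innerCutoff a n).differentiable (by simp) ρ).hasDerivAt
      have dO : HasDerivAt (outerCutoff n) (deriv (outerCutoff n) ρ) ρ :=
        ((contDiff_outerCutoff n).differentiable (by simp) ρ).hasDerivAt
      have dF : HasDerivAt F (deriv F ρ) ρ := (differentiableAt_of_smooth hF.smooth hρ0).hasDerivAt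
      beta_reduce
      rw [((dI.fun_mul dO).fun_mul dF).deriv]
      have t1 : |deriv (innerCutoff a n) ρ| * |outerCutoff n ρ| * |F ρ| ≤
          S * |M'| * (ρ ^ (N + 1))⁻¹ := by
        calc _ ≤ S / (ρ - a) * 1 * (|M'| * ((ρ - a) * (ρ ^ (N + 1))⁻¹)) := by
              gcongr; exact hS2 n ρ hρ
          _ = _ := by field_simp
      have t2 : |innerCutoff a n ρ| * |deriv (outerCutoff n) ρ| * |F ρ| ≤
          S * |M| * (ρ ^ (N + 1))⁻¹ := by
        calc _ ≤ 1 * (S / ρ) * (|M| * (ρ ^ N)⁻¹) := by gcongr; exact hS1 n ρ hρ0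
          _ = _ := by rw [pow_succ]; field_simp
      have t3 : |innerCutoff a n ρ| * |outerCutoff n ρ| * |deriv F ρ| ≤
          |M| * (ρ ^ (N + 1))⁻¹ := by
        calc _ ≤ 1 * 1 * (|M| * (ρ ^ (N + 1))⁻¹) := by gcongr
          _ = _ := by ring
      rw [add_mul]
      refine (abs_add_le _ _).trans ((add_le_add (abs_add_le _ _) le_rfl).trans ?_)
      simp only [abs_mul]
      have : 0 ≤ |M| * (ρ ^ (N + 1))⁻¹ := by positivity
      nlinarith
  · filter_upwards [eventually_innerCutoff hρ, eventually_outerCutoff ρ] with n h1 h2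
    filter_upwards [h1, h2] with y e1 e2
    rw [e1, e2, one_mul, one_mul]

/-- A profile without boundary condition is a limit on `(a, ∞)` of profiles which are smooth on the
whole line and vanish for large `ρ`. No inner cutoff at `a` is needed, so nothing has to vanish
there. -/
lemma RadialDecay.exists_cutoff {a : ℝ} (ha : 0 < a) {N : ℕ} {F : ℝ → ℝ}
    (hF : RadialDecay a N F) : ∃ (G : ℕ → ℝ → ℝ) (M : ℝ),
    (∀ n, ContDiff ℝ ∞ (G n) ∧ ∃ d, ∀ ρ, d < ρ → G n ρ = 0) ∧
    (∀ n ρ, a < ρ → |G n ρ| ≤ M * (ρ ^ N)⁻¹ ∧ |deriv (G n) ρ| ≤ M * (ρ ^ (N + 1))⁻¹) ∧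
    ∀ ρ, a < ρ → ∀ᶠ n in atTop, G n =ᶠ[𝓝 ρ] F := by
  obtain ⟨M, hM⟩ := hF.bound
  obtain ⟨S, hS, hS1, -⟩ := exists_deriv_cutoff_le a
  -- a fixed cutoff near the origin, equal to `1` on `[a, ∞)`
  set κ : ℝ → ℝ := fun ρ => Real.smoothTransition (2 * ρ / a - 1) with hκ
  have κ1 : ∀ ρ, a ≤ ρ → κ ρ = 1 := fun ρ h => by
    refine Real.smoothTransition.one_of_one_le ?_
    rw [le_sub_iff_add_le, le_div_iff₀ ha]; linarith
  have κ0 : ∀ ρ, ρ ≤ a / 2 → κ ρ = 0 := fun ρ h => by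
    refine Real.smoothTransition.zero_of_nonpos ?_
    rw [sub_nonpos, div_le_one ha]; linarith
  have κs : ContDiff ℝ ∞ κ := Real.smoothTransition.contDiff.comp
    (((contDiff_const.mul contDiff_id).div_const _).sub contDiff_const)
  have loc : ∀ n, ∀ ρ, a < ρ → (fun ρ => κ ρ * outerCutoff n ρ * F ρ) =ᶠ[𝓝 ρ]
      fun ρ => outerCutoff n ρ * F ρ := fun n ρ h => by
    filter_upwards [Ioi_mem_nhds h] with y hy
    rw [κ1 y (le_of_lt hy), one_mul]
  refine ⟨fun n ρ => κ ρ * outerCutoff n ρ * F ρ, |M| + S * |M|,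
    fun n => ⟨?_, 2 * (n + 1), fun ρ hρ => ?_⟩, fun n ρ hρ => ?_, fun ρ hρ => ?_⟩
  · rw [contDiff_iff_contDiffAt]
    intro ρ
    rcases le_or_gt ρ 0 with h | h
    · have : (fun ρ => κ ρ * outerCutoff n ρ * F ρ) =ᶠ[𝓝 ρ] fun _ => 0 := by
        filter_upwards [Iio_mem_nhds (show ρ < a / 2 by linarith)] with y hy
        rw [κ0 y (le_of_lt hy), zero_mul, zero_mul]
      exact contDiffAt_const.congr_of_eventuallyEq this
    · exact (κs.contDiffAt.mul (contDiff_outerCutoff n).contDiffAt).mul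
        (hF.smooth.contDiffAt (Ioi_mem_nhds h))
  · beta_reduce
    rw [outerCutoff_eq_zero hρ.le, mul_zero, zero_mul]
  · have hρ0 : 0 < ρ := ha.trans hρ
    have p0 : 0 ≤ (ρ ^ N)⁻¹ := by positivity
    have p1 : 0 ≤ (ρ ^ (N + 1))⁻¹ := by positivity
    have bO := abs_outerCutoff_le n ρ
    have bF : |F ρ| ≤ |M| * (ρ ^ N)⁻¹ :=
      (hM ρ hρ.le).1.trans (mul_le_mul_of_nonneg_right (le_abs_self M) p0)
    have bF' : |deriv F ρ| ≤ |M| * (ρ ^ (N + 1))⁻¹ :=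
      (hM ρ hρ.le).2.1.trans (mul_le_mul_of_nonneg_right (le_abs_self M) p1)
    have hSM := mul_nonneg hS (abs_nonneg M)
    have e1 := (loc n ρ hρ).eq_of_nhds
    have e2 := (loc n ρ hρ).deriv_eq
    beta_reduce at e1 ⊢
    rw [e2, e1]
    constructor
    · rw [abs_mul]
      calc |outerCutoff n ρ| * |F ρ| ≤ 1 * (|M| * (ρ ^ N)⁻¹) := by gcongr
        _ ≤ _ := by
          rw [one_mul]
          exact mul_le_mul_of_nonneg_right (by linarith) p0
    · have dO : HasDerivAt (outerCutoff n) (deriv (outerCutoff n) ρ) ρ :=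
        ((contDiff_outerCutoff n).differentiable (by simp) ρ).hasDerivAt
      have dF : HasDerivAt F (deriv F ρ) ρ := (differentiableAt_of_smooth hF.smooth hρ0).hasDerivAt
      rw [(dO.fun_mul dF).deriv]
      have t2 : |deriv (outerCutoff n) ρ| * |F ρ| ≤ S * |M| * (ρ ^ (N + 1))⁻¹ := by
        calc _ ≤ (S / ρ) * (|M| * (ρ ^ N)⁻¹) := by gcongr; exact hS1 n ρ hρ0
          _ = _ := by rw [pow_succ]; field_simp
      have t3 : |outerCutoff n ρ| * |deriv F ρ| ≤ |M| * (ρ ^ (N + 1))⁻¹ := by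
        calc _ ≤ 1 * (|M| * (ρ ^ (N + 1))⁻¹) := by gcongr
          _ = _ := by ring
      refine (abs_add_le _ _).trans ?_
      simp only [abs_mul]
      linarith
  · filter_upwards [eventually_outerCutoff ρ] with n h2
    filter_upwards [h2, loc n ρ hρ] with y e1 e2
    rw [e2, e1, one_mul]

/-! ### Fields with a radial factor -/

section Radial

variable {E : Type*} [NormedAddCommGroup E] [NormedSpace ℝ E]

lemma hasFDerivAt_norm_sq (x : Plane) :
    HasFDerivAt (fun y : Plane => ‖y‖ ^ 2) (2 • (innerSL ℝ x)) x :=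
  (hasStrictFDerivAt_norm_sq x).hasFDerivAt

lemma inner_stdVec (x : Plane) (i : Fin 2) : inner ℝ x (stdVec i) = x i := by
  simp [stdVec, EuclideanSpace.inner_single_right]

lemma norm_stdVec (i : Fin 2) : ‖stdVec i‖ = 1 := by simp [stdVec]

lemma pderiv_radial_smul {F : ℝ → ℝ} {P : Plane → E} {x : Plane}
    (hF : DifferentiableAt ℝ F (‖x‖ ^ 2)) (hP : DifferentiableAt ℝ P x) (i : Fin 2) :
    pderiv i (fun y => F (‖y‖ ^ 2) • P y) x =
      F (‖x‖ ^ 2) • pderiv i P x + (2 * x i * deriv F (‖x‖ ^ 2)) • P x := by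
  have h1 : HasFDerivAt (fun y : Plane => F (‖y‖ ^ 2)) (deriv F (‖x‖ ^ 2) • (2 • innerSL ℝ x)) x :=
    HasDerivAt.comp_hasFDerivAt x hF.hasDerivAt (hasFDerivAt_norm_sq x)
  rw [pderiv, (h1.fun_smul hP.hasFDerivAt).fderiv]
  simp only [add_apply, smul_apply,
    ContinuousLinearMap.smulRight_apply, innerSL_apply_apply, inner_stdVec, pderiv, nsmul_eq_mul,
    Nat.cast_ofNat, smul_eq_mul]
  congr 2
  ring

lemma pderiv_coord_smul {P : Plane → E} {x : Plane} (hP : DifferentiableAt ℝ P x) (i j : Fin 2) :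
    pderiv j (fun y => (2 * y i) • P y) x =
      (2 * x i) • pderiv j P x + (if i = j then (2 : ℝ) else 0) • P x := by
  have h1 : HasFDerivAt (fun y : Plane => 2 * y i) ((2 : ℝ) • coord i) x :=
    (coord i).hasFDerivAt.const_mul 2
  rw [pderiv, (h1.fun_smul hP.hasFDerivAt).fderiv]
  simp [pderiv, stdVec_apply]

lemma pderiv_add {f g : Plane → E} {x : Plane} (hf : DifferentiableAt ℝ f x)
    (hg : DifferentiableAt ℝ g x) (i : Fin 2) :
    pderiv i (fun y => f y + g y) x = pderiv i f x + pderiv i g x := by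
  simp only [pderiv]
  rw [fderiv_fun_add hf hg]
  rfl

lemma pderiv_congr {f g : Plane → E} {x : Plane} (h : f =ᶠ[𝓝 x] g) (i : Fin 2) :
    pderiv i f x = pderiv i g x := by
  rw [pderiv, h.fderiv_eq, pderiv]

lemma pderiv_clm_comp {G : Type*} [NormedAddCommGroup G] [NormedSpace ℝ G] (T : E →L[ℝ] G)
    {f : Plane → E} {x : Plane} (hf : DifferentiableAt ℝ f x) (i : Fin 2) :
    pderiv i (fun y => T (f y)) x = T (pderiv i f x) := by
  have h : HasFDerivAt (fun y => T (f y)) (T.comp (fderiv ℝ f x)) x :=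
    T.hasFDerivAt.comp x hf.hasFDerivAt
  rw [pderiv, h.fderiv]
  rfl

lemma norm_sq_pos {x : Plane} (hx : x ≠ 0) : 0 < ‖x‖ ^ 2 := pow_pos (norm_pos_iff.2 hx) 2

lemma contDiffOn_radial {F : ℝ → ℝ} (hF : ContDiffOn ℝ ∞ F (Set.Ioi 0)) :
    ContDiffOn ℝ ∞ (fun x : Plane => F (‖x‖ ^ 2)) {0}ᶜ :=
  hF.comp (contDiff_norm_sq ℝ).contDiffOn fun _ hx => norm_sq_pos hx

lemma differentiableAt_radial {F : ℝ → ℝ} (hF : ContDiffOn ℝ ∞ F (Set.Ioi 0)) {x : Plane}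
    (hx : x ≠ 0) : DifferentiableAt ℝ (fun x : Plane => F (‖x‖ ^ 2)) x :=
  ((contDiffOn_radial hF).contDiffAt (isOpen_punctured.mem_nhds hx)).differentiableAt (by simp)

lemma contDiff_pderiv {P : Plane → E} (hP : ContDiff ℝ ∞ P) (i : Fin 2) :
    ContDiff ℝ ∞ (pderiv i P) := by
  rw [← contDiffOn_univ] at hP ⊢
  exact contDiffOn_pderiv isOpen_univ hP i

/-- Second derivatives of `F(|x|²) P(x)`, by the product rule and `∂ᵢ|x|² = 2xᵢ`. -/
lemma pderiv_pderiv_radial_smul {F : ℝ → ℝ} (hF : ContDiffOn ℝ ∞ F (Set.Ioi 0)) {P : Plane → E}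
    (hP : ContDiff ℝ ∞ P) {x : Plane} (hx : x ≠ 0) (i j : Fin 2) :
    pderiv j (pderiv i (fun y => F (‖y‖ ^ 2) • P y)) x =
      F (‖x‖ ^ 2) • pderiv j (pderiv i P) x + (2 * x j * deriv F (‖x‖ ^ 2)) • pderiv i P x +
      (deriv F (‖x‖ ^ 2) • ((2 * x i) • pderiv j P x + (if i = j then (2 : ℝ) else 0) • P x) +
        (2 * x j * deriv (deriv F) (‖x‖ ^ 2)) • ((2 * x i) • P x)) := by
  have hd : ∀ {Q : Plane → E}, ContDiff ℝ ∞ Q → ∀ y, DifferentiableAt ℝ Q y := fun h y =>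
    h.differentiable (by simp) y
  have hQ : ContDiff ℝ ∞ (fun y : Plane => (2 * y i) • P y) :=
    (contDiff_const.mul (coord i).contDiff).smul hP
  have e : pderiv i (fun y => F (‖y‖ ^ 2) • P y) =ᶠ[𝓝 x] fun y =>
      F (‖y‖ ^ 2) • pderiv i P y + deriv F (‖y‖ ^ 2) • ((2 * y i) • P y) := by
    filter_upwards [isOpen_punctured.mem_nhds hx] with y hy
    rw [pderiv_radial_smul (differentiableAt_of_smooth hF (norm_sq_pos hy)) (hd hP y), smul_smul,
      mul_comm (deriv F _)]
  have hF' := contDiffOn_deriv hF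
  rw [pderiv_congr e, pderiv_add
    ((differentiableAt_radial hF hx).fun_smul (hd (contDiff_pderiv hP i) x))
    ((differentiableAt_radial hF' hx).fun_smul (hd hQ x)),
    pderiv_radial_smul (differentiableAt_of_smooth hF (norm_sq_pos hx)) (hd (contDiff_pderiv hP i) x),
    pderiv_radial_smul (differentiableAt_of_smooth hF' (norm_sq_pos hx)) (hd hQ x),
    pderiv_coord_smul (hd hP x)]

/-- A smooth function bounded by a multiple of `|x|^k`, with derivatives up to order two bounded
accordingly, as for homogeneous polynomials of degree `k`. -/
structure HomogeneousBound (k : ℕ) (P : Plane → E) : Prop where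
  smooth : ContDiff ℝ ∞ P
  bound : ∃ K, 0 ≤ K ∧ ∀ x, ‖P x‖ ≤ K * ‖x‖ ^ k ∧ (∀ i, ‖pderiv i P x‖ * ‖x‖ ≤ K * ‖x‖ ^ k) ∧
    ∀ i j, ‖pderiv j (pderiv i P) x‖ * ‖x‖ ^ 2 ≤ K * ‖x‖ ^ k

lemma abs_coord_le (x : Plane) (i : Fin 2) : |x i| ≤ ‖x‖ := PiLp.norm_apply_le x i

/-- Each differentiation of `F(|x|²) P(x)` gains a factor `1/|x|`. -/
lemma norm_pderiv_radial_le {F : ℝ → ℝ} {P : Plane → E} {x : Plane} {k N : ℕ} {K M : ℝ}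
    (hx : x ≠ 0) (hF : DifferentiableAt ℝ F (‖x‖ ^ 2)) (hP : DifferentiableAt ℝ P x)
    (h0 : |F (‖x‖ ^ 2)| ≤ M * ((‖x‖ ^ 2) ^ N)⁻¹)
    (h1 : |deriv F (‖x‖ ^ 2)| ≤ M * ((‖x‖ ^ 2) ^ (N + 1))⁻¹) (hP0 : ‖P x‖ ≤ K * ‖x‖ ^ k) (i : Fin 2)
    (hP1 : ‖pderiv i P x‖ * ‖x‖ ≤ K * ‖x‖ ^ k) :
    ‖pderiv i (fun y => F (‖y‖ ^ 2) • P y) x‖ ≤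
      3 * (M * K) * (((‖x‖ ^ 2) ^ N)⁻¹ * ‖x‖ ^ k * ‖x‖⁻¹) := by
  have hr : 0 < ‖x‖ := norm_pos_iff.2 hx
  rw [pderiv_radial_smul hF hP]
  refine (norm_add_le _ _).trans ?_
  rw [norm_smul, norm_smul, Real.norm_eq_abs, Real.norm_eq_abs, abs_mul, abs_mul, abs_two]
  have hP1' : ‖pderiv i P x‖ ≤ K * ‖x‖ ^ k * ‖x‖⁻¹ := by
    rw [← div_eq_mul_inv, le_div_iff₀ hr]; exact hP1
  have b1 : |F (‖x‖ ^ 2)| * ‖pderiv i P x‖ ≤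
      (M * ((‖x‖ ^ 2) ^ N)⁻¹) * (K * ‖x‖ ^ k * ‖x‖⁻¹) :=
    mul_le_mul h0 hP1' (norm_nonneg _) ((abs_nonneg _).trans h0)
  have b2 : 2 * |x i| * |deriv F (‖x‖ ^ 2)| * ‖P x‖ ≤
      2 * ‖x‖ * (M * ((‖x‖ ^ 2) ^ (N + 1))⁻¹) * (K * ‖x‖ ^ k) := by
    have h2 := abs_coord_le x i
    have h3 := (abs_nonneg _).trans h1
    gcongr
  have e : 2 * ‖x‖ * (M * ((‖x‖ ^ 2) ^ (N + 1))⁻¹) * (K * ‖x‖ ^ k) =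
      2 * ((M * ((‖x‖ ^ 2) ^ N)⁻¹) * (K * ‖x‖ ^ k * ‖x‖⁻¹)) := by
    rw [pow_succ]
    field_simp
  calc _ ≤ _ := add_le_add b1 (b2.trans e.le)
    _ = _ := by ring

/-- In the exterior of the disk, the excess decay of `r^{k - 2N}` over `r^{-s}` is absorbed in a
power of `ε`. -/
lemma decay_le {ε r : ℝ} (hε : 0 < ε) (hr : ε ≤ r) {k s N : ℕ} (h : k + s ≤ 2 * N) :
    ((r ^ 2) ^ N)⁻¹ * r ^ k ≤ (ε ^ (2 * N - k - s))⁻¹ * (r ^ s)⁻¹ := by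
  have hr0 : 0 < r := hε.trans_le hr
  have e : (r ^ 2) ^ N = r ^ k * (r ^ (2 * N - k - s) * r ^ s) := by
    rw [← pow_mul, ← pow_add, ← pow_add]; congr 1; omega
  rw [e, mul_inv, mul_inv]
  have : (r ^ k)⁻¹ * ((r ^ (2 * N - k - s))⁻¹ * (r ^ s)⁻¹) * r ^ k =
      (r ^ (2 * N - k - s))⁻¹ * (r ^ s)⁻¹ := by field_simp
  rw [this]
  gcongr

/-- Products of a decaying profile vanishing at `ρ = ε²` with a homogeneous field. -/
lemma vanishingField_radial {ε : ℝ} (hε : 0 < ε) {k s N : ℕ} (hks : k + s ≤ 2 * N) {F : ℝ → ℝ}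
    (hF : RadialDecay (ε ^ 2) N F) (h0 : F (ε ^ 2) = 0) {P : Plane → Plane}
    (hP : HomogeneousBound k P) : VanishingField ε s (fun x => F (‖x‖ ^ 2) • P x) := by
  obtain ⟨K, hK, hPb⟩ := hP.bound
  obtain ⟨M, hM⟩ := hF.bound
  obtain ⟨G, A, hG1, hG2, hG3⟩ := hF.exists_cutoff_of_vanish (by positivity) h0
  set D := (ε ^ (2 * N - k - s))⁻¹ with hD
  have hD0 : 0 ≤ D := by positivity
  have hsq : ∀ {x : Plane}, x ∈ extDisk ε → ε ^ 2 < ‖x‖ ^ 2 := fun hx =>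
    pow_lt_pow_left₀ hx hε.le (by norm_num)
  have hdP : ∀ x, DifferentiableAt ℝ P x := hP.smooth.differentiable (by simp)
  have hinv : ∀ {x : Plane}, x ∈ extDisk ε → ‖x‖⁻¹ ≤ ε⁻¹ := fun hx => inv_anti₀ hε (le_of_lt hx)
  -- any quantity bounded by a multiple of `ρ^{-N} |x|^k` has the decay `|x|^{-s}`
  have main : ∀ {x : Plane}, x ∈ extDisk ε → ∀ {m : ℝ} (c : ℝ), 0 ≤ m → m ≤ c → ∀ {y : ℝ},
      y ≤ m * (((‖x‖ ^ 2) ^ N)⁻¹ * ‖x‖ ^ k) → y ≤ c * D * (‖x‖ ^ s)⁻¹ := by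
    intro x hx m c hm hmc y hy
    have h1 := decay_le hε (le_of_lt hx) hks
    calc y ≤ m * (D * (‖x‖ ^ s)⁻¹) := hy.trans (by gcongr)
      _ ≤ c * (D * (‖x‖ ^ s)⁻¹) := by gcongr
      _ = _ := by ring
  -- bounds for `H(|x|²) P` and its gradient, used both for `F` and for its cutoffs
  have bound0 : ∀ {H : ℝ → ℝ} {m : ℝ} {x : Plane}, |H (‖x‖ ^ 2)| ≤ m * ((‖x‖ ^ 2) ^ N)⁻¹ →
      ‖H (‖x‖ ^ 2) • P x‖ ≤ (|m| * K) * (((‖x‖ ^ 2) ^ N)⁻¹ * ‖x‖ ^ k) := by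
    intro H m x h
    rw [norm_smul, Real.norm_eq_abs]
    have h2 := (hPb x).1
    calc _ ≤ (|m| * ((‖x‖ ^ 2) ^ N)⁻¹) * (K * ‖x‖ ^ k) := by
          gcongr
          refine h.trans ?_
          gcongr
          exact le_abs_self m
      _ = _ := by ring
  have bound1 : ∀ {H : ℝ → ℝ} {m : ℝ} {x : Plane}, x ∈ extDisk ε → DifferentiableAt ℝ H (‖x‖ ^ 2) →
      |H (‖x‖ ^ 2)| ≤ m * ((‖x‖ ^ 2) ^ N)⁻¹ → |deriv H (‖x‖ ^ 2)| ≤ m * ((‖x‖ ^ 2) ^ (N + 1))⁻¹ →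
      ∀ i, ‖pderiv i (fun y => H (‖y‖ ^ 2) • P y) x‖ ≤
        (3 * (|m| * K) * ε⁻¹) * (((‖x‖ ^ 2) ^ N)⁻¹ * ‖x‖ ^ k) := by
    intro H m x hx hd h1 h2 i
    refine (norm_pderiv_radial_le (ne_zero_of_mem_extDisk hε hx) hd (hdP x) h1 h2 (hPb x).1 i
      ((hPb x).2.1 i)).trans ?_
    have h3 := hinv hx
    have h4 := le_abs_self m
    calc 3 * (m * K) * (((‖x‖ ^ 2) ^ N)⁻¹ * ‖x‖ ^ k * ‖x‖⁻¹)
        ≤ 3 * (|m| * K) * (((‖x‖ ^ 2) ^ N)⁻¹ * ‖x‖ ^ k * ε⁻¹) := by gcongr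
      _ = _ := by ring
  have bound2 : ∀ {x : Plane}, x ∈ extDisk ε → ∀ i j,
      ‖pderiv j (pderiv i (fun y => F (‖y‖ ^ 2) • P y)) x‖ ≤
        (11 * (|M| * K) * (ε⁻¹ * ε⁻¹)) * (((‖x‖ ^ 2) ^ N)⁻¹ * ‖x‖ ^ k) := by
    intro x hx i j
    have hx0 := ne_zero_of_mem_extDisk hε hx
    have hr : 0 < ‖x‖ := norm_pos_iff.2 hx0
    obtain ⟨f0, f1, f2⟩ := hM _ (hsq hx).le
    obtain ⟨p0, p1, p2⟩ := hPb x
    set T := ((‖x‖ ^ 2) ^ N)⁻¹ with hT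
    have hT0 : 0 ≤ T := by positivity
    have hMa := le_abs_self M
    have g0 : |F (‖x‖ ^ 2)| ≤ |M| * T := f0.trans (by gcongr)
    have g1 : |deriv F (‖x‖ ^ 2)| ≤ |M| * T * (‖x‖⁻¹ * ‖x‖⁻¹) := by
      refine f1.trans ?_
      rw [pow_succ, mul_inv, ← hT]
      calc M * (T * (‖x‖ ^ 2)⁻¹) ≤ |M| * (T * (‖x‖ ^ 2)⁻¹) := by gcongr
        _ = _ := by field_simp
    have g2 : |deriv (deriv F) (‖x‖ ^ 2)| ≤ |M| * T * (‖x‖⁻¹ * ‖x‖⁻¹ * (‖x‖⁻¹ * ‖x‖⁻¹)) := by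
      refine f2.trans ?_
      rw [pow_add, mul_inv, ← hT]
      calc M * (T * ((‖x‖ ^ 2) ^ 2)⁻¹) ≤ |M| * (T * ((‖x‖ ^ 2) ^ 2)⁻¹) := by gcongr
        _ = _ := by field_simp
    have q1 : ∀ i, ‖pderiv i P x‖ ≤ K * ‖x‖ ^ k * ‖x‖⁻¹ := fun i => by
      rw [← div_eq_mul_inv, le_div_iff₀ hr]; exact p1 i
    have q2 : ‖pderiv j (pderiv i P) x‖ ≤ K * ‖x‖ ^ k * (‖x‖⁻¹ * ‖x‖⁻¹) := by
      have := p2 i j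
      rw [← le_div_iff₀ (by positivity)] at this
      refine this.trans (le_of_eq ?_)
      field_simp
    have cj := abs_coord_le x j
    have ci := abs_coord_le x i
    have hite : |(if i = j then (2 : ℝ) else 0)| ≤ 2 := by split_ifs <;> simp
    rw [pderiv_pderiv_radial_smul hF.smooth hP.smooth hx0]
    refine (norm_add_le _ _).trans ((add_le_add (norm_add_le _ _) (norm_add_le _ _)).trans ?_)
    have t1 : ‖F (‖x‖ ^ 2) • pderiv j (pderiv i P) x‖ ≤
        (|M| * T) * (K * ‖x‖ ^ k * (‖x‖⁻¹ * ‖x‖⁻¹)) := by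
      rw [norm_smul, Real.norm_eq_abs]
      gcongr
    have t2 : ‖(2 * x j * deriv F (‖x‖ ^ 2)) • pderiv i P x‖ ≤
        (2 * ‖x‖ * (|M| * T * (‖x‖⁻¹ * ‖x‖⁻¹))) * (K * ‖x‖ ^ k * ‖x‖⁻¹) := by
      rw [norm_smul, Real.norm_eq_abs, abs_mul, abs_mul, abs_two]
      gcongr
      exact q1 i
    have t3 : ‖deriv F (‖x‖ ^ 2) • ((2 * x i) • pderiv j P x + (if i = j then (2 : ℝ) else 0) • P x)‖ ≤
        (|M| * T * (‖x‖⁻¹ * ‖x‖⁻¹)) * (2 * ‖x‖ * (K * ‖x‖ ^ k * ‖x‖⁻¹) + 2 * (K * ‖x‖ ^ k)) := by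
      rw [norm_smul, Real.norm_eq_abs]
      refine mul_le_mul g1 ((norm_add_le _ _).trans (add_le_add ?_ ?_)) (norm_nonneg _) (by positivity)
      · rw [norm_smul, Real.norm_eq_abs, abs_mul, abs_two]
        gcongr
        exact q1 j
      · rw [norm_smul, Real.norm_eq_abs]
        gcongr
    have t4 : ‖(2 * x j * deriv (deriv F) (‖x‖ ^ 2)) • ((2 * x i) • P x)‖ ≤
        (2 * ‖x‖ * (|M| * T * (‖x‖⁻¹ * ‖x‖⁻¹ * (‖x‖⁻¹ * ‖x‖⁻¹)))) * (2 * ‖x‖ * (K * ‖x‖ ^ k)) := by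
      rw [norm_smul, norm_smul, Real.norm_eq_abs, Real.norm_eq_abs, abs_mul, abs_mul, abs_mul, abs_two]
      gcongr
    refine (add_le_add (add_le_add t1 t2) (add_le_add t3 t4)).trans ?_
    have hri := hinv hx
    calc _ = 11 * (|M| * K) * (‖x‖⁻¹ * ‖x‖⁻¹) * (T * ‖x‖ ^ k) := by field_simp; ring
      _ ≤ _ := by gcongr
  refine ⟨(contDiffOn_radial hF.smooth).smul hP.smooth.contDiffOn,
    ⟨(|M| * K + 3 * (|M| * K) * ε⁻¹ + 11 * (|M| * K) * (ε⁻¹ * ε⁻¹)) * D, fun x hx => ?_⟩,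
    fun n x => G n (‖x‖ ^ 2) • P x, (|A| * K + 3 * (|A| * K) * ε⁻¹) * D, fun n => ?_,
    fun n x hx => ?_, fun x hx => ?_⟩
  · obtain ⟨f0, f1, -⟩ := hM _ (hsq hx).le
    have n1 : 0 ≤ |M| * K := by positivity
    have n2 : 0 ≤ 3 * (|M| * K) * ε⁻¹ := by positivity
    have n3 : 0 ≤ 11 * (|M| * K) * (ε⁻¹ * ε⁻¹) := by positivity
    have hd := differentiableAt_of_smooth hF.smooth (norm_sq_pos (ne_zero_of_mem_extDisk hε hx))
    exact ⟨main hx _ n1 (by linarith) (bound0 f0),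
      fun i => main hx _ n2 (by linarith) (bound1 hx hd f0 f1 i),
      fun i j => main hx _ n3 (by linarith) (bound2 hx i j)⟩
  · obtain ⟨hs, b, d, hb, hz⟩ := hG1 n
    have hsupp : Function.support (fun x => G n (‖x‖ ^ 2) • P x) ⊆
        {x : Plane | ‖x‖ ^ 2 ∈ Set.Icc b d} := by
      intro x hx
      by_contra h
      exact hx (by simp only [hz _ h, zero_smul])
    have hcl : IsClosed {x : Plane | ‖x‖ ^ 2 ∈ Set.Icc b d} :=
      isClosed_Icc.preimage (continuous_norm.pow 2)
    have hts : tsupport (fun x => G n (‖x‖ ^ 2) • P x) ⊆ {x : Plane | ‖x‖ ^ 2 ∈ Set.Icc b d} :=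
      closure_minimal hsupp hcl
    refine ⟨(hs.comp (contDiff_norm_sq ℝ)).smul hP.smooth, ?_, hts.trans fun x hx => ?_⟩
    · refine (isCompact_closedBall (0 : Plane) (Real.sqrt d)).of_isClosed_subset
        (isClosed_tsupport _) (hts.trans fun x hx => ?_)
      rw [mem_closedBall_zero_iff]
      exact Real.le_sqrt_of_sq_le hx.2
    · exact lt_of_pow_lt_pow_left₀ 2 (norm_nonneg x) (hb.trans_le hx.1)
  · obtain ⟨g0, g1⟩ := hG2 n _ (hsq hx)
    have n1 : 0 ≤ |A| * K := by positivity
    have n2 : 0 ≤ 3 * (|A| * K) * ε⁻¹ := by positivity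
    exact ⟨main hx _ n1 (by linarith) (bound0 g0), fun i => main hx _ n2 (by linarith)
      (bound1 hx ((hG1 n).1.differentiable (by simp) _) g0 g1 i)⟩
  · filter_upwards [hG3 _ (hsq hx)] with n hn
    have hc : ContinuousAt (fun y : Plane => ‖y‖ ^ 2) x := (continuous_norm.pow 2).continuousAt
    filter_upwards [hc.eventually hn] with y hy
    rw [hy]

/-- Solenoidal `L^p` fields are orthogonal to the gradients of decaying potentials. The potentials need
not vanish on the boundary, since the test functions in the definition of `L^p_σ` may meet it. -/
lemma MemLpSigma.integral_gradient_radial {ε : ℝ} (hε : 0 < ε) {p q : ℝ≥0∞}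
    [ENNReal.HolderConjugate p q] (hq : q ≠ ⊤) (hq1 : 1 < q.toReal) {k N : ℕ} (hkN : k + 1 ≤ 2 * N)
    {F : ℝ → ℝ} (hF : RadialDecay (ε ^ 2) N F) {P : Plane → ℝ} (hP : HomogeneousBound k P)
    {w : Plane → Plane} (hw : MemLpSigma ε p w) :
    ∫ x in extDisk ε, ∑ i, w x i * pderiv i (fun y => F (‖y‖ ^ 2) • P y) x = 0 := by
  obtain ⟨K, hK, hPb⟩ := hP.bound
  obtain ⟨G, A, hG1, hG2, hG3⟩ := hF.exists_cutoff (by positivity)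
  have hsq : ∀ {x : Plane}, x ∈ extDisk ε → ε ^ 2 < ‖x‖ ^ 2 := fun hx =>
    pow_lt_pow_left₀ hx hε.le (by norm_num)
  have hae : ∀ {R : Plane → Prop}, (∀ x ∈ extDisk ε, R x) → ∀ᵐ x ∂(volume.restrict (extDisk ε)), R x :=
    fun hR => (ae_restrict_iff' (measurableSet_extDisk ε)).2 (ae_of_all _ hR)
  have hs : ∀ n, ContDiff ℝ ∞ (fun x => G n (‖x‖ ^ 2) • P x) := fun n =>
    ((hG1 n).1.comp (contDiff_norm_sq ℝ)).smul hP.smooth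
  have hcs : ∀ n, HasCompactSupport (fun x => G n (‖x‖ ^ 2) • P x) := by
    intro n
    obtain ⟨-, d, hd⟩ := hG1 n
    refine HasCompactSupport.intro (isCompact_closedBall (0 : Plane) (Real.sqrt |d|)) fun x hx => ?_
    rw [mem_closedBall_zero_iff, not_le, Real.sqrt_lt' (norm_pos_iff.2 ?_)] at hx
    · rw [hd _ ((le_abs_self d).trans_lt hx), zero_smul]
    · rintro rfl
      simp only [norm_zero] at hx
      exact absurd hx (not_lt.2 (Real.sqrt_nonneg _))
  set D := (ε ^ (2 * N - k - 1))⁻¹ with hD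
  have hD0 : 0 ≤ D := by positivity
  have bnd : ∀ n, ∀ x ∈ extDisk ε, ∀ i, ‖pderiv i (fun x => G n (‖x‖ ^ 2) • P x) x‖ ≤
      3 * (|A| * K) * D * (‖x‖ ^ 2)⁻¹ := by
    intro n x hx i
    have hx0 := ne_zero_of_mem_extDisk hε hx
    obtain ⟨g0, g1⟩ := hG2 n _ (hsq hx)
    refine (norm_pderiv_radial_le hx0 ((hG1 n).1.differentiable (by simp) _)
      (hP.smooth.differentiable (by simp) x) g0 g1 (hPb x).1 i ((hPb x).2.1 i)).trans ?_
    have h1 := decay_le hε (le_of_lt hx) hkN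
    have h2 := le_abs_self A
    calc 3 * (A * K) * (((‖x‖ ^ 2) ^ N)⁻¹ * ‖x‖ ^ k * ‖x‖⁻¹)
        ≤ 3 * (|A| * K) * ((D * (‖x‖ ^ 1)⁻¹) * ‖x‖⁻¹) := by gcongr
      _ = _ := by rw [pow_one, pow_two, mul_inv]; ring
  have key : Tendsto (fun n => ∫ x in extDisk ε,
      ∑ i, w x i * pderiv i (fun x => G n (‖x‖ ^ 2) • P x) x) atTop
      (𝓝 (∫ x in extDisk ε, ∑ i, w x i * pderiv i (fun y => F (‖y‖ ^ 2) • P y) x)) := by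
    refine tendsto_integral_of_dominated_convergence
      (fun x => ‖w x‖ * ((2 * (3 * (|A| * K) * D)) * (‖x‖ ^ 2)⁻¹)) (fun n => ?_) ?_
      (fun n => hae fun x hx => ?_) (hae fun x hx => ?_)
    · have : ∀ i, AEStronglyMeasurable (fun x => w x i * pderiv i (fun x => G n (‖x‖ ^ 2) • P x) x)
          (volume.restrict (extDisk ε)) := fun i =>
        ((coord i).continuous.comp_aestronglyMeasurable hw.1.1).mul
          (contDiff_pderiv (hs n) i).continuous.aestronglyMeasurable
      exact Finset.aestronglyMeasurable_fun_sum _ fun i _ => this i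
    · refine hw.1.norm.integrable_mul ((memLp_inv_norm_pow hε hq ?_).const_mul _)
      push_cast
      linarith
    · rw [Fin.sum_univ_two]
      refine (norm_add_le _ _).trans ?_
      rw [norm_mul, norm_mul]
      have b0 : ‖w x 0‖ * ‖pderiv 0 (fun x => G n (‖x‖ ^ 2) • P x) x‖ ≤
          ‖w x‖ * (3 * (|A| * K) * D * (‖x‖ ^ 2)⁻¹) := by
        gcongr
        · exact abs_coord_le _ _
        · exact bnd n x hx 0
      have b1 : ‖w x 1‖ * ‖pderiv 1 (fun x => G n (‖x‖ ^ 2) • P x) x‖ ≤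
          ‖w x‖ * (3 * (|A| * K) * D * (‖x‖ ^ 2)⁻¹) := by
        gcongr
        · exact abs_coord_le _ _
        · exact bnd n x hx 1
      linarith
    · refine tendsto_const_nhds.congr' ?_
      filter_upwards [hG3 _ (hsq hx)] with n hn
      have hc : ContinuousAt (fun y : Plane => ‖y‖ ^ 2) x := (continuous_norm.pow 2).continuousAt
      have : (fun y => F (‖y‖ ^ 2) • P y) =ᶠ[𝓝 x] fun y => G n (‖y‖ ^ 2) • P y := by
        filter_upwards [hc.eventually hn] with y hy
        rw [hy]
      simp_rw [pderiv_congr this]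
  refine tendsto_nhds_unique key (tendsto_const_nhds.congr fun n => ?_)
  have := hw.2 _ (hs n) (hcs n)
  simp_rw [fderiv_apply_eq_sum] at this
  exact this.symm

end Radial

/-! ### Fields and potentials given by powers of a complex coordinate -/

section ComplexPowers

/-- A complex linear coordinate on the plane: either `z = x₁ + i x₂` or its conjugate. Both satisfy
`L e₁ = 1` and `(L e₂)² = -1`, which is what makes the powers of `L` harmonic. -/
structure IsComplexCoord (L : Plane →L[ℝ] ℂ) : Prop where
  map_zero : L (stdVec 0) = 1
  map_one_sq : L (stdVec 1) ^ 2 = -1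

/-- The coordinate `z = x₁ + i x₂`. -/
noncomputable def zCoord : Plane →L[ℝ] ℂ := toC.toContinuousLinearEquiv

/-- The coordinate `x₁ - i x₂`. -/
noncomputable def zbarCoord : Plane →L[ℝ] ℂ := (Complex.conjCLE : ℂ →L[ℝ] ℂ).comp zCoord

lemma zCoord_apply (x : Plane) : zCoord x = toC x := rfl

lemma zbarCoord_apply (x : Plane) : zbarCoord x = (starRingEnd ℂ) (toC x) := rfl

lemma toC_stdVec_zero : toC (stdVec 0) = 1 := by
  simp [toC_apply, stdVec_apply]

lemma toC_stdVec_one : toC (stdVec 1) = Complex.I := by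
  simp [toC_apply, stdVec_apply]

lemma isComplexCoord_zCoord : IsComplexCoord zCoord :=
  ⟨by rw [zCoord_apply, toC_stdVec_zero], by rw [zCoord_apply, toC_stdVec_one, Complex.I_sq]⟩

lemma isComplexCoord_zbarCoord : IsComplexCoord zbarCoord :=
  ⟨by rw [zbarCoord_apply, toC_stdVec_zero, map_one],
    by rw [zbarCoord_apply, toC_stdVec_one, ← map_pow, Complex.I_sq, map_neg, map_one]⟩

lemma norm_zCoord (x : Plane) : ‖zCoord x‖ = ‖x‖ := norm_toC x

lemma norm_zbarCoord (x : Plane) : ‖zbarCoord x‖ = ‖x‖ := by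
  rw [zbarCoord_apply, RCLike.norm_conj, norm_toC]

variable {L : Plane →L[ℝ] ℂ}

lemma coord_decomposition (L : Plane →L[ℝ] ℂ) (x : Plane) :
    L x = x 0 * L (stdVec 0) + x 1 * L (stdVec 1) := by
  have : x = x 0 • stdVec 0 + x 1 • stdVec 1 := by
    ext i
    fin_cases i <;> simp [stdVec]
  conv_lhs => rw [this]
  simp

lemma hasFDerivAt_const_mul_pow (L : Plane →L[ℝ] ℂ) (c : ℂ) (k : ℕ) (x : Plane) :
    HasFDerivAt (fun y => c * L y ^ k) ((c * (k * L x ^ (k - 1))) • L) x := by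
  have := (L.hasFDerivAt (x := x)).pow k
  refine (this.const_mul c).congr_fderiv ?_
  ext v
  simp
  ring

lemma pderiv_const_mul_pow (L : Plane →L[ℝ] ℂ) (c : ℂ) (k : ℕ) (i : Fin 2) :
    pderiv i (fun y => c * L y ^ k) = fun x => (c * k * L (stdVec i)) * L x ^ (k - 1) := by
  ext x
  rw [pderiv, (hasFDerivAt_const_mul_pow L c k x).fderiv]
  simp
  ring

lemma contDiff_const_mul_pow (L : Plane →L[ℝ] ℂ) (c : ℂ) (k : ℕ) :
    ContDiff ℝ ∞ (fun y => c * L y ^ k) := contDiff_const.mul (L.contDiff.pow k)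

lemma pow_pred_mul_le (r : ℝ) (k : ℕ) : (k : ℝ) * r ^ (k - 1) * r ≤ k * r ^ k := by
  cases k with
  | zero => simp
  | succ k => rw [Nat.add_sub_cancel, mul_assoc, ← pow_succ]

lemma homogeneousBound_pow (hn : ∀ x, ‖L x‖ = ‖x‖) (c : ℂ) (k : ℕ) :
    HomogeneousBound k (fun y => c * L y ^ k) := by
  refine ⟨contDiff_const_mul_pow L c k, ‖c‖ * (1 + k + k * k), by positivity, fun x =>
    ⟨?_, fun i => ?_, fun i j => ?_⟩⟩
  · rw [norm_mul, norm_pow, hn]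
    gcongr
    have : (0 : ℝ) ≤ k + k * k := by positivity
    nlinarith [norm_nonneg c]
  · rw [pderiv_const_mul_pow]
    simp only [norm_mul, norm_pow, hn, norm_stdVec, Complex.norm_natCast]
    have := pow_pred_mul_le ‖x‖ k
    calc ‖c‖ * k * 1 * ‖x‖ ^ (k - 1) * ‖x‖ = ‖c‖ * (k * ‖x‖ ^ (k - 1) * ‖x‖) := by ring
      _ ≤ ‖c‖ * (k * ‖x‖ ^ k) := by gcongr
      _ = ‖c‖ * k * ‖x‖ ^ k := by ring
      _ ≤ _ := by
        gcongr
        nlinarith [sq_nonneg (k : ℝ)]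
  · rw [pderiv_const_mul_pow, pderiv_const_mul_pow]
    simp only [norm_mul, norm_pow, hn, norm_stdVec, Complex.norm_natCast]
    have h1 := pow_pred_mul_le ‖x‖ (k - 1)
    have h2 := pow_pred_mul_le ‖x‖ k
    have h3 : ((k - 1 : ℕ) : ℝ) ≤ k := by exact_mod_cast Nat.sub_le _ _
    calc ‖c‖ * k * 1 * (k - 1 : ℕ) * 1 * ‖x‖ ^ (k - 1 - 1) * ‖x‖ ^ 2
        = ‖c‖ * k * ‖x‖ * ((k - 1 : ℕ) * ‖x‖ ^ (k - 1 - 1) * ‖x‖) := by ring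
      _ ≤ ‖c‖ * k * ‖x‖ * ((k - 1 : ℕ) * ‖x‖ ^ (k - 1)) := by gcongr
      _ ≤ ‖c‖ * k * ‖x‖ * (k * ‖x‖ ^ (k - 1)) := by gcongr
      _ = ‖c‖ * k * (k * ‖x‖ ^ (k - 1) * ‖x‖) := by ring
      _ ≤ ‖c‖ * k * (k * ‖x‖ ^ k) := by gcongr
      _ = ‖c‖ * (k * k) * ‖x‖ ^ k := by ring
      _ ≤ _ := by
        gcongr
        have : (0 : ℝ) ≤ k := by positivity
        linarith

lemma HomogeneousBound.clm_comp {E G : Type*} [NormedAddCommGroup E] [NormedSpace ℝ E]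
    [NormedAddCommGroup G] [NormedSpace ℝ G] {k : ℕ} {P : Plane → E} (hP : HomogeneousBound k P)
    (T : E →L[ℝ] G) : HomogeneousBound k (fun x => T (P x)) := by
  obtain ⟨K, hK, h⟩ := hP.bound
  have e1 : ∀ i, pderiv i (fun x => T (P x)) = fun x => T (pderiv i P x) := fun i =>
    funext fun x => pderiv_clm_comp T (hP.smooth.differentiable (by simp) x) i
  have e2 : ∀ i j, pderiv j (pderiv i (fun x => T (P x))) = fun x => T (pderiv j (pderiv i P) x) :=
    fun i j => by
      rw [e1]
      exact funext fun x =>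
        pderiv_clm_comp T ((contDiff_pderiv hP.smooth i).differentiable (by simp) x) j
  refine ⟨T.contDiff.comp hP.smooth, ‖T‖ * K, by positivity, fun x => ⟨?_, fun i => ?_, fun i j => ?_⟩⟩
  · calc _ ≤ ‖T‖ * ‖P x‖ := T.le_opNorm _
      _ ≤ ‖T‖ * (K * ‖x‖ ^ k) := by have := (h x).1; gcongr
      _ = _ := by ring
  · rw [e1]
    calc _ ≤ ‖T‖ * ‖pderiv i P x‖ * ‖x‖ := by gcongr; exact T.le_opNorm _
      _ = ‖T‖ * (‖pderiv i P x‖ * ‖x‖) := by ring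
      _ ≤ ‖T‖ * (K * ‖x‖ ^ k) := by have := (h x).2.1 i; gcongr
      _ = _ := by ring
  · rw [e2]
    calc _ ≤ ‖T‖ * ‖pderiv j (pderiv i P) x‖ * ‖x‖ ^ 2 := by gcongr; exact T.le_opNorm _
      _ = ‖T‖ * (‖pderiv j (pderiv i P) x‖ * ‖x‖ ^ 2) := by ring
      _ ≤ ‖T‖ * (K * ‖x‖ ^ k) := by have := (h x).2.2 i j; gcongr
      _ = _ := by ring

/-- The vector field with complex form `c L(x)^k`. -/
noncomputable def powField (L : Plane →L[ℝ] ℂ) (c : ℂ) (k : ℕ) (x : Plane) : Plane :=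
  toC.symm (c * L x ^ k)

/-- The potential `Re (c L(x)^k)`. -/
noncomputable def powPotential (L : Plane →L[ℝ] ℂ) (c : ℂ) (k : ℕ) (x : Plane) : ℝ :=
  (c * L x ^ k).re

lemma homogeneousBound_powField (hn : ∀ x, ‖L x‖ = ‖x‖) (c : ℂ) (k : ℕ) :
    HomogeneousBound k (powField L c k) :=
  (homogeneousBound_pow hn c k).clm_comp (toC.symm.toContinuousLinearEquiv : ℂ →L[ℝ] Plane)

lemma homogeneousBound_powPotential (hn : ∀ x, ‖L x‖ = ‖x‖) (c : ℂ) (k : ℕ) :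
    HomogeneousBound k (powPotential L c k) :=
  (homogeneousBound_pow hn c k).clm_comp Complex.reCLM

lemma pderiv_powField (L : Plane →L[ℝ] ℂ) (c : ℂ) (k : ℕ) (i : Fin 2) :
    pderiv i (powField L c k) = powField L (c * k * L (stdVec i)) (k - 1) := by
  ext1 x
  have := pderiv_clm_comp (toC.symm.toContinuousLinearEquiv : ℂ →L[ℝ] Plane)
    ((contDiff_const_mul_pow L c k).differentiable (by simp) x) i
  rw [pderiv_const_mul_pow] at this
  exact this

lemma pderiv_powPotential (L : Plane →L[ℝ] ℂ) (c : ℂ) (k : ℕ) (i : Fin 2) :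
    pderiv i (powPotential L c k) = powPotential L (c * k * L (stdVec i)) (k - 1) := by
  ext1 x
  have := pderiv_clm_comp Complex.reCLM
    ((contDiff_const_mul_pow L c k).differentiable (by simp) x) i
  rw [pderiv_const_mul_pow] at this
  exact this

lemma toC_powField (L : Plane →L[ℝ] ℂ) (c : ℂ) (k : ℕ) (x : Plane) :
    toC (powField L c k x) = c * L x ^ k := toC.apply_symm_apply _

lemma contDiff_powField (L : Plane →L[ℝ] ℂ) (c : ℂ) (k : ℕ) : ContDiff ℝ ∞ (powField L c k) :=
  toC.symm.toContinuousLinearEquiv.contDiff.comp (contDiff_const_mul_pow L c k)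

lemma contDiff_powPotential (L : Plane →L[ℝ] ℂ) (c : ℂ) (k : ℕ) :
    ContDiff ℝ ∞ (powPotential L c k) :=
  Complex.reCLM.contDiff.comp (contDiff_const_mul_pow L c k)

lemma norm_sq_eq (x : Plane) : ‖x‖ ^ 2 = x 0 ^ 2 + x 1 ^ 2 := by
  rw [EuclideanSpace.norm_sq_eq, Fin.sum_univ_two, Real.norm_eq_abs, Real.norm_eq_abs, sq_abs, sq_abs]

/-- Powers of a complex coordinate are harmonic, and homogeneous, hence the Laplacian of their
product with a radial function is again of this form. -/
lemma laplacian_radial_powField (hL : IsComplexCoord L) {F : ℝ → ℝ}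
    (hF : ContDiffOn ℝ ∞ F (Set.Ioi 0)) (c : ℂ) (k : ℕ) {x : Plane} (hx : x ≠ 0) :
    ∑ i, pderiv i (pderiv i (fun y => F (‖y‖ ^ 2) • powField L c k y)) x =
      (4 * (‖x‖ ^ 2 * deriv (deriv F) (‖x‖ ^ 2) + (k + 1) * deriv F (‖x‖ ^ 2))) •
        powField L c k x := by
  simp only [pderiv_pderiv_radial_smul hF (contDiff_powField L c k) hx, if_true]
  apply toC.injective
  rw [norm_sq_eq]
  generalize deriv F (x 0 ^ 2 + x 1 ^ 2) = F1
  generalize deriv (deriv F) (x 0 ^ 2 + x 1 ^ 2) = F2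
  generalize F (x 0 ^ 2 + x 1 ^ 2) = F0
  simp only [pderiv_powField, Fin.sum_univ_two, map_add, map_smul, toC_powField, Complex.real_smul]
  have hdec := coord_decomposition L x
  have h1 := hL.map_one_sq
  rw [hL.map_zero, mul_one] at hdec
  rw [hL.map_zero]
  -- Euler's identity for the homogeneous polynomial `L^k`
  have key : ((x 0 : ℝ) : ℂ) * (k * L x ^ (k - 1)) + x 1 * (L (stdVec 1) * (k * L x ^ (k - 1))) =
      k * L x ^ k := by
    cases k with
    | zero => simp
    | succ k =>
      rw [Nat.add_sub_cancel, pow_succ]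
      linear_combination (-((k + 1 : ℕ) : ℂ) * L x ^ k) * hdec
  push_cast
  linear_combination (4 * F1 * c) * key +
    (F0 * (c * k * ((k - 1 : ℕ) : ℂ) * L x ^ (k - 1 - 1))) * h1

/-- In complex notation, the divergence of a vector field is `Re ∂₁ + Im ∂₂`. -/
lemma sum_coord_eq (v : Fin 2 → Plane) : ∑ i, v i i = (toC (v 0)).re + (toC (v 1)).im := by
  simp [toC_apply]

/-- The divergence of the field `F(|x|²) c z^{k+1}`. -/
lemma divergence_radial_zCoord {F : ℝ → ℝ} {x : Plane} (hF : DifferentiableAt ℝ F (‖x‖ ^ 2)) (c : ℂ)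
    (k : ℕ) :
    ∑ i, pderiv i (fun y => F (‖y‖ ^ 2) • powField zCoord c (k + 1) y) x i =
      2 * ((k + 1) * F (‖x‖ ^ 2) + ‖x‖ ^ 2 * deriv F (‖x‖ ^ 2)) * (c * toC x ^ k).re := by
  rw [sum_coord_eq fun i => pderiv i (fun y => F (‖y‖ ^ 2) • powField zCoord c (k + 1) y) x]
  simp only [pderiv_radial_smul hF ((contDiff_powField zCoord c (k + 1)).differentiable (by simp) x)]
  rw [norm_sq_eq]
  generalize deriv F (x 0 ^ 2 + x 1 ^ 2) = F1
  generalize F (x 0 ^ 2 + x 1 ^ 2) = F0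
  simp only [pderiv_powField, map_add, map_smul, toC_powField, zCoord_apply, toC_stdVec_zero,
    toC_stdVec_one, Nat.add_sub_cancel, pow_succ]
  generalize toC x ^ k = w
  have h0 : (toC x).re = x 0 := by simp [toC_apply]
  have h1 : (toC x).im = x 1 := by simp [toC_apply]
  simp [h0, h1]
  ring

/-- The divergence of the field `F(|x|²) c̄ z̄^k`. It involves the same harmonic polynomial `Re (c
z^{k+1})` as that of a field `F(|x|²) c z^{k+2}`, so that the two can cancel. -/
lemma divergence_radial_zbarCoord {F : ℝ → ℝ} {x : Plane} (hF : DifferentiableAt ℝ F (‖x‖ ^ 2)) (c : ℂ)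
    (k : ℕ) :
    ∑ i, pderiv i (fun y => F (‖y‖ ^ 2) • powField zbarCoord ((starRingEnd ℂ) c) k y) x i =
      2 * deriv F (‖x‖ ^ 2) * (c * toC x ^ (k + 1)).re := by
  rw [sum_coord_eq fun i => pderiv i (fun y => F (‖y‖ ^ 2) • powField zbarCoord _ k y) x]
  simp only [pderiv_radial_smul hF ((contDiff_powField zbarCoord _ k).differentiable (by simp) x)]
  rw [norm_sq_eq]
  generalize deriv F (x 0 ^ 2 + x 1 ^ 2) = F1
  generalize F (x 0 ^ 2 + x 1 ^ 2) = F0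
  simp only [pderiv_powField, map_add, map_smul, toC_powField, zbarCoord_apply, toC_stdVec_zero,
    toC_stdVec_one, pow_succ, map_one, Complex.conj_I, ← map_pow]
  generalize toC x ^ k = w
  generalize toC x ^ (k - 1) = w'
  have h0 : (toC x).re = x 0 := by simp [toC_apply]
  have h1 : (toC x).im = x 1 := by simp [toC_apply]
  simp [h0, h1]
  ring

/-- The pairing of a vector with the gradient of `F(|x|²) Re (c z^k)`. -/
lemma gradient_radial_powPotential {F : ℝ → ℝ} {x : Plane} (hF : DifferentiableAt ℝ F (‖x‖ ^ 2))
    (c : ℂ) (k : ℕ) (w : Plane) :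
    ∑ i, w i * pderiv i (fun y => F (‖y‖ ^ 2) • powPotential zCoord c k y) x =
      k * F (‖x‖ ^ 2) * (c * toC x ^ (k - 1) * toC w).re +
        deriv F (‖x‖ ^ 2) * ((c * toC x ^ k * (starRingEnd ℂ) (toC x) * toC w).re +
          (c * toC x ^ (k + 1) * (starRingEnd ℂ) (toC w)).re) := by
  simp only [pderiv_radial_smul hF ((contDiff_powPotential zCoord c k).differentiable (by simp) x)]
  generalize deriv F (‖x‖ ^ 2) = F1
  generalize F (‖x‖ ^ 2) = F0
  simp only [pderiv_powPotential, powPotential, zCoord_apply, Fin.sum_univ_two, toC_stdVec_zero,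
    toC_stdVec_one, pow_succ]
  generalize toC x ^ k = u
  generalize toC x ^ (k - 1) = u'
  have h0 : (toC x).re = x 0 := by simp [toC_apply]
  have h1 : (toC x).im = x 1 := by simp [toC_apply]
  have h2 : (toC w).re = w 0 := by simp [toC_apply]
  have h3 : (toC w).im = w 1 := by simp [toC_apply]
  simp [h0, h1, h2, h3]
  ring

lemma inner_eq_re (v w : Plane) : inner ℝ v w = (toC w * (starRingEnd ℂ) (toC v)).re := by
  simp [toC_apply, PiLp.inner_apply]

end ComplexPowers

/-! ### Radial profiles built from Bessel integrals -/

section Profile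

/-- The radial profile `a A_m^l + b A_m^μ + d ρ^{-N}`, where `A_m^l` is the Bessel integral. With
`μ = α⁻¹`, the last two terms serve to meet boundary conditions. -/
noncomputable def profile (m N : ℕ) (l μ a b d ρ : ℝ) : ℝ :=
  a * besselInt m l ρ + b * besselInt m μ ρ + d * (ρ ^ N)⁻¹

variable {m N : ℕ} {l μ a b d : ℝ}

lemma radialDecay_profile {r : ℝ} (hr : 0 < r) (hl : 0 < l) (hμ : 0 < μ) :
    RadialDecay r N (profile m N l μ a b d) :=
  (((radialDecay_besselInt hr m N hl).const_mul a).add hr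
    ((radialDecay_besselInt hr m N hμ).const_mul b)).add hr ((radialDecay_inv_pow hr N).const_mul d)

lemma deriv_profile (hl : 0 < l) (hμ : 0 < μ) {ρ : ℝ} (hρ : 0 < ρ) :
    deriv (profile m N l μ a b d) ρ =
      -(a * besselInt (m + 1) l ρ + b * besselInt (m + 1) μ ρ) / 4 - d * (N * (ρ ^ (N + 1))⁻¹) := by
  have h := (((hasDerivAt_besselInt m hl hρ).const_mul a).fun_add
    ((hasDerivAt_besselInt m hμ hρ).const_mul b)).fun_add ((hasDerivAt_inv_pow N hρ).const_mul d)
  refine h.deriv.trans ?_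
  ring

lemma deriv_deriv_profile (hl : 0 < l) (hμ : 0 < μ) {ρ : ℝ} (hρ : 0 < ρ) :
    deriv (deriv (profile m N l μ a b d)) ρ =
      (a * besselInt (m + 2) l ρ + b * besselInt (m + 2) μ ρ) / 16 +
        d * (N * (N + 1) * (ρ ^ (N + 2))⁻¹) := by
  have e : deriv (profile m N l μ a b d) =ᶠ[𝓝 ρ] fun ρ => -(1 / 4) * (profile (m + 1) (N + 1) l μ a b
      (4 * N * d) ρ) := by
    filter_upwards [Ioi_mem_nhds hρ] with y hy
    rw [deriv_profile hl hμ hy, profile]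
    ring
  rw [e.deriv_eq, deriv_const_mul_field, deriv_profile hl hμ hρ]
  push_cast
  ring

/-- The radial part of the Laplacian on fields of angular frequency `k` multiplies the Bessel
integrals by their parameter, and annihilates `ρ^{-k}`. -/
lemma radial_laplacian_profile (k N : ℕ) (hl : 0 < l) (hμ : 0 < μ) {ρ : ℝ} (hρ : 0 < ρ) :
    4 * (ρ * deriv (deriv (profile (k + 1) N l μ a b d)) ρ +
      (k + 1) * deriv (profile (k + 1) N l μ a b d) ρ) =
      a * l * besselInt (k + 1) l ρ + b * μ * besselInt (k + 1) μ ρ +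
        4 * N * (N - k) * d * (ρ ^ (N + 1))⁻¹ := by
  rw [deriv_deriv_profile hl hμ hρ, deriv_profile hl hμ hρ]
  have h1 := besselInt_recurrence (k + 1) hl hρ
  have h2 := besselInt_recurrence (k + 1) hμ hρ
  have h3 : ρ * (ρ ^ (N + 2))⁻¹ = (ρ ^ (N + 1))⁻¹ := by rw [pow_succ ρ (N + 1)]; field_simp
  push_cast at h1 h2
  linear_combination a * h1 + b * h2 + 4 * d * N * (N + 1) * h3

end Profile

/-! ### The solution of the resolvent equation -/

section Resolvent

lemma perp_eq_powField (x : Plane) : perp x = powField zCoord Complex.I 1 x := by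
  apply toC.injective
  rw [toC_powField, toC_perp, zCoord_apply, pow_one]

lemma perp_eq_powField' : perp = powField zCoord Complex.I 1 := funext perp_eq_powField

lemma norm_perp (x : Plane) : ‖perp x‖ = ‖x‖ := by
  rw [← norm_toC, toC_perp, norm_mul, Complex.norm_I, one_mul, norm_toC]

lemma continuous_perp : Continuous perp := by
  rw [perp_eq_powField']
  exact (contDiff_powField _ _ _).continuous

/-- Bounded azimuthal fields are weakly divergence free and tangent to circles. -/
lemma integral_fderiv_azimuthal {ε : ℝ} {f : ℝ → ℝ} (hf : Measurable f) {C : ℝ}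
    (hC : 0 ≤ C) (hb : ∀ x ∈ extDisk ε, ‖f ‖x‖ • perp x‖ ≤ C) {φ : Plane → ℝ} (hφ : ContDiff ℝ ∞ φ)
    (hc : HasCompactSupport φ) : ∫ x in extDisk ε, fderiv ℝ φ x (f ‖x‖ • perp x) = 0 := by
  have e : ∀ x, (extDisk ε).indicator (fun x => fderiv ℝ φ x (f ‖x‖ • perp x)) x =
      fderiv ℝ φ x ((Set.Ioi ε).indicator f ‖x‖ • perp x) := by
    intro x
    by_cases hx : x ∈ extDisk ε
    · have : ‖x‖ ∈ Set.Ioi ε := hx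
      rw [Set.indicator_of_mem hx, Set.indicator_of_mem this]
    · have : ‖x‖ ∉ Set.Ioi ε := hx
      rw [Set.indicator_of_notMem hx, Set.indicator_of_notMem this, zero_smul, map_zero]
  rw [← integral_indicator (measurableSet_extDisk ε)]
  simp_rw [e]
  refine integral_fderiv_smul_perp φ hφ _ ?_
  have hcont : Continuous (fderiv ℝ φ) := hφ.continuous_fderiv (by simp)
  have hint : Integrable (fun x => ‖fderiv ℝ φ x‖ * C) :=
    ((hcont.integrable_of_hasCompactSupport (hc.fderiv ℝ)).norm).mul_const C
  have hmeas : Measurable (fun x : Plane => (Set.Ioi ε).indicator f ‖x‖ • perp x) :=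
    ((hf.indicator measurableSet_Ioi).comp measurable_norm).smul continuous_perp.measurable
  refine hint.mono' ?_ (ae_of_all _ fun x => ?_)
  · exact (ContinuousLinearMap.apply ℝ ℝ).flip.aestronglyMeasurable_comp₂
      hcont.aestronglyMeasurable hmeas.aestronglyMeasurable
  · by_cases hx : x ∈ extDisk ε
    · have : ‖x‖ ∈ Set.Ioi ε := hx
      rw [Set.indicator_of_mem this]
      refine ((fderiv ℝ φ x).le_opNorm _).trans ?_
      gcongr
      exact hb x hx
    · have : ‖x‖ ∉ Set.Ioi ε := hx
      rw [Set.indicator_of_notMem this, zero_smul, map_zero, norm_zero]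
      positivity

/-- A bounded azimuthal field of decay `|x|^{-s}` is solenoidal in `L^q`. -/
lemma memLpSigma_azimuthal {ε : ℝ} (hε : 0 < ε) {f : ℝ → ℝ} (hf : Measurable f) {s : ℕ} {C : ℝ}
    (hC : 0 ≤ C) (hb : ∀ x ∈ extDisk ε, ‖f ‖x‖ • perp x‖ ≤ C * (‖x‖ ^ s)⁻¹) {q : ℝ≥0∞} (hq : q ≠ ⊤)
    (hsq : 2 < s * q.toReal) : MemLpSigma ε q (fun x => f ‖x‖ • perp x) := by
  have hm : Measurable (fun x : Plane => f ‖x‖ • perp x) :=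
    (hf.comp measurable_norm).smul continuous_perp.measurable
  refine ⟨memLp_of_decay hε hq hsq hm.aestronglyMeasurable hb, fun φ hφ hc =>
    integral_fderiv_azimuthal hf (C := C * (ε ^ s)⁻¹) (by positivity) (fun x hx => ?_) hφ hc⟩
  have h : ε ≤ ‖x‖ := le_of_lt hx
  exact (hb x hx).trans (by gcongr)

/-- The Leray projector fixes azimuthal fields. A field of decay `1/|x|` need not be in `L²`, but its
truncations to disks are again azimuthal, belong to `L²_σ`, and converge in `L^p` for `p > 2`. -/
lemma isLeray_azimuthal {ε : ℝ} (hε : 0 < ε) {f : ℝ → ℝ} (hf : Measurable f) {C : ℝ}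
    (hC : 0 ≤ C) (hb : ∀ x ∈ extDisk ε, ‖f ‖x‖ • perp x‖ ≤ C * (‖x‖ ^ 1)⁻¹) {p : ℝ≥0∞} (hp : p ≠ ⊤)
    (hp2 : 2 < p.toReal) {g : Plane → Plane}
    (hg : ∀ x ∈ extDisk ε, g x = f ‖x‖ • perp x) : IsLeray ε p g (fun x => f ‖x‖ • perp x) := by
  have hm : Measurable (fun x : Plane => f ‖x‖ • perp x) :=
    (hf.comp measurable_norm).smul continuous_perp.measurable
  have hp1 : 2 < ((1 : ℕ) : ℝ) * p.toReal := by simpa using hp2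
  have hae : ∀ᵐ x ∂(volume.restrict (extDisk ε)), f ‖x‖ • perp x = g x :=
    (ae_restrict_iff' (measurableSet_extDisk ε)).2 (ae_of_all _ fun x hx => (hg x hx).symm)
  have mf := (memLpSigma_azimuthal hε hf hC hb hp hp1).1
  let F : ℕ → ℝ → ℝ := fun n => (Set.Iio (n : ℝ)).indicator f
  have hF : ∀ n, Measurable (F n) := fun n => hf.indicator measurableSet_Iio
  have hFb : ∀ n, ∀ x ∈ extDisk ε, ‖F n ‖x‖ • perp x‖ ≤ C * (‖x‖ ^ 1)⁻¹ := by
    intro n x hx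
    by_cases h : ‖x‖ ∈ Set.Iio (n : ℝ)
    · simp only [F, Set.indicator_of_mem h]
      exact hb x hx
    · simp only [F, Set.indicator_of_notMem h, zero_smul, norm_zero]
      positivity
  have hFb2 : ∀ n, ∀ x ∈ extDisk ε, ‖F n ‖x‖ • perp x‖ ≤ C * n * (‖x‖ ^ 2)⁻¹ := by
    intro n x hx
    have hx0 : 0 < ‖x‖ := hε.trans hx
    by_cases h : ‖x‖ ∈ Set.Iio (n : ℝ)
    · have h' : ‖x‖ ≤ n := le_of_lt h
      refine (hFb n x hx).trans ?_
      calc C * (‖x‖ ^ 1)⁻¹ = C * ‖x‖ * (‖x‖ ^ 2)⁻¹ := by field_simp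
        _ ≤ _ := by gcongr
    · simp only [F, Set.indicator_of_notMem h, zero_smul, norm_zero]
      positivity
  have hσ : ∀ n {q : ℝ≥0∞}, q ≠ ⊤ → 1 < q.toReal → MemLpSigma ε q (fun x => F n ‖x‖ • perp x) :=
    fun n q hq hq1 => memLpSigma_azimuthal hε (hF n) (by positivity) (hFb2 n) hq
      (by push_cast; linarith)
  have hσ2 := fun n => hσ n (q := 2) (by simp) (by simp)
  have hσp := fun n => (hσ n hp (by linarith)).1
  have hlim : Tendsto (fun n => eLpNorm (fun x => F n ‖x‖ • perp x - f ‖x‖ • perp x) p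
      (volume.restrict (extDisk ε))) atTop (𝓝 0) := by
    refine tendsto_eLpNorm_sub_of_dominated (by rintro rfl; simp at hp2; linarith) hp
      (fun n => (hσp n).1) mf.1 ((memLp_inv_norm_pow hε hp hp1).const_mul C)
      (fun n => (ae_restrict_iff' (measurableSet_extDisk ε)).2 (ae_of_all _ (hFb n)))
      (ae_of_all _ fun x => ?_)
    refine tendsto_const_nhds.congr' ?_
    obtain ⟨N, hN⟩ := exists_nat_gt ‖x‖
    filter_upwards [eventually_ge_atTop N] with n hn
    have h : ‖x‖ ∈ Set.Iio (n : ℝ) := hN.trans_le (by exact_mod_cast hn)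
    simp only [F, Set.indicator_of_mem h]
  refine ⟨mf.ae_eq hae, mf, fun n x => F n ‖x‖ • perp x, fun n x => F n ‖x‖ • perp x,
    fun n => ⟨⟨(hσ2 n).1, hσ2 n, fun h _ => by simp⟩, hσp n, hσp n⟩, ?_, hlim⟩
  refine hlim.congr fun n => eLpNorm_congr_ae ?_
  filter_upwards [hae] with x hx
  rw [hx]

variable {α ε : ℝ}

/-- The coefficient `κ` for which `H - κ A₂(|x|²) x^⊥` vanishes on the circle of radius `ε`. -/
noncomputable def boundaryCoeff (α ε : ℝ) : ℝ := 1 / (2 * Real.pi * ε ^ 2 * besselInt 2 α⁻¹ (ε ^ 2))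

/-- The profile of the solution: `1/(2πρ) - κ A₂(ρ)`. -/
noncomputable def resolventProfile (α ε : ℝ) : ℝ → ℝ :=
  profile 2 1 α⁻¹ α⁻¹ (-boundaryCoeff α ε) 0 (1 / (2 * Real.pi))

/-- The solution `(1 + α A_ε)⁻¹ H` of the resolvent equation; the second factor is `x^⊥`. -/
noncomputable def resolventField (α ε : ℝ) (x : Plane) : Plane :=
  resolventProfile α ε (‖x‖ ^ 2) • powField zCoord Complex.I 1 x

lemma resolventProfile_eq (ρ : ℝ) : resolventProfile α ε ρ =
    1 / (2 * Real.pi * ρ) - boundaryCoeff α ε * besselInt 2 α⁻¹ ρ := by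
  rw [resolventProfile, profile]
  field_simp
  ring

lemma resolventProfile_self (hα : 0 < α) (hε : 0 < ε) : resolventProfile α ε (ε ^ 2) = 0 := by
  have h := (besselInt_pos 2 (inv_pos.2 hα) (pow_pos hε 2)).ne'
  rw [resolventProfile_eq, boundaryCoeff]
  generalize besselInt 2 α⁻¹ (ε ^ 2) = A at *
  field_simp
  ring

lemma vanishingField_resolventField (hα : 0 < α) (hε : 0 < ε) :
    VanishingField ε 1 (resolventField α ε) :=
  vanishingField_radial hε (N := 1) (k := 1) le_rfl
    (radialDecay_profile (by positivity) (inv_pos.2 hα) (inv_pos.2 hα))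
    (resolventProfile_self hα hε) (homogeneousBound_powField norm_zCoord _ _)

lemma resolventField_sub_harmonicField (x : Plane) : resolventField α ε x - harmonicField x =
    (-boundaryCoeff α ε * besselInt 2 α⁻¹ (‖x‖ ^ 2)) • perp x := by
  rw [resolventField, harmonicField, resolventProfile_eq, ← perp_eq_powField, ← sub_smul]
  ring_nf

/-- `H` is harmonic and `Δ (A₂ x^⊥) = α⁻¹ A₂ x^⊥`. -/
lemma laplacian_resolventField (hα : 0 < α) {x : Plane} (hx : x ≠ 0) :
    ∑ i, pderiv i (pderiv i (resolventField α ε)) x =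
      α⁻¹ • (resolventField α ε x - harmonicField x) := by
  have hα' := inv_pos.2 hα
  have hρ := norm_sq_pos hx
  have h := laplacian_radial_powField isComplexCoord_zCoord
    (radialDecay_profile (N := 1) (m := 2) (a := -boundaryCoeff α ε) (b := 0)
      (d := 1 / (2 * Real.pi)) hρ hα' hα').smooth Complex.I 1 hx
  have h2 := radial_laplacian_profile (a := -boundaryCoeff α ε) (b := 0) (d := 1 / (2 * Real.pi))
    1 1 hα' hα' hρ
  rw [resolventField_sub_harmonicField, perp_eq_powField, smul_smul]
  refine h.trans ?_
  congr 1
  refine h2.trans ?_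
  push_cast
  ring

lemma measurable_besselInt (m : ℕ) (l : ℝ) : Measurable (besselInt m l) := by
  have : StronglyMeasurable (fun p : ℝ × ℝ =>
      Real.exp (-(l * p.2) - p.1 / (4 * p.2)) * (p.2 ^ m)⁻¹) := by
    refine Measurable.stronglyMeasurable ?_
    fun_prop
  exact (this.integral_prod_right (ν := volume.restrict (Set.Ioi 0))).measurable

/-- The azimuthal fields `F(|x|²) x^⊥` for a profile of decay `ρ^{-1}`. -/
lemma RadialDecay.norm_smul_perp_le (hε : 0 < ε) {F : ℝ → ℝ} (hF : RadialDecay (ε ^ 2) 1 F) :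
    ∃ C, 0 ≤ C ∧ ∀ x ∈ extDisk ε, ‖F (‖x‖ ^ 2) • perp x‖ ≤ C * (‖x‖ ^ 1)⁻¹ := by
  obtain ⟨M, hM⟩ := hF.bound
  refine ⟨|M|, abs_nonneg _, fun x hx => ?_⟩
  have hx0 : 0 < ‖x‖ := hε.trans hx
  have h : ε ≤ ‖x‖ := le_of_lt hx
  have h1 := (hM (‖x‖ ^ 2) (by gcongr)).1
  rw [norm_smul, Real.norm_eq_abs, norm_perp]
  calc _ ≤ (|M| * ((‖x‖ ^ 2) ^ 1)⁻¹) * ‖x‖ := by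
        gcongr
        refine h1.trans ?_
        gcongr
        exact le_abs_self M
    _ = _ := by field_simp

/-- The Laplacian of the solution is azimuthal and hence fixed by the Leray projector, so the
resolvent equation reduces to `u - α Δu = H`. -/
lemma isStokesResolvent_resolventField (hα : 0 < α) (hε : 0 < ε) {p : ℝ≥0∞} (hp2 : 2 < p)
    (hp : p ≠ ⊤) : IsStokesResolvent α ε p harmonicField (resolventField α ε) := by
  have hα' := inv_pos.2 hα
  have hp2' : 2 < p.toReal := by
    have := (ENNReal.toReal_lt_toReal (by simp) hp).2 hp2
    simpa using this
  have hp1 : 2 < ((1 : ℕ) : ℝ) * p.toReal := by simpa using hp2'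
  have hdec : ∀ a d : ℝ, RadialDecay (ε ^ 2) 1 (profile 2 1 α⁻¹ α⁻¹ a 0 d) := fun a d =>
    radialDecay_profile (by positivity) hα' hα'
  have hmeas : ∀ a d : ℝ, Measurable fun r : ℝ => profile 2 1 α⁻¹ α⁻¹ a 0 d (r ^ 2) := by
    intro a d
    have := measurable_besselInt 2 α⁻¹
    unfold profile
    fun_prop
  have hvan := vanishingField_resolventField hα hε
  have hu : resolventField α ε = fun x => profile 2 1 α⁻¹ α⁻¹ (-boundaryCoeff α ε) 0
      (1 / (2 * Real.pi)) (‖x‖ ^ 2) • perp x := by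
    ext1 x
    rw [perp_eq_powField]
    rfl
  have hH : harmonicField = fun x => profile 2 1 α⁻¹ α⁻¹ 0 0 (1 / (2 * Real.pi)) (‖x‖ ^ 2) • perp x := by
    ext1 x
    rw [harmonicField, profile]
    congr 1
    field_simp
    ring
  have hσ : ∀ a d : ℝ, MemLpSigma ε p (fun x =>
      profile 2 1 α⁻¹ α⁻¹ a 0 d (‖x‖ ^ 2) • perp x) := fun a d => by
    obtain ⟨C, hC, hb⟩ := (hdec a d).norm_smul_perp_le hε
    exact memLpSigma_azimuthal hε (f := fun r => profile 2 1 α⁻¹ α⁻¹ a 0 d (r ^ 2)) (hmeas a d) hC hb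
      hp hp1
  refine ⟨hH ▸ hσ _ _, fun x => -((α⁻¹ * -boundaryCoeff α ε * besselInt 2 α⁻¹ (‖x‖ ^ 2)) • perp x),
    ⟨hu ▸ hσ _ _, hvan.memW1Zero hε hp hp1, _, hvan.memW2WithLaplacian hε hp hp1, ?_⟩, ?_⟩
  · simp only [neg_neg]
    obtain ⟨C, hC, hb⟩ := (hdec (α⁻¹ * -boundaryCoeff α ε) 0).norm_smul_perp_le hε
    simp only [profile, zero_mul, add_zero] at hb
    refine isLeray_azimuthal hε
      (f := fun r => α⁻¹ * -boundaryCoeff α ε * besselInt 2 α⁻¹ (r ^ 2)) ?_ hC hb hp hp2' fun x hx => ?_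
    · have := measurable_besselInt 2 α⁻¹
      fun_prop
    · rw [laplacian_resolventField hα (ne_zero_of_mem_extDisk hε hx),
        resolventField_sub_harmonicField, smul_smul, mul_assoc]
  · refine ae_of_all _ fun x => ?_
    have h := resolventField_sub_harmonicField (α := α) (ε := ε) x
    have h2 : harmonicField x = resolventField α ε x -
        (-boundaryCoeff α ε * besselInt 2 α⁻¹ (‖x‖ ^ 2)) • perp x := by rw [← h]; abel
    simp only
    rw [h2, smul_neg, smul_smul, sub_eq_add_neg, ← mul_assoc, ← mul_assoc, mul_inv_cancel₀ hα.ne',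
      one_mul]

end Resolvent

/-! ### Bessel moments of a solution of the homogeneous equation -/

section Moments

/-- The integrand `Re (c L(x)^k w(x)) F(|x|²)` of a moment of the field `w`, where `w(x)` is read as a
complex number. -/
noncomputable def momentDensity (L : Plane →L[ℝ] ℂ) (c : ℂ) (k : ℕ) (w : Plane → Plane) (F : ℝ → ℝ)
    (x : Plane) : ℝ := (c * L x ^ k * toC (w x)).re * F (‖x‖ ^ 2)

variable {ε : ℝ} {p q : ℝ≥0∞} {w : Plane → Plane} {L : Plane →L[ℝ] ℂ} {F : ℝ → ℝ}

lemma norm_momentDensity_le (hn : ∀ x, ‖L x‖ = ‖x‖) (c : ℂ) (k : ℕ) (x : Plane) :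
    ‖momentDensity L c k w F x‖ ≤ ‖w x‖ * (‖c‖ * ‖x‖ ^ k * |F (‖x‖ ^ 2)|) := by
  rw [momentDensity, norm_mul, Real.norm_eq_abs, Real.norm_eq_abs]
  have := Complex.abs_re_le_norm (c * L x ^ k * toC (w x))
  rw [norm_mul, norm_mul, norm_pow, hn, norm_toC] at this
  calc _ ≤ ‖c‖ * ‖x‖ ^ k * ‖w x‖ * |F (‖x‖ ^ 2)| := by gcongr
    _ = _ := by ring

lemma aestronglyMeasurable_momentDensity (hε : 0 < ε) (hF : ContDiffOn ℝ ∞ F (Set.Ioi 0))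
    (hw : AEStronglyMeasurable w (volume.restrict (extDisk ε))) (c : ℂ) (k : ℕ) :
    AEStronglyMeasurable (momentDensity L c k w F) (volume.restrict (extDisk ε)) := by
  refine AEStronglyMeasurable.mul ?_ (aestronglyMeasurable_extDisk hε (contDiffOn_radial hF))
  refine Complex.continuous_re.comp_aestronglyMeasurable (AEStronglyMeasurable.mul ?_
    (toC.continuous.comp_aestronglyMeasurable hw))
  exact (contDiff_const_mul_pow L c k).continuous.aestronglyMeasurable

lemma integrable_momentDensity_of_le (hε : 0 < ε) [ENNReal.HolderConjugate p q] (hq : q ≠ ⊤)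
    (hq1 : 1 < q.toReal) (hw : MemLp w p (volume.restrict (extDisk ε))) (hn : ∀ x, ‖L x‖ = ‖x‖)
    {N k : ℕ} (hkN : k + 2 ≤ 2 * N) (hF : ContDiffOn ℝ ∞ F (Set.Ioi 0)) {M : ℝ}
    (hM : ∀ ρ, ε ^ 2 ≤ ρ → |F ρ| ≤ M * (ρ ^ N)⁻¹) (c : ℂ) :
    Integrable (momentDensity L c k w F) (volume.restrict (extDisk ε)) := by
  set D := (ε ^ (2 * N - k - 2))⁻¹ with hD
  have hint : Integrable (fun x => ‖w x‖ * ((‖c‖ * |M| * D) * (‖x‖ ^ 2)⁻¹))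
      (volume.restrict (extDisk ε)) :=
    hw.norm.integrable_mul ((memLp_inv_norm_pow hε hq (by push_cast; linarith)).const_mul _)
  refine hint.mono' (aestronglyMeasurable_momentDensity hε hF hw.1 c k)
    ((ae_restrict_iff' (measurableSet_extDisk ε)).2 (ae_of_all _ fun x hx => ?_))
  have hx' : ε ≤ ‖x‖ := le_of_lt hx
  have h1 := hM (‖x‖ ^ 2) (by gcongr)
  have h2 := decay_le hε hx' hkN
  refine (norm_momentDensity_le hn c k x).trans ?_
  gcongr ‖w x‖ * ?_
  calc ‖c‖ * ‖x‖ ^ k * |F (‖x‖ ^ 2)| ≤ ‖c‖ * ‖x‖ ^ k * (|M| * ((‖x‖ ^ 2) ^ N)⁻¹) := by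
        gcongr
        refine h1.trans ?_
        gcongr
        exact le_abs_self M
    _ = ‖c‖ * |M| * (((‖x‖ ^ 2) ^ N)⁻¹ * ‖x‖ ^ k) := by ring
    _ ≤ ‖c‖ * |M| * (D * (‖x‖ ^ 2)⁻¹) := by gcongr
    _ = _ := by ring

lemma integrable_momentDensity (hε : 0 < ε) [ENNReal.HolderConjugate p q] (hq : q ≠ ⊤)
    (hq1 : 1 < q.toReal) (hw : MemLp w p (volume.restrict (extDisk ε))) (hn : ∀ x, ‖L x‖ = ‖x‖)
    {N k : ℕ} (hkN : k + 2 ≤ 2 * N) (hF : RadialDecay (ε ^ 2) N F) (c : ℂ) :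
    Integrable (momentDensity L c k w F) (volume.restrict (extDisk ε)) := by
  obtain ⟨M, hM⟩ := hF.bound
  exact integrable_momentDensity_of_le hε hq hq1 hw hn hkN hF.smooth (fun ρ hρ => (hM ρ hρ).1) c

lemma mul_inv_pow_succ {ρ : ℝ} (hρ : ρ ≠ 0) (n : ℕ) : ρ * (ρ ^ (n + 1))⁻¹ = (ρ ^ n)⁻¹ := by
  rw [pow_succ]; field_simp

lemma norm_sq_eq_toC (x : Plane) : ((‖x‖ ^ 2 : ℝ) : ℂ) = toC x * (starRingEnd ℂ) (toC x) := by
  rw [Complex.mul_conj, Complex.normSq_eq_norm_sq, norm_toC]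

lemma re_conj_mul (c z w : ℂ) (k : ℕ) : (c * z ^ k * (starRingEnd ℂ) w).re =
    ((starRingEnd ℂ) c * (starRingEnd ℂ) z ^ k * w).re := by
  rw [← Complex.conj_re]
  simp

/-- Orthogonality of a solenoidal field to the gradient of `F(|x|²) Re (c z^{m+1})`. -/
lemma integral_gradient_pow (hε : 0 < ε) [ENNReal.HolderConjugate p q] (hq : q ≠ ⊤)
    (hq1 : 1 < q.toReal) (hw : MemLpSigma ε p w) {N m : ℕ} (hN : m + 2 ≤ 2 * N)
    (hF : RadialDecay (ε ^ 2) N F) (c : ℂ) :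
    ∫ x in extDisk ε,
      (momentDensity zCoord c m w (fun ρ => (m + 1) * F ρ + ρ * deriv F ρ) x +
        momentDensity zbarCoord ((starRingEnd ℂ) c) (m + 2) w (deriv F) x) = 0 := by
  have h := hw.integral_gradient_radial hε hq hq1 (k := m + 1) (by omega) hF
    (homogeneousBound_powPotential norm_zCoord c (m + 1))
  rw [← h]
  refine setIntegral_congr_fun (measurableSet_extDisk ε) fun x hx => ?_
  have hρ := norm_sq_pos (ne_zero_of_mem_extDisk hε hx)
  simp only [gradient_radial_powPotential (differentiableAt_of_smooth hF.smooth hρ), momentDensity,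
    zCoord_apply, zbarCoord_apply, Nat.add_sub_cancel]
  rw [← re_conj_mul, pow_succ (toC x) m]
  have e : (c * (toC x ^ m * toC x) * (starRingEnd ℂ) (toC x) * toC (w x)) =
      ((‖x‖ ^ 2 : ℝ) : ℂ) * (c * toC x ^ m * toC (w x)) := by
    rw [norm_sq_eq_toC]; ring
  rw [e, Complex.re_ofReal_mul]
  push_cast
  ring

lemma radialDecay_besselInt' (hε : 0 < ε) (m N : ℕ) {l : ℝ} (hl : 0 < l) :
    RadialDecay (ε ^ 2) N (besselInt m l) := radialDecay_besselInt (by positivity) m N hl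

lemma integral_congr_linear {Ω : Set Plane} (hΩ : MeasurableSet Ω) {f g h : Plane → ℝ} {a b : ℝ}
    (hg : Integrable g (volume.restrict Ω)) (hh : Integrable h (volume.restrict Ω))
    (e : ∀ x ∈ Ω, f x = a * g x + b * h x) :
    ∫ x in Ω, f x = a * (∫ x in Ω, g x) + b * ∫ x in Ω, h x := by
  rw [setIntegral_congr_fun hΩ e, integral_add (hg.const_mul a) (hh.const_mul b),
    integral_const_mul, integral_const_mul]

/-- The relation between two Bessel moments that comes from the gradient of `A_{m+2}^l(|x|²) Re (c
z^{m+1})`. -/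
lemma moment_relation_gradient (hε : 0 < ε) [ENNReal.HolderConjugate p q] (hq : q ≠ ⊤)
    (hq1 : 1 < q.toReal) (hw : MemLpSigma ε p w) {l : ℝ} (hl : 0 < l) (m : ℕ) (c : ℂ) :
    -l * (∫ x in extDisk ε, momentDensity zCoord c m w (besselInt (m + 1) l) x) +
      -(1 / 4) * (∫ x in extDisk ε,
        momentDensity zbarCoord ((starRingEnd ℂ) c) (m + 2) w (besselInt (m + 3) l) x) = 0 := by
  rw [← integral_gradient_pow hε hq hq1 hw (N := m + 2) (m := m) (by omega)
    (radialDecay_besselInt' hε (m + 2) _ hl) c]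
  refine (integral_congr_linear (measurableSet_extDisk ε)
    (integrable_momentDensity hε hq hq1 hw.1 norm_zCoord (N := m + 2) (by omega)
      (radialDecay_besselInt' hε _ _ hl) _)
    (integrable_momentDensity hε hq hq1 hw.1 norm_zbarCoord (N := m + 2) (by omega)
      (radialDecay_besselInt' hε _ _ hl) _) fun x hx => ?_).symm
  have hρ := norm_sq_pos (ne_zero_of_mem_extDisk hε hx)
  have h := besselInt_recurrence (m + 1) hl hρ
  simp only [momentDensity, deriv_besselInt (m + 2) hl hρ]
  push_cast at h
  linear_combination (-(c * zCoord x ^ m * toC (w x)).re) * h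

/-- The field in question is, up to a constant, the gradient of the harmonic potential
`|x|^{-2(m+1)} Re (c z^{m+1})`. -/
lemma moment_inv_pow_eq_zero (hε : 0 < ε) [ENNReal.HolderConjugate p q] (hq : q ≠ ⊤)
    (hq1 : 1 < q.toReal) (hw : MemLpSigma ε p w) (m : ℕ) (c : ℂ) :
    ∫ x in extDisk ε,
      momentDensity zbarCoord ((starRingEnd ℂ) c) (m + 2) w (fun ρ => (ρ ^ (m + 2))⁻¹) x = 0 := by
  have h := integral_gradient_pow hε hq hq1 hw (N := m + 1) (m := m) (by omega)
    (radialDecay_inv_pow (a := ε ^ 2) (by positivity) (m + 1)) c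
  have hm : -((m : ℝ) + 1) ≠ 0 := by
    have : (0 : ℝ) ≤ m := by positivity
    linarith
  rw [setIntegral_congr_fun (g := fun x => -((m : ℝ) + 1) *
    momentDensity zbarCoord ((starRingEnd ℂ) c) (m + 2) w (fun ρ => (ρ ^ (m + 2))⁻¹) x)
    (measurableSet_extDisk ε) fun x hx => ?_, integral_const_mul] at h
  · exact (mul_eq_zero.1 h).resolve_left hm
  have hρ := norm_sq_pos (ne_zero_of_mem_extDisk hε hx)
  have e : ‖x‖ ^ 2 * ((‖x‖ ^ 2) ^ (m + 1 + 1))⁻¹ = ((‖x‖ ^ 2) ^ (m + 1))⁻¹ :=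
    mul_inv_pow_succ hρ.ne' _
  simp only [momentDensity, (hasDerivAt_inv_pow (m + 1) hρ).deriv]
  push_cast
  linear_combination (-((m : ℝ) + 1) * (c * zCoord x ^ m * toC (w x)).re) * e

/-- `w` solves the homogeneous resolvent equation in the sense of transposition. -/
def IsTransposedSolution (α ε : ℝ) (w : Plane → Plane) : Prop :=
  ∀ h, VanishingField ε 2 h → (∀ x ∈ extDisk ε, ∑ i, pderiv i h x i = 0) →
    ∫ x in extDisk ε, inner ℝ (w x) (h x - α • ∑ i, pderiv i (pderiv i h) x) = 0

lemma inner_powField (v : Plane) (L : Plane →L[ℝ] ℂ) (c : ℂ) (k : ℕ) (x : Plane) :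
    inner ℝ v (powField L c k x) = (c * L x ^ k * (starRingEnd ℂ) (toC v)).re := by
  rw [inner_eq_re, toC_powField]

lemma laplacian_add {f g : Plane → Plane} (hf : ContDiffOn ℝ ∞ f {0}ᶜ) (hg : ContDiffOn ℝ ∞ g {0}ᶜ)
    {x : Plane} (hx : x ≠ 0) :
    ∑ i, pderiv i (pderiv i fun y => f y + g y) x =
      ∑ i, pderiv i (pderiv i f) x + ∑ i, pderiv i (pderiv i g) x := by
  have hd : ∀ {u : Plane → Plane}, ContDiffOn ℝ ∞ u {0}ᶜ → ∀ y ≠ 0, DifferentiableAt ℝ u y :=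
    fun hu y hy => (hu.contDiffAt (isOpen_punctured.mem_nhds hy)).differentiableAt (by simp)
  rw [← Finset.sum_add_distrib]
  refine Finset.sum_congr rfl fun i _ => ?_
  rw [← pderiv_add (hd (contDiffOn_pderiv isOpen_punctured hf i) x hx)
    (hd (contDiffOn_pderiv isOpen_punctured hg i) x hx)]
  refine pderiv_congr ?_ i
  filter_upwards [isOpen_punctured.mem_nhds hx] with y hy
  exact pderiv_add (hd hf y hy) (hd hg y hy) i

/-- Testing with `F(|x|²) c z^{m+2} + G(|x|²) c̄ z̄^m`, where the profiles solve the Bessel equations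
and are chosen so that this field is divergence free and vanishes on the circle. -/
lemma moment_relation_test {α : ℝ} (hα : 0 < α) (hε : 0 < ε) [ENNReal.HolderConjugate p q]
    (hq : q ≠ ⊤) (hq1 : 1 < q.toReal) (hw : MemLpSigma ε p w) (hsol : IsTransposedSolution α ε w)
    {l : ℝ} (hl : 0 < l) (m : ℕ) (c : ℂ) :
    (1 - α * l) * (1 / 4 * (∫ x in extDisk ε,
        momentDensity zbarCoord ((starRingEnd ℂ) c) (m + 2) w (besselInt (m + 3) l) x) +
      -l * (∫ x in extDisk ε, momentDensity zCoord c m w (besselInt (m + 1) l) x)) = 0 := by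
  have hμ := inv_pos.2 hα
  set μ := α⁻¹ with hμd
  have hαμ : α * μ = 1 := mul_inv_cancel₀ hα.ne'
  have hε2 : 0 < ε ^ 2 := by positivity
  -- `b` makes `G` vanish on the circle and `d` makes `F` vanish there. The terms with parameter
  -- `μ` drop out since `1 - α μ = 0`, and the term with `d` is a harmonic gradient.
  set b := -(l * besselInt (m + 1) l (ε ^ 2)) / (μ * besselInt (m + 1) μ (ε ^ 2)) with hb
  set d := -(1 / 4 * besselInt (m + 3) l (ε ^ 2) + b / 4 * besselInt (m + 3) μ (ε ^ 2)) *
    (ε ^ 2) ^ (m + 2) with hd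
  set F := profile (m + 3) (m + 2) l μ (1 / 4) (b / 4) d with hF
  set G := profile (m + 1) (m + 1) l μ (-l) (-(b * μ)) 0 with hG
  have dF : RadialDecay (ε ^ 2) (m + 2) F := radialDecay_profile hε2 hl hμ
  have dG : RadialDecay (ε ^ 2) (m + 1) G := radialDecay_profile hε2 hl hμ
  have F0 : F (ε ^ 2) = 0 := by
    simp only [hF, profile, hd]
    field_simp
    ring
  have G0 : G (ε ^ 2) = 0 := by
    have h1 := (besselInt_pos (m + 1) hμ hε2).ne'
    simp only [hG, profile, hb]
    generalize besselInt (m + 1) μ (ε ^ 2) = A at *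
    field_simp
    ring
  have v1 := vanishingField_radial hε (s := 2) (by omega) dF F0
    (homogeneousBound_powField norm_zCoord c (m + 2))
  have v2 := vanishingField_radial hε (s := 2) (by omega) dG G0
    (homogeneousBound_powField norm_zbarCoord ((starRingEnd ℂ) c) m)
  have hne : ∀ x ∈ extDisk ε, x ≠ 0 := fun x hx => ne_zero_of_mem_extDisk hε hx
  have hdiff : ∀ {u : Plane → Plane}, ContDiffOn ℝ ∞ u {0}ᶜ → ∀ y ≠ 0, DifferentiableAt ℝ u y :=
    fun hu y hy => (hu.contDiffAt (isOpen_punctured.mem_nhds hy)).differentiableAt (by simp)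
  have key := hsol _ (v1.add hε v2) fun x hx => ?_
  · have e : ∀ x ∈ extDisk ε, inner ℝ (w x) (F (‖x‖ ^ 2) • powField zCoord c (m + 2) x +
        G (‖x‖ ^ 2) • powField zbarCoord ((starRingEnd ℂ) c) m x - α • ∑ i, pderiv i (pderiv i
          fun x => F (‖x‖ ^ 2) • powField zCoord c (m + 2) x +
          G (‖x‖ ^ 2) • powField zbarCoord ((starRingEnd ℂ) c) m x) x) =
        1 * ((1 - α * l) * (1 / 4 *
          momentDensity zbarCoord ((starRingEnd ℂ) c) (m + 2) w (besselInt (m + 3) l) x +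
          -l * momentDensity zCoord c m w (besselInt (m + 1) l) x)) +
        d * momentDensity zbarCoord ((starRingEnd ℂ) c) (m + 2) w (fun ρ => (ρ ^ (m + 2))⁻¹) x := by
      intro x hx
      have hρ := norm_sq_pos (hne x hx)
      have q1 := radial_laplacian_profile (a := 1 / 4) (b := b / 4) (d := d) (m + 2) (m + 2) hl hμ hρ
      have q2 := radial_laplacian_profile (a := -l) (b := -(b * μ)) (d := 0) m (m + 1) hl hμ hρ
      rw [← hF] at q1
      rw [← hG] at q2
      rw [laplacian_add v1.smooth v2.smooth (hne x hx),
        laplacian_radial_powField isComplexCoord_zCoord dF.smooth _ _ (hne x hx),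
        laplacian_radial_powField isComplexCoord_zbarCoord dG.smooth _ _ (hne x hx), q1, q2]
      simp only [inner_sub_right, inner_add_right, real_inner_smul_right, inner_powField,
        momentDensity, zCoord_apply, zbarCoord_apply, re_conj_mul, Complex.conj_conj]
      simp only [hF, hG, profile]
      push_cast
      linear_combination (-b / 4 * ((starRingEnd ℂ) c * (starRingEnd ℂ) (toC x) ^ (m + 2) *
        toC (w x)).re * besselInt (m + 3) μ (‖x‖ ^ 2) + b * μ * (c * toC x ^ m * toC (w x)).re *
          besselInt (m + 1) μ (‖x‖ ^ 2)) * hαμ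
    have i1 := integrable_momentDensity hε hq hq1 hw.1 norm_zbarCoord (N := m + 2) (k := m + 2)
      (by omega) (radialDecay_besselInt' hε (m + 3) _ hl) ((starRingEnd ℂ) c)
    have i2 := integrable_momentDensity hε hq hq1 hw.1 norm_zCoord (N := m + 1) (k := m)
      (by omega) (radialDecay_besselInt' hε (m + 1) _ hl) c
    have i3 := integrable_momentDensity hε hq hq1 hw.1 norm_zbarCoord (N := m + 2) (k := m + 2)
      (by omega) (radialDecay_inv_pow hε2 (m + 2)) ((starRingEnd ℂ) c)
    rw [integral_congr_linear (measurableSet_extDisk ε)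
      (((i1.const_mul (1 / 4)).add (i2.const_mul (-l))).const_mul (1 - α * l)) i3 e,
      moment_inv_pow_eq_zero hε hq hq1 hw, mul_zero, add_zero, one_mul] at key
    rw [← key, integral_const_mul]
    simp only [Pi.add_apply]
    rw [integral_add (i1.const_mul (1 / 4)) (i2.const_mul (-l)), integral_const_mul,
      integral_const_mul]
  · have hρ := norm_sq_pos (hne x hx)
    have r1 := besselInt_recurrence (m + 2) hl hρ
    have r2 := besselInt_recurrence (m + 2) hμ hρ
    have r3 : ‖x‖ ^ 2 * ((‖x‖ ^ 2) ^ (m + 2 + 1))⁻¹ = ((‖x‖ ^ 2) ^ (m + 2))⁻¹ :=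
      mul_inv_pow_succ hρ.ne' _
    have s1 := divergence_radial_zCoord (differentiableAt_of_smooth dF.smooth hρ) c (m + 1)
    have s2 := divergence_radial_zbarCoord (differentiableAt_of_smooth dG.smooth hρ) c m
    simp only [pderiv_add (hdiff v1.smooth x (hne x hx)) (hdiff v2.smooth x (hne x hx)),
      PiLp.add_apply, Finset.sum_add_distrib]
    refine (congrArg₂ (· + ·) s1 s2).trans ?_
    rw [hF, hG, deriv_profile hl hμ hρ, deriv_profile hl hμ hρ, profile]
    push_cast at r1 r2 ⊢
    linear_combination (2 * (c * toC x ^ (m + 1)).re) * (-(1 / 4) * r1 - b / 4 * r2 -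
      d * (m + 2) * r3)

/-- The moments of lowest frequency, obtained from the radial potential and the azimuthal field. -/
lemma moment_zbar_one (hε : 0 < ε) {α : ℝ} (hα : 0 < α) [ENNReal.HolderConjugate p q] (hq : q ≠ ⊤)
    (hq1 : 1 < q.toReal) (hw : MemLpSigma ε p w) (hsol : IsTransposedSolution α ε w) {l : ℝ}
    (hl : 0 < l) (hlα : 1 - α * l ≠ 0) (c : ℂ) :
    ∫ x in extDisk ε, momentDensity zbarCoord c 1 w (besselInt 2 l) x = 0 := by
  have hμ := inv_pos.2 hα
  set μ := α⁻¹ with hμd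
  have hαμ : α * μ = 1 := mul_inv_cancel₀ hα.ne'
  have hε2 : 0 < ε ^ 2 := by positivity
  have hi := fun c => integrable_momentDensity hε hq hq1 hw.1 norm_zbarCoord (N := 2) (k := 1)
      (by omega) (radialDecay_besselInt' hε 2 _ hl) c
  -- the potential `A₁^l(|x|²)` has gradient `-(1/2) A₂^l(|x|²) x`
  have hre : ∫ x in extDisk ε, momentDensity zbarCoord 1 1 w (besselInt 2 l) x = 0 := by
    have h := hw.integral_gradient_radial hε hq hq1 (N := 1) (k := 0) (by omega)
      (radialDecay_besselInt' hε 1 _ hl) (homogeneousBound_powPotential norm_zCoord 1 0)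
    rw [setIntegral_congr_fun (g := fun x => -(1 / 2) *
      momentDensity zbarCoord 1 1 w (besselInt 2 l) x) (measurableSet_extDisk ε) fun x hx => ?_,
      integral_const_mul] at h
    · exact (mul_eq_zero.1 h).resolve_left (by norm_num)
    have hρ := norm_sq_pos (ne_zero_of_mem_extDisk hε hx)
    simp only [gradient_radial_powPotential (differentiableAt_of_smooth
      (contDiffOn_besselInt 1 hl) hρ), momentDensity, zbarCoord_apply, deriv_besselInt 1 hl hρ,
      re_conj_mul]
    simp
    ring
  -- the azimuthal test field `(A₂^l + b A₂^μ) x^⊥`, with `b` chosen such that it vanishes on the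
  -- circle
  have him : ∫ x in extDisk ε, momentDensity zbarCoord Complex.I 1 w (besselInt 2 l) x = 0 := by
    set b := -besselInt 2 l (ε ^ 2) / besselInt 2 μ (ε ^ 2) with hb
    set F := profile 2 2 l μ 1 b 0 with hF
    have dF : RadialDecay (ε ^ 2) 2 F := radialDecay_profile hε2 hl hμ
    have F0 : F (ε ^ 2) = 0 := by
      have h1 := (besselInt_pos 2 hμ hε2).ne'
      simp only [hF, profile, hb]
      generalize besselInt 2 μ (ε ^ 2) = A at *
      field_simp
      ring
    have v := vanishingField_radial hε (s := 2) (by omega) dF F0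
      (homogeneousBound_powField norm_zCoord Complex.I 1)
    have key := hsol _ v fun x hx => by
      have hρ := norm_sq_pos (ne_zero_of_mem_extDisk hε hx)
      rw [divergence_radial_zCoord (differentiableAt_of_smooth dF.smooth hρ) Complex.I 0]
      simp
    rw [setIntegral_congr_fun (g := fun x => -(1 - α * l) *
      momentDensity zbarCoord Complex.I 1 w (besselInt 2 l) x) (measurableSet_extDisk ε)
      fun x hx => ?_, integral_const_mul] at key
    · exact (mul_eq_zero.1 key).resolve_left (neg_ne_zero.2 hlα)
    have hx0 := ne_zero_of_mem_extDisk hε hx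
    have hρ := norm_sq_pos hx0
    have q1 := radial_laplacian_profile (a := 1) (b := b) (d := 0) 1 2 hl hμ hρ
    rw [← hF] at q1
    simp only
    rw [laplacian_radial_powField isComplexCoord_zCoord dF.smooth _ _ hx0, q1]
    simp only [inner_sub_right, real_inner_smul_right, inner_powField, momentDensity, zCoord_apply,
      zbarCoord_apply, re_conj_mul, Complex.conj_I]
    simp only [hF, profile, neg_mul, Complex.neg_re]
    push_cast
    linear_combination (b * besselInt 2 μ (‖x‖ ^ 2) *
      (Complex.I * (starRingEnd ℂ) (toC x) ^ 1 * toC (w x)).re) * hαμ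
  rw [integral_congr_linear (measurableSet_extDisk ε) (hi 1) (hi Complex.I) (a := c.re) (b := c.im),
    hre, him, mul_zero, mul_zero, add_zero]
  intro x _
  simp only [momentDensity]
  conv_lhs => rw [← Complex.re_add_im c]
  simp
  ring

/-- All Bessel moments of a solenoidal solution of the homogeneous equation vanish. For each `m` the
two relations `-l M - N/4 = 0` and `-l M + N/4 = 0` between the moment `M` of `c z^m` and the moment `N`
of `c̄ z̄^{m+2}` are independent; this leaves out the powers `1` and `z̄`, which are treated apart. -/
lemma moment_besselInt_eq_zero (hε : 0 < ε) {α : ℝ} (hα : 0 < α) [ENNReal.HolderConjugate p q]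
    (hq : q ≠ ⊤) (hq1 : 1 < q.toReal) (hw : MemLpSigma ε p w) (hsol : IsTransposedSolution α ε w)
    {l : ℝ} (hl : 0 < l) (hlα : 1 - α * l ≠ 0) (m : ℕ) (c : ℂ) :
    ∫ x in extDisk ε, momentDensity zCoord c m w (besselInt (m + 1) l) x = 0 ∧
      ∫ x in extDisk ε, momentDensity zbarCoord c m w (besselInt (m + 1) l) x = 0 := by
  have main : ∀ m c, ∫ x in extDisk ε, momentDensity zCoord c m w (besselInt (m + 1) l) x = 0 ∧
      ∫ x in extDisk ε, momentDensity zbarCoord ((starRingEnd ℂ) c) (m + 2) w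
        (besselInt (m + 3) l) x = 0 := by
    intro m c
    have h1 := moment_relation_gradient hε hq hq1 hw hl m c
    have h2 := (mul_eq_zero.1 (moment_relation_test hα hε hq hq1 hw hsol hl m c)).resolve_left hlα
    refine ⟨(mul_eq_zero.1 (?_ : l * _ = 0)).resolve_left hl.ne', ?_⟩ <;> linarith
  refine ⟨(main m c).1, ?_⟩
  rcases m with _ | _ | m
  · simpa only [momentDensity, pow_zero] using (main 0 c).1
  · exact moment_zbar_one hε hα hq hq1 hw hsol hl hlα c
  · simpa using (main m ((starRingEnd ℂ) c)).2

end Moments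

/-! ### Completeness of the Bessel moments -/

section Laplace

/-- A function on `(0, ∞)` whose Laplace transform vanishes on an arithmetic progression is zero, by
the Weierstrass approximation theorem in the variable `e^{-t}`. -/
lemma ae_eq_zero_of_laplace_eq_zero {f : ℝ → ℝ} (hf : IntegrableOn f (Set.Ioi 0))
    (h : ∀ j : ℕ, ∫ t in Set.Ioi (0 : ℝ), Real.exp (-(j * t)) * f t = 0) :
    ∀ᵐ t, t ∈ Set.Ioi (0 : ℝ) → f t = 0 := by
  refine isOpen_Ioi.ae_eq_zero_of_integral_contDiff_smul_eq_zero hf.locallyIntegrableOn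
    fun φ hφ hc hsupp => ?_
  have hset : ∫ t, φ t • f t = ∫ t in Set.Ioi (0 : ℝ), φ t * f t := by
    refine (setIntegral_eq_integral_of_forall_compl_eq_zero fun t ht => ?_).symm
    rw [image_eq_zero_of_notMem_tsupport fun h => ht (hsupp h), zero_smul]
  rw [hset]
  -- polynomials in `e^{-t}` integrate to zero against `f`
  have hexp : ∀ j : ℕ, ∀ t : ℝ, Real.exp (-(j * t)) = Real.exp (-t) ^ j := fun j t => by
    rw [← Real.exp_nat_mul]; congr 1; ring
  have hle : ∀ t ∈ Set.Ioi (0 : ℝ), Real.exp (-t) ∈ Set.Icc (0 : ℝ) 1 := fun t (ht : 0 < t) =>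
    ⟨(Real.exp_pos _).le, Real.exp_le_one_iff.2 (by linarith)⟩
  have hintj : ∀ j : ℕ, IntegrableOn (fun t => Real.exp (-t) ^ j * f t) (Set.Ioi 0) := by
    intro j
    refine hf.norm.mono' (AEStronglyMeasurable.mul (by fun_prop) hf.1)
      ((ae_restrict_iff' measurableSet_Ioi).2 (ae_of_all _ fun t ht => ?_))
    rw [norm_mul, Real.norm_of_nonneg (pow_nonneg (hle t ht).1 _)]
    exact mul_le_of_le_one_left (norm_nonneg _) (pow_le_one₀ (hle t ht).1 (hle t ht).2)
  have h' : ∀ j : ℕ, ∫ t in Set.Ioi (0 : ℝ), Real.exp (-t) ^ j * f t = 0 := fun j => by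
    simpa only [hexp] using h j
  have hpoly : ∀ P : Polynomial ℝ, IntegrableOn (fun t => P.eval (Real.exp (-t)) * f t) (Set.Ioi 0) ∧
      ∫ t in Set.Ioi (0 : ℝ), P.eval (Real.exp (-t)) * f t = 0 := by
    intro P
    simp only [Polynomial.eval_eq_sum_range, Finset.sum_mul, mul_assoc]
    refine ⟨integrable_finsetSum _ fun j _ => (hintj j).const_mul _, ?_⟩
    rw [integral_finsetSum _ fun j _ => (hintj j).const_mul _]
    refine Finset.sum_eq_zero fun j _ => ?_
    rw [integral_const_mul, h', mul_zero]
  obtain ⟨R, hR⟩ := hc.isCompact.bddAbove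
  have hφR : ∀ t, R < t → φ t = 0 := fun t ht =>
    image_eq_zero_of_notMem_tsupport fun h => absurd (hR h) (not_le.2 ht)
  -- the test function as a continuous function of `e^{-t}`
  have hη : ContinuousOn (fun s => φ (-Real.log s)) (Set.Icc 0 1) := by
    intro s hs
    rcases hs.1.eq_or_lt with rfl | hs0
    · have h0 : φ (-Real.log 0) = 0 := by
        rw [Real.log_zero, neg_zero]
        exact image_eq_zero_of_notMem_tsupport fun h => lt_irrefl (0 : ℝ) (hsupp h)
      rw [ContinuousWithinAt, h0]
      refine tendsto_const_nhds.congr' ?_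
      have : Set.Iio (Real.exp (-R)) ∈ 𝓝[Set.Icc 0 1] (0 : ℝ) :=
        mem_nhdsWithin_of_mem_nhds (Iio_mem_nhds (Real.exp_pos _))
      filter_upwards [this, self_mem_nhdsWithin] with s h1 h2
      rcases h2.1.eq_or_lt with rfl | h3
      · exact h0.symm
      · refine (hφR _ ?_).symm
        have := (Real.log_lt_iff_lt_exp h3).2 h1
        linarith
    · exact (hφ.continuous.continuousAt.comp (Real.continuousAt_log hs0.ne').neg).continuousWithinAt
  have hφint : IntegrableOn (fun t => φ t * f t) (Set.Ioi 0) := by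
    obtain ⟨C, hC⟩ := hφ.continuous.bounded_above_of_compact_support hc
    exact hf.bdd_mul hφ.continuous.aestronglyMeasurable (ae_of_all _ hC)
  set I := ∫ t in Set.Ioi (0 : ℝ), ‖f t‖ with hI
  have hI0 : 0 ≤ I := integral_nonneg fun t => norm_nonneg _
  have hsmall : ∀ δ, 0 < δ → |∫ t in Set.Ioi (0 : ℝ), φ t * f t| ≤ δ * I := by
    intro δ hδ
    obtain ⟨P, hP⟩ := exists_polynomial_near_of_continuousOn 0 1 _ hη δ hδ
    have e : ∫ t in Set.Ioi (0 : ℝ), φ t * f t =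
        ∫ t in Set.Ioi (0 : ℝ), (φ t * f t - P.eval (Real.exp (-t)) * f t) := by
      rw [integral_sub hφint (hpoly P).1, (hpoly P).2, sub_zero]
    rw [e, hI, ← integral_const_mul, ← Real.norm_eq_abs]
    refine norm_integral_le_of_norm_le (hf.norm.const_mul δ)
      ((ae_restrict_iff' measurableSet_Ioi).2 (ae_of_all _ fun t ht => ?_))
    have := hP _ (hle t ht)
    rw [Real.log_exp, neg_neg, abs_sub_comm] at this
    rw [← sub_mul, norm_mul, Real.norm_eq_abs]
    gcongr
  refine abs_eq_zero.1 (le_antisymm (le_of_forall_pos_le_add fun δ hδ => ?_) (abs_nonneg _))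
  refine (hsmall (δ / (I + 1)) (by positivity)).trans ?_
  rw [zero_add, div_mul_eq_mul_div, div_le_iff₀ (by positivity)]
  nlinarith

variable {X : Type*} [MeasurableSpace X] {ν : Measure X} {g r : X → ℝ}

/-- Differentiation under the integral sign of the Gaussian moments in `s`. -/
lemma hasDerivAt_integral_mul_exp (hg : AEStronglyMeasurable g ν) (hr : Measurable r)
    (hr0 : ∀ᵐ x ∂ν, 0 ≤ r x) (k : ℕ)
    (hint : ∀ k : ℕ, ∀ s : ℝ, 0 < s → Integrable (fun x => g x * (r x ^ k * Real.exp (-(s * r x)))) ν)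
    {s : ℝ} (hs : 0 < s) :
    HasDerivAt (fun s => ∫ x, g x * (r x ^ k * Real.exp (-(s * r x))) ∂ν)
      (-∫ x, g x * (r x ^ (k + 1) * Real.exp (-(s * r x))) ∂ν) s := by
  have hm : ∀ k : ℕ, ∀ s : ℝ, AEStronglyMeasurable
      (fun x => g x * (r x ^ k * Real.exp (-(s * r x)))) ν := fun k s =>
    hg.mul (Measurable.aestronglyMeasurable (by fun_prop))
  have key := (hasDerivAt_integral_of_dominated_loc_of_deriv_le (μ := ν)
    (F := fun s x => g x * (r x ^ k * Real.exp (-(s * r x))))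
    (F' := fun s x => -(g x * (r x ^ (k + 1) * Real.exp (-(s * r x)))))
    (x₀ := s) (s := Set.Ioi (s / 2))
    (bound := fun x => ‖g x * (r x ^ (k + 1) * Real.exp (-(s / 2 * r x)))‖)
    (Ioi_mem_nhds (by linarith)) (Eventually.of_forall fun s' => hm k s') (hint k s hs)
    (hm (k + 1) s).neg ?_ (hint (k + 1) (s / 2) (by positivity)).norm
    (ae_of_all _ fun x s' _ => ?_)).2
  · rwa [integral_neg] at key
  · filter_upwards [hr0] with x hx s' hs'
    have : s / 2 ≤ s' := le_of_lt hs'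
    rw [norm_neg, norm_mul, norm_mul, norm_mul, norm_mul, Real.norm_of_nonneg (Real.exp_pos _).le,
      Real.norm_of_nonneg (Real.exp_pos _).le]
    gcongr
  · have h1 : HasDerivAt (fun s' : ℝ => g x * (r x ^ k * Real.exp (-(s' * r x))))
        (g x * (r x ^ k * (Real.exp (-(s' * r x)) * -(1 * r x)))) s' :=
      (((((hasDerivAt_id s').mul_const (r x)).fun_neg).exp).const_mul _).const_mul _
    refine h1.congr_deriv ?_
    rw [pow_succ]
    ring

/-- If the Bessel moments of `g` with parameters in an arithmetic progression vanish, then so do its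
Gaussian moments of every order. -/
lemma gaussian_moment_eq_zero [SFinite ν] (hg : AEStronglyMeasurable g ν) (hr : Measurable r)
    (hr0 : ∀ᵐ x ∂ν, 0 < r x) (m : ℕ) {l : ℝ} (hl : 0 < l)
    (hint : ∀ k : ℕ, ∀ s : ℝ, 0 < s → Integrable (fun x => g x * (r x ^ k * Real.exp (-(s * r x)))) ν)
    (hintB : Integrable (fun x => g x * besselInt m l (r x)) ν)
    (h : ∀ j : ℕ, ∫ x, g x * besselInt m (l + j) (r x) ∂ν = 0) (k : ℕ) {s : ℝ} (hs : 0 < s) :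
    ∫ x, g x * (r x ^ k * Real.exp (-(s * r x))) ∂ν = 0 := by
  have hr0' : ∀ᵐ x ∂ν, 0 ≤ r x := hr0.mono fun x hx => hx.le
  -- reduction to the moments of order zero by differentiation in `s`
  suffices h0 : ∀ s, 0 < s → ∫ x, g x * (r x ^ 0 * Real.exp (-(s * r x))) ∂ν = 0 by
    induction k generalizing s with
    | zero => exact h0 s hs
    | succ k ih =>
      have h1 := hasDerivAt_integral_mul_exp hg hr hr0' k hint hs
      have h2 : HasDerivAt (fun s => ∫ x, g x * (r x ^ k * Real.exp (-(s * r x))) ∂ν) 0 s := by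
        refine (hasDerivAt_const s (0 : ℝ)).congr_of_eventuallyEq ?_
        filter_upwards [Ioi_mem_nhds hs] with s' hs'
        exact ih hs'
      exact neg_eq_zero.1 (h1.unique h2)
  -- for fixed `t`, the integral of `K x t` over `x` is the Gaussian moment with `s = 1/(4t)`, up
  -- to a positive factor; the Bessel moments are the Laplace transform of this function of `t`
  set K : X → ℝ → ℝ := fun x t => g x * (Real.exp (-(l * t) - r x / (4 * t)) * (t ^ m)⁻¹) with hK
  have hKm : AEStronglyMeasurable (Function.uncurry K) (ν.prod (volume.restrict (Set.Ioi 0))) := by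
    refine (hg.comp_fst).mul (Measurable.aestronglyMeasurable ?_)
    fun_prop
  have hKi : Integrable (Function.uncurry K) (ν.prod (volume.restrict (Set.Ioi 0))) := by
    rw [integrable_prod_iff hKm]
    refine ⟨?_, hintB.norm.congr ?_⟩
    · filter_upwards [hr0] with x hx
      exact (integrableOn_besselInt_integrand m hl hx).const_mul (g x)
    · refine ae_of_all _ fun x => ?_
      simp only [Function.uncurry_apply_pair, hK, norm_mul]
      rw [integral_const_mul, Real.norm_of_nonneg (besselInt_nonneg _ _ _), besselInt]
      congr 1
      refine setIntegral_congr_fun measurableSet_Ioi fun t (ht : 0 < t) => ?_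
      rw [Real.norm_of_nonneg (Real.exp_pos _).le, Real.norm_of_nonneg (by positivity)]
  have hzero : ∀ᵐ t, t ∈ Set.Ioi (0 : ℝ) → ∫ x, K x t ∂ν = 0 := by
    refine ae_eq_zero_of_laplace_eq_zero hKi.integral_prod_right fun j => ?_
    have hj : Integrable (Function.uncurry fun x t => Real.exp (-(j * t)) * K x t)
        (ν.prod (volume.restrict (Set.Ioi 0))) := by
      refine hKi.norm.mono' (AEStronglyMeasurable.mul
        (Measurable.aestronglyMeasurable (by fun_prop)) hKm) ?_
      have : ∀ᵐ z ∂(ν.prod (volume.restrict (Set.Ioi (0 : ℝ)))), 0 < z.2 :=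
        (Measure.quasiMeasurePreserving_snd (μ := ν) (ν := volume.restrict (Set.Ioi (0 : ℝ)))).ae
          (ae_restrict_mem measurableSet_Ioi)
      filter_upwards [this] with z hz
      simp only [Function.uncurry, norm_mul]
      rw [Real.norm_of_nonneg (Real.exp_pos _).le]
      refine mul_le_of_le_one_left (by positivity) (Real.exp_le_one_iff.2 ?_)
      have : 0 ≤ j * z.2 := by positivity
      linarith
    simp_rw [← integral_const_mul]
    rw [← integral_integral_swap hj]
    refine Eq.trans ?_ (h j)
    refine integral_congr_ae (ae_of_all _ fun x => ?_)
    simp only [hK, besselInt]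
    rw [← integral_const_mul]
    refine integral_congr_ae (ae_of_all _ fun t => ?_)
    simp only
    have e : Real.exp (-((l + j) * t) - r x / (4 * t)) =
        Real.exp (-(j * t)) * Real.exp (-(l * t) - r x / (4 * t)) := by
      rw [← Real.exp_add]; congr 1; ring
    rw [e]
    ring
  have hcont : ContinuousOn (fun t : ℝ => ∫ x, g x * (r x ^ 0 * Real.exp (-(1 / (4 * t) * r x))) ∂ν)
      (Set.Ioi 0) := by
    intro t (ht : 0 < t)
    have h1 : ContinuousAt (fun s => ∫ x, g x * (r x ^ 0 * Real.exp (-(s * r x))) ∂ν) (1 / (4 * t)) :=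
      (hasDerivAt_integral_mul_exp hg hr hr0' 0 hint (by positivity)).continuousAt
    have h2 : ContinuousAt (fun t : ℝ => 1 / (4 * t)) t :=
      continuousAt_const.div (by fun_prop) (by positivity)
    exact (ContinuousAt.comp (f := fun t : ℝ => 1 / (4 * t)) h1 h2).continuousWithinAt
  have hae : (fun t : ℝ => ∫ x, g x * (r x ^ 0 * Real.exp (-(1 / (4 * t) * r x))) ∂ν)
      =ᵐ[volume.restrict (Set.Ioi 0)] fun _ => 0 := by
    refine (ae_restrict_iff' measurableSet_Ioi).2 ?_
    filter_upwards [hzero] with t h1 ht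
    have ht0 : 0 < t := ht
    have h2 := h1 ht
    rw [show (fun x => K x t) = fun x => (Real.exp (-(l * t)) * (t ^ m)⁻¹) *
      (g x * (r x ^ 0 * Real.exp (-(1 / (4 * t) * r x)))) from funext fun x => by
        simp only [hK, sub_eq_add_neg, Real.exp_add]
        rw [show -(1 / (4 * t) * r x) = -(r x / (4 * t)) by ring]
        ring, integral_const_mul] at h2
    exact (mul_eq_zero.1 h2).resolve_left (by positivity)
  -- the moments vanish for almost every `t`, and they are continuous in `t`
  have heq := Measure.eqOn_open_of_ae_eq hae isOpen_Ioi hcont continuousOn_const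
  intro s hs
  have := heq (show (1 / (4 * s)) ∈ Set.Ioi (0 : ℝ) from by simp only [Set.mem_Ioi]; positivity)
  simp only at this
  rw [show 1 / (4 * (1 / (4 * s))) = s by field_simp] at this
  exact this

end Laplace

section Fourier

/-- An exponentially decaying function all of whose moments vanish is zero, since its Fourier
transform is given by its moments. -/
lemma ae_eq_zero_of_moments_eq_zero {ν : Measure Plane} [SigmaFinite ν] {f : Plane → ℝ}
    (hf : AEStronglyMeasurable f ν)
    (hexp : ∀ R : ℝ, Integrable (fun x => f x * Real.exp (R * ‖x‖)) ν)
    (h : ∀ ξ : Plane, ∀ n : ℕ, ∫ x, inner ℝ x ξ ^ n * f x ∂ν = 0) : f =ᵐ[ν] 0 := by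
  have hfi : Integrable f ν := by simpa using hexp 0
  have hfourier : ∀ ξ : Plane, ∫ x, (f x : ℂ) * Complex.exp (inner ℝ x ξ * Complex.I) ∂ν = 0 := by
    intro ξ
    -- the exponential series is integrated term by term, dominated by `|f| e^{|ξ| |x|}`
    have key := hasSum_integral_of_dominated_convergence (μ := ν)
      (F := fun (n : ℕ) x => (f x : ℂ) * ((inner ℝ x ξ * Complex.I) ^ n / n.factorial))
      (f := fun x => (f x : ℂ) * Complex.exp (inner ℝ x ξ * Complex.I))
      (fun n x => ‖f x‖ * ((‖ξ‖ * ‖x‖) ^ n / n.factorial)) (fun n => ?_)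
      (fun n => ae_of_all _ fun x => ?_) (ae_of_all _ fun x => ?_) ?_ (ae_of_all _ fun x => ?_)
    · refine (key.unique ?_)
      have h0 : ∀ n : ℕ, ∫ x, (f x : ℂ) * ((inner ℝ x ξ * Complex.I) ^ n / n.factorial) ∂ν = 0 := by
        intro n
        have e : ∀ x, (f x : ℂ) * ((inner ℝ x ξ * Complex.I) ^ n / n.factorial) =
            (Complex.I ^ n / n.factorial) * ((inner ℝ x ξ ^ n * f x : ℝ) : ℂ) := fun x => by
          push_cast; ring
        simp_rw [e]
        rw [integral_const_mul, integral_complex_ofReal, h ξ n, Complex.ofReal_zero, mul_zero]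
      simp only [h0]
      exact hasSum_zero
    · refine (Complex.continuous_ofReal.comp_aestronglyMeasurable hf).mul
        (Continuous.aestronglyMeasurable ?_)
      fun_prop
    · rw [norm_mul, norm_div, norm_pow, norm_mul, Complex.norm_I, mul_one, Complex.norm_real,
        Complex.norm_real, Complex.norm_natCast]
      gcongr
      rw [mul_comm]
      exact norm_inner_le_norm x ξ
    · exact (NormedSpace.expSeries_div_summable (‖ξ‖ * ‖x‖)).mul_left _
    · refine (hexp ‖ξ‖).norm.congr (ae_of_all _ fun x => ?_)
      simp only
      rw [tsum_mul_left, norm_mul, Real.norm_of_nonneg (Real.exp_pos _).le, Real.exp_eq_exp_ℝ,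
        NormedSpace.exp_eq_tsum_div]
    · rw [Complex.exp_eq_exp_ℂ]
      have h1 := NormedSpace.expSeries_div_hasSum_exp (((inner ℝ x ξ : ℝ) : ℂ) * Complex.I)
      exact h1.mul_left (f x : ℂ)
  -- injectivity of the Fourier transform, through the finite measures with densities the positive
  -- and the negative part of `f`
  have hm1 : AEMeasurable (fun x => ENNReal.ofReal (f x)) ν := hf.aemeasurable.ennreal_ofReal
  have hm2 : AEMeasurable (fun x => ENNReal.ofReal (-f x)) ν := hf.aemeasurable.neg.ennreal_ofReal
  have hfin1 : IsFiniteMeasure (ν.withDensity fun x => ENNReal.ofReal (f x)) :=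
    isFiniteMeasure_withDensity_ofReal hfi.2
  have hfin2 : IsFiniteMeasure (ν.withDensity fun x => ENNReal.ofReal (-f x)) :=
    isFiniteMeasure_withDensity_ofReal hfi.neg.2
  have heq : (ν.withDensity fun x => ENNReal.ofReal (f x)) =
      ν.withDensity fun x => ENNReal.ofReal (-f x) := by
    refine Measure.ext_of_charFun (funext fun ξ => ?_)
    rw [charFun_apply, charFun_apply, integral_withDensity_eq_integral_toReal_smul₀ hm1
      (ae_of_all _ fun x => ENNReal.ofReal_lt_top), integral_withDensity_eq_integral_toReal_smul₀ hm2
      (ae_of_all _ fun x => ENNReal.ofReal_lt_top), ← sub_eq_zero]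
    have hi : ∀ u : Plane → ℝ, Integrable u ν → Integrable
        (fun x => (ENNReal.ofReal (u x)).toReal • Complex.exp (inner ℝ x ξ * Complex.I)) ν := by
      intro u hu
      refine hu.norm.mono' (AEStronglyMeasurable.smul
        hu.1.aemeasurable.ennreal_ofReal.ennreal_toReal.aestronglyMeasurable
        (Continuous.aestronglyMeasurable (by fun_prop))) (ae_of_all _ fun x => ?_)
      rw [norm_smul, Complex.norm_exp_ofReal_mul_I, mul_one, ENNReal.toReal_ofReal',
        Real.norm_of_nonneg (le_max_right _ _)]
      exact max_le (le_abs_self _) (abs_nonneg _)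
    rw [← integral_sub (hi f hfi) (hi (fun x => -f x) hfi.neg), ← hfourier ξ]
    refine integral_congr_ae (ae_of_all _ fun x => ?_)
    simp only
    rw [← sub_smul, ENNReal.toReal_ofReal', ENNReal.toReal_ofReal', Complex.real_smul]
    congr 2
    rcases le_total 0 (f x) with h | h
    · rw [max_eq_left h, max_eq_right (by linarith), sub_zero]
    · rw [max_eq_right h, max_eq_left (by linarith), zero_sub, neg_neg]
  rw [withDensity_eq_iff_of_sigmaFinite hm1 hm2] at heq
  filter_upwards [heq] with x hx
  have hx' := congrArg ENNReal.toReal hx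
  rw [ENNReal.toReal_ofReal', ENNReal.toReal_ofReal'] at hx'
  rcases le_total 0 (f x) with h | h
  · rw [max_eq_left h, max_eq_right (by linarith)] at hx'; exact hx'
  · rw [max_eq_right h, max_eq_left (by linarith)] at hx'
    simp only [Pi.zero_apply]; linarith

end Fourier

/-! ### Uniqueness for the resolvent equation -/

section Uniqueness

variable {ε : ℝ} {p q : ℝ≥0∞} {w : Plane → Plane}

lemma pow_mul_exp_neg_le {s ρ : ℝ} (hs : 0 < s) (hρ : 0 < ρ) (k N : ℕ) :
    |ρ ^ k * Real.exp (-(s * ρ))| ≤ (N + k).factorial * (s ^ (N + k))⁻¹ * (ρ ^ N)⁻¹ := by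
  have h := Real.pow_div_factorial_le_exp (s * ρ) (by positivity) (N + k)
  rw [abs_of_nonneg (by positivity), Real.exp_neg]
  calc ρ ^ k * (Real.exp (s * ρ))⁻¹ ≤ ρ ^ k * ((s * ρ) ^ (N + k) / (N + k).factorial)⁻¹ := by gcongr
    _ = _ := by
      rw [mul_pow, pow_add ρ]
      field_simp

variable [ENNReal.HolderConjugate p q]

lemma integrable_gaussian_moment (hε : 0 < ε) (hq : q ≠ ⊤) (hq1 : 1 < q.toReal)
    (hw : MemLp w p (volume.restrict (extDisk ε))) {L : Plane →L[ℝ] ℂ} (hn : ∀ x, ‖L x‖ = ‖x‖)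
    (c : ℂ) (m k : ℕ) {s : ℝ} (hs : 0 < s) :
    Integrable (momentDensity L c m w fun ρ => ρ ^ k * Real.exp (-(s * ρ)))
      (volume.restrict (extDisk ε)) :=
  integrable_momentDensity_of_le hε hq hq1 hw hn (N := m + 1) (by omega) (by fun_prop)
    (fun ρ hρ => pow_mul_exp_neg_le hs ((by positivity : 0 < ε ^ 2).trans_le hρ) k (m + 1)) c

/-- The parameters `α⁻¹ + 1 + j` form an arithmetic progression that avoids the exceptional value
`α⁻¹`. -/
lemma gaussian_moment_pow_eq_zero {α : ℝ} (hα : 0 < α) (hε : 0 < ε) (hq : q ≠ ⊤)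
    (hq1 : 1 < q.toReal) (hw : MemLpSigma ε p w) (hsol : IsTransposedSolution α ε w) (c : ℂ)
    (m k : ℕ) {s : ℝ} (hs : 0 < s) :
    ∫ x in extDisk ε, momentDensity zCoord c m w (fun ρ => ρ ^ k * Real.exp (-(s * ρ))) x = 0 ∧
      ∫ x in extDisk ε, momentDensity zbarCoord c m w (fun ρ => ρ ^ k * Real.exp (-(s * ρ))) x = 0 := by
  have hl : 0 < α⁻¹ + 1 := by positivity
  have hlj : ∀ j : ℕ, 0 < α⁻¹ + 1 + j ∧ 1 - α * (α⁻¹ + 1 + j) ≠ 0 := fun j => by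
    refine ⟨by positivity, ?_⟩
    have : 1 - α * (α⁻¹ + 1 + j) = -(α * (1 + j)) := by field_simp; ring
    rw [this]
    exact neg_ne_zero.2 (by positivity)
  have hmom := fun j : ℕ =>
    moment_besselInt_eq_zero hε hα hq hq1 hw hsol (hlj j).1 (hlj j).2 m c
  have main : ∀ {L : Plane →L[ℝ] ℂ}, (∀ x, ‖L x‖ = ‖x‖) →
      (∀ j : ℕ, ∫ x in extDisk ε, momentDensity L c m w (besselInt (m + 1) (α⁻¹ + 1 + j)) x = 0) →
      ∫ x in extDisk ε, momentDensity L c m w (fun ρ => ρ ^ k * Real.exp (-(s * ρ))) x = 0 := by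
    intro L hn h
    refine gaussian_moment_eq_zero (ν := volume.restrict (extDisk ε))
      (g := fun x => (c * L x ^ m * toC (w x)).re) (r := fun x => ‖x‖ ^ 2) (m := m + 1) ?_
      (by fun_prop) ?_ hl
      (fun k s hs => integrable_gaussian_moment hε hq hq1 hw.1 hn c m k hs)
      (integrable_momentDensity hε hq hq1 hw.1 hn (N := m + 1) (by omega)
        (radialDecay_besselInt' hε (m + 1) _ hl) c) h k hs
    · have := toC.continuous.comp_aestronglyMeasurable hw.1.1
      exact Complex.continuous_re.comp_aestronglyMeasurable
        ((contDiff_const_mul_pow L c m).continuous.aestronglyMeasurable.mul this)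
    · exact (ae_restrict_iff' (measurableSet_extDisk ε)).2
        (ae_of_all _ fun x hx => norm_sq_pos (ne_zero_of_mem_extDisk hε hx))
  exact ⟨main norm_zCoord fun j => (hmom j).1, main norm_zbarCoord fun j => (hmom j).2⟩

/-- Gaussian moments against arbitrary monomials: `z^a z̄^b` is a power of `|x|²` times a power of `z` or
of `z̄`. -/
lemma gaussian_moment_monomial {α : ℝ} (hα : 0 < α) (hε : 0 < ε) (hq : q ≠ ⊤)
    (hq1 : 1 < q.toReal) (hw : MemLpSigma ε p w) (hsol : IsTransposedSolution α ε w) (c : ℂ)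
    (a b : ℕ) :
    Integrable (fun x => (c * (toC x ^ a * (starRingEnd ℂ) (toC x) ^ b) * toC (w x)).re *
      Real.exp (-‖x‖ ^ 2)) (volume.restrict (extDisk ε)) ∧
    ∫ x in extDisk ε, (c * (toC x ^ a * (starRingEnd ℂ) (toC x) ^ b) * toC (w x)).re *
      Real.exp (-‖x‖ ^ 2) = 0 := by
  rcases le_total b a with h | h
  · obtain ⟨d, rfl⟩ := Nat.exists_eq_add_of_le h
    have e : (fun x => (c * (toC x ^ (b + d) * (starRingEnd ℂ) (toC x) ^ b) * toC (w x)).re *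
        Real.exp (-‖x‖ ^ 2)) = momentDensity zCoord c d w fun ρ => ρ ^ b * Real.exp (-(1 * ρ)) := by
      ext1 x
      have : c * (toC x ^ (b + d) * (starRingEnd ℂ) (toC x) ^ b) * toC (w x) =
          (((‖x‖ ^ 2) ^ b : ℝ) : ℂ) * (c * toC x ^ d * toC (w x)) := by
        rw [Complex.ofReal_pow, norm_sq_eq_toC, mul_pow, pow_add]; ring
      rw [this, Complex.re_ofReal_mul, momentDensity, zCoord_apply, one_mul]
      ring
    rw [e]
    exact ⟨integrable_gaussian_moment hε hq hq1 hw.1 norm_zCoord c d b one_pos,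
      (gaussian_moment_pow_eq_zero hα hε hq hq1 hw hsol c d b one_pos).1⟩
  · obtain ⟨d, rfl⟩ := Nat.exists_eq_add_of_le h
    have e : (fun x => (c * (toC x ^ a * (starRingEnd ℂ) (toC x) ^ (a + d)) * toC (w x)).re *
        Real.exp (-‖x‖ ^ 2)) = momentDensity zbarCoord c d w fun ρ => ρ ^ a * Real.exp (-(1 * ρ)) := by
      ext1 x
      have : c * (toC x ^ a * (starRingEnd ℂ) (toC x) ^ (a + d)) * toC (w x) =
          (((‖x‖ ^ 2) ^ a : ℝ) : ℂ) * (c * (starRingEnd ℂ) (toC x) ^ d * toC (w x)) := by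
        rw [Complex.ofReal_pow, norm_sq_eq_toC, mul_pow, pow_add]; ring
      rw [this, Complex.re_ofReal_mul, momentDensity, zbarCoord_apply, one_mul]
      ring
    rw [e]
    exact ⟨integrable_gaussian_moment hε hq hq1 hw.1 norm_zbarCoord c d a one_pos,
      (gaussian_moment_pow_eq_zero hα hε hq hq1 hw hsol c d a one_pos).2⟩

lemma ofReal_inner_eq (x ξ : Plane) : ((inner ℝ x ξ : ℝ) : ℂ) =
    toC x * ((starRingEnd ℂ) (toC ξ) / 2) + (starRingEnd ℂ) (toC x) * (toC ξ / 2) := by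
  have h := Complex.add_conj (toC ξ * (starRingEnd ℂ) (toC x))
  rw [inner_eq_re]
  rw [map_mul, Complex.conj_conj] at h
  push_cast at h
  linear_combination (-(1 / 2) : ℂ) * h

/-- Solenoidal solutions of the homogeneous transposed equation vanish. -/
lemma IsTransposedSolution.ae_eq_zero {α : ℝ} (hα : 0 < α) (hε : 0 < ε) (hq : q ≠ ⊤)
    (hq1 : 1 < q.toReal) (hw : MemLpSigma ε p w) (hsol : IsTransposedSolution α ε w) :
    w =ᵐ[volume.restrict (extDisk ε)] 0 := by
  have hwC := toC.continuous.comp_aestronglyMeasurable hw.1.1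
  -- it suffices to treat the real-valued functions `Re (c w) e^{-|x|²}`
  have hre : ∀ c : ℂ, (fun x => (c * toC (w x)).re * Real.exp (-‖x‖ ^ 2))
      =ᵐ[volume.restrict (extDisk ε)] 0 := by
    intro c
    have hm : AEStronglyMeasurable (fun x => (c * toC (w x)).re * Real.exp (-‖x‖ ^ 2))
        (volume.restrict (extDisk ε)) :=
      (Complex.continuous_re.comp_aestronglyMeasurable (hwC.const_mul c)).mul
        (Continuous.aestronglyMeasurable (by fun_prop))
    refine ae_eq_zero_of_moments_eq_zero hm (fun R => ?_) fun ξ n => ?_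
    · have hint : Integrable (fun x => ‖w x‖ * ((‖c‖ * Real.exp (R ^ 2 / 2) * 2) * (‖x‖ ^ 2)⁻¹))
          (volume.restrict (extDisk ε)) :=
        hw.1.norm.integrable_mul ((memLp_inv_norm_pow hε hq (by push_cast; linarith)).const_mul _)
      refine hint.mono' (hm.mul (Continuous.aestronglyMeasurable (by fun_prop)))
        ((ae_restrict_iff' (measurableSet_extDisk ε)).2 (ae_of_all _ fun x hx => ?_))
      have hx0 : 0 < ‖x‖ := hε.trans hx
      rw [mul_assoc, ← Real.exp_add, norm_mul, Real.norm_of_nonneg (Real.exp_pos _).le]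
      have h1 : |(c * toC (w x)).re| ≤ ‖c‖ * ‖w x‖ := by
        rw [← norm_toC (w x), ← norm_mul]; exact Complex.abs_re_le_norm _
      have h2 : Real.exp (-‖x‖ ^ 2 + R * ‖x‖) ≤ Real.exp (R ^ 2 / 2) * (2 * (‖x‖ ^ 2)⁻¹) := by
        have h3 : Real.exp (-‖x‖ ^ 2 + R * ‖x‖) ≤ Real.exp (R ^ 2 / 2 + -(‖x‖ ^ 2 / 2)) :=
          Real.exp_le_exp.2 (by nlinarith [sq_nonneg (R - ‖x‖)])
        refine h3.trans ?_
        rw [Real.exp_add, Real.exp_neg]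
        gcongr
        have h4 : ‖x‖ ^ 2 / 2 ≤ Real.exp (‖x‖ ^ 2 / 2) := by
          linarith [Real.add_one_le_exp (‖x‖ ^ 2 / 2)]
        calc _ ≤ (‖x‖ ^ 2 / 2)⁻¹ := by gcongr
          _ = _ := by field_simp
      calc _ ≤ (‖c‖ * ‖w x‖) * (Real.exp (R ^ 2 / 2) * (2 * (‖x‖ ^ 2)⁻¹)) := by
            rw [Real.norm_eq_abs]; gcongr
        _ = _ := by ring
    -- the power of the inner product is expanded in monomials `z^j z̄^{n-j}`
    · have hmono := fun j => gaussian_moment_monomial hα hε hq hq1 hw hsol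
        (c * (((starRingEnd ℂ) (toC ξ) / 2) ^ j * (toC ξ / 2) ^ (n - j) * n.choose j)) j (n - j)
      rw [← Finset.sum_eq_zero (s := Finset.range (n + 1)) fun j _ => (hmono j).2,
        ← integral_finsetSum _ fun j _ => (hmono j).1]
      refine integral_congr_ae (ae_of_all _ fun x => ?_)
      simp only
      rw [← Finset.sum_mul, ← Complex.re_sum, ← mul_assoc, ← Complex.re_ofReal_mul]
      congr 2
      rw [Complex.ofReal_pow, ofReal_inner_eq, add_pow, Finset.sum_mul]
      refine Finset.sum_congr rfl fun j _ => ?_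
      rw [mul_pow, mul_pow]
      ring
  filter_upwards [hre 1, hre (-Complex.I)] with x h1 h2
  have hne := (Real.exp_pos (-‖x‖ ^ 2)).ne'
  have h1' := (mul_eq_zero.1 h1).resolve_right hne
  have h2' := (mul_eq_zero.1 h2).resolve_right hne
  apply toC.injective
  rw [Pi.zero_apply, map_zero]
  apply Complex.ext
  · simpa using h1'
  · simpa using h2'

lemma integrable_fderiv_apply {p : ℝ≥0∞} (q : ℝ≥0∞) [ENNReal.HolderConjugate p q] {φ : Plane → ℝ}
    (hφ : ContDiff ℝ ∞ φ) (hc : HasCompactSupport φ) {u : Plane → Plane} (hu : MemLp u p (volume.restrict (extDisk ε))) :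
    Integrable (fun x => fderiv ℝ φ x (u x)) (volume.restrict (extDisk ε)) := by
  have hcont : Continuous (fderiv ℝ φ) := hφ.continuous_fderiv (by simp)
  have hm : MemLp (fderiv ℝ φ) q (volume.restrict (extDisk ε)) :=
    (hcont.memLp_of_hasCompactSupport (hc.fderiv ℝ)).restrict _
  refine (hu.norm.integrable_mul hm.norm).mono'
    ((ContinuousLinearMap.apply ℝ ℝ).flip.aestronglyMeasurable_comp₂ hm.1 hu.1)
    (ae_of_all _ fun x => ?_)
  refine ((fderiv ℝ φ x).le_opNorm _).trans (le_of_eq ?_)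
  rw [mul_comm]
  rfl

lemma MemLpSigma.sub {p : ℝ≥0∞} (q : ℝ≥0∞) [ENNReal.HolderConjugate p q] {u v : Plane → Plane}
    (hu : MemLpSigma ε p u) (hv : MemLpSigma ε p v) : MemLpSigma ε p (fun x => u x - v x) := by
  refine ⟨hu.1.sub hv.1, fun φ hφ hc => ?_⟩
  simp_rw [map_sub]
  rw [integral_sub (integrable_fderiv_apply q hφ hc hu.1)
    (integrable_fderiv_apply q hφ hc hv.1), hu.2 φ hφ hc, hv.2 φ hφ hc, sub_zero]

lemma IsStokesResolvent.memLpSigma {α : ℝ} {f v : Plane → Plane} (hv : IsStokesResolvent α ε p f v) :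
    MemLpSigma ε p v := by
  obtain ⟨_, _, ⟨h, _⟩, _⟩ := hv
  exact h

lemma exists_holderConjugate {p : ℝ≥0∞} (hp1 : 1 < p) (hp : p ≠ ⊤) :
    ∃ q : ℝ≥0∞, ENNReal.HolderConjugate p q ∧ q ≠ ⊤ ∧ 1 < q.toReal := by
  have hpq : ENNReal.HolderConjugate p (1 - p⁻¹)⁻¹ := by
    rw [ENNReal.holderConjugate_iff, inv_inv]
    exact add_tsub_cancel_of_le (ENNReal.inv_le_one.2 hp1.le)
  have hqp : ENNReal.HolderConjugate (1 - p⁻¹)⁻¹ p := inferInstance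
  have htop := (ENNReal.HolderConjugate.lt_top_iff_one_lt (1 - p⁻¹)⁻¹ p).2 hp1
  have hone := (ENNReal.HolderConjugate.lt_top_iff_one_lt p (1 - p⁻¹)⁻¹).1 (lt_top_iff_ne_top.2 hp)
  refine ⟨_, hpq, htop.ne, ?_⟩
  simpa using (ENNReal.toReal_lt_toReal (by simp) htop.ne).2 hone

/-- The resolvent equation for the Stokes operator has at most one solution. -/
lemma IsStokesResolvent.ae_unique {α : ℝ} (hα : 0 < α) (hε : 0 < ε) {p : ℝ≥0∞} (hp1 : 1 < p)
    (hp : p ≠ ⊤) {f u v : Plane → Plane} (hu : IsStokesResolvent α ε p f u)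
    (hv : IsStokesResolvent α ε p f v) : v =ᵐ[volume.restrict (extDisk ε)] u := by
  obtain ⟨q, hpq, hq, hq1⟩ := exists_holderConjugate hp1 hp
  have hsol : IsTransposedSolution α ε (fun x => v x - u x) := by
    intro h hh hdiv
    have hsq : 2 < ((2 : ℕ) : ℝ) * q.toReal := by push_cast; linarith
    have mT : MemLp (fun x => h x - α • ∑ i, pderiv i (pderiv i h) x) q
        (volume.restrict (extDisk ε)) :=
      (hh.memLp hε hq hsq).sub
        ((memLp_finsetSum _ fun i _ => hh.memLp_pderiv_pderiv hε hq hsq i i).const_smul α)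
    simp_rw [inner_sub_left]
    rw [integral_sub (integrable_inner_of_memLp hv.memLpSigma.1 mT)
      (integrable_inner_of_memLp hu.memLpSigma.1 mT), hv.integral_test hε hq hq1 hh hdiv,
      hu.integral_test hε hq hq1 hh hdiv, sub_self]
  filter_upwards [hsol.ae_eq_zero hα hε hq hq1 (hv.memLpSigma.sub q hu.memLpSigma)] with x hx
  exact sub_eq_zero.1 hx

end Uniqueness

/-! ### The distance to the smoothed field -/

section Estimate

variable {l : ℝ}

lemma besselInt_zero_antitone (hl : 0 < l) {ρ σ : ℝ} (hρ : 0 < ρ) (h : ρ ≤ σ) :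
    besselInt 0 l σ ≤ besselInt 0 l ρ := by
  refine setIntegral_mono_on (integrableOn_besselInt_integrand 0 hl (hρ.trans_le h))
    (integrableOn_besselInt_integrand 0 hl hρ) measurableSet_Ioi fun t (ht : 0 < t) => ?_
  gcongr

lemma besselInt_zero_le (hl : 0 < l) {ρ : ℝ} (hρ : 0 < ρ) : l * besselInt 0 l ρ ≤ 1 := by
  have h : besselInt 0 l ρ ≤ besselInt 0 l 0 := by
    refine setIntegral_mono_on (integrableOn_besselInt_integrand 0 hl hρ) ?_ measurableSet_Ioi
      fun t (ht : 0 < t) => ?_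
    · simpa using integrableOn_pow_mul_exp_neg 0 hl
    · gcongr
  rw [besselInt_zero_zero hl] at h
  calc l * besselInt 0 l ρ ≤ l * l⁻¹ := by gcongr
    _ = 1 := mul_inv_cancel₀ hl.ne'

/-- The case `m = 0` of the recurrence, where the term with `A₁` is absent. -/
lemma mul_besselInt_two (hl : 0 < l) {ρ : ℝ} (hρ : 0 < ρ) :
    ρ * besselInt 2 l ρ = 4 * (l * besselInt 0 l ρ) := by
  have := besselInt_recurrence 0 hl hρ
  push_cast at this
  linear_combination 4 * this

/-- The defect `1 - l A₀(ρ)`: the weight `1 - e^{-ρ/(4t)}` is at most `1` for `t ≤ ρ` and at most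
`ρ/(4t)` beyond, which produces the logarithm. -/
lemma one_sub_besselInt_zero_le (hl : 0 < l) {ρ : ℝ} (hρ : 0 < ρ) (hρ1 : ρ ≤ 1) :
    1 - l * besselInt 0 l ρ ≤ l * ρ + l / 4 * (ρ * |Real.log ρ|) + ρ / 4 := by
  have hexp : IntegrableOn (fun t : ℝ => Real.exp (-(l * t))) (Set.Ioi 0) := by
    simpa using integrableOn_pow_mul_exp_neg 0 hl
  have hexpI : ∫ t in Set.Ioi (0 : ℝ), Real.exp (-(l * t)) = l⁻¹ := by
    have := besselInt_zero_zero hl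
    simpa [besselInt] using this
  have hlog : ∫ t in Set.Ioc ρ 1, ρ / (4 * t) = ρ * |Real.log ρ| / 4 := by
    rw [← intervalIntegral.integral_of_le hρ1,
      show (fun t : ℝ => ρ / (4 * t)) = fun t => ρ / 4 * t⁻¹ from funext fun t => by
        rw [div_mul_eq_div_div, div_eq_mul_inv], intervalIntegral.integral_const_mul,
      integral_inv_of_pos hρ one_pos, one_div, Real.log_inv,
      abs_of_nonpos (Real.log_nonpos hρ.le hρ1)]
    ring
  have hlogi : IntegrableOn (fun t : ℝ => ρ / (4 * t)) (Set.Ioc ρ 1) := by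
    refine (ContinuousOn.integrableOn_Icc ?_).mono_set Set.Ioc_subset_Icc_self
    exact continuousOn_const.div (by fun_prop) fun t ht => by
      have := hρ.trans_le ht.1
      positivity
  have i1 : IntegrableOn ((Set.Ioc 0 ρ).indicator fun _ => (1 : ℝ)) (Set.Ioi 0) :=
    ((integrableOn_const (by simp)).integrable_indicator measurableSet_Ioc).integrableOn
  have i2 : IntegrableOn ((Set.Ioc ρ 1).indicator fun t : ℝ => ρ / (4 * t)) (Set.Ioi 0) :=
    (hlogi.integrable_indicator measurableSet_Ioc).integrableOn
  have e1 : ∫ t in Set.Ioi (0 : ℝ), (Set.Ioc 0 ρ).indicator (fun _ => (1 : ℝ)) t = ρ := by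
    rw [setIntegral_indicator measurableSet_Ioc,
      Set.inter_eq_right.2 fun t ht => ht.1]
    simp [hρ.le]
  have e2 : ∫ t in Set.Ioi (0 : ℝ), (Set.Ioc ρ 1).indicator (fun t : ℝ => ρ / (4 * t)) t =
      ρ * |Real.log ρ| / 4 := by
    rw [setIntegral_indicator measurableSet_Ioc,
      Set.inter_eq_right.2 (show Set.Ioc ρ 1 ⊆ Set.Ioi 0 from fun t ht => hρ.trans ht.1), hlog]
  have hsub : l⁻¹ - besselInt 0 l ρ = ∫ t in Set.Ioi (0 : ℝ),
      (Real.exp (-(l * t)) - Real.exp (-(l * t) - ρ / (4 * t)) * (t ^ 0)⁻¹) := by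
    rw [integral_sub hexp (integrableOn_besselInt_integrand 0 hl hρ), hexpI, besselInt]
  have hle : l⁻¹ - besselInt 0 l ρ ≤ ρ + ρ * |Real.log ρ| / 4 + ρ / 4 * l⁻¹ := by
    rw [hsub]
    have i3 := hexp.const_mul (ρ / 4)
    calc _ ≤ ∫ t in Set.Ioi (0 : ℝ), ((Set.Ioc 0 ρ).indicator (fun _ => (1 : ℝ)) t +
          (Set.Ioc ρ 1).indicator (fun t : ℝ => ρ / (4 * t)) t + ρ / 4 * Real.exp (-(l * t))) := by
          refine setIntegral_mono_on (hexp.sub (integrableOn_besselInt_integrand 0 hl hρ))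
            ((i1.add i2).add i3) measurableSet_Ioi fun t (ht : 0 < t) => ?_
          have hx0 := Real.exp_pos (-(l * t))
          have hx1 : Real.exp (-(l * t)) ≤ 1 := Real.exp_le_one_iff.2 (by nlinarith)
          have hw := Real.exp_pos (-(ρ / (4 * t)))
          have hw1 := Real.add_one_le_exp (-(ρ / (4 * t)))
          have hq : 0 ≤ ρ / (4 * t) := by positivity
          rw [pow_zero, inv_one, mul_one, sub_eq_add_neg (-(l * t)), Real.exp_add]
          rcases le_or_gt t ρ with h1 | h1
          · rw [Set.indicator_of_mem (show t ∈ Set.Ioc 0 ρ from ⟨ht, h1⟩),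
              Set.indicator_of_notMem (fun h : t ∈ Set.Ioc ρ 1 => absurd h.1 (not_lt.2 h1))]
            have : 0 ≤ ρ / 4 * Real.exp (-(l * t)) := by positivity
            nlinarith [mul_pos hx0 hw]
          · rw [Set.indicator_of_notMem (fun h : t ∈ Set.Ioc 0 ρ => absurd h.2 (not_le.2 h1))]
            have h2 : Real.exp (-(l * t)) - Real.exp (-(l * t)) * Real.exp (-(ρ / (4 * t))) ≤
                Real.exp (-(l * t)) * (ρ / (4 * t)) := by nlinarith
            refine h2.trans ?_
            rcases le_or_gt t 1 with h3 | h3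
            · rw [Set.indicator_of_mem (show t ∈ Set.Ioc ρ 1 from ⟨h1, h3⟩)]
              have : 0 ≤ ρ / 4 * Real.exp (-(l * t)) := by positivity
              nlinarith
            · rw [Set.indicator_of_notMem (fun h : t ∈ Set.Ioc ρ 1 => absurd h.2 (not_le.2 h3))]
              have : ρ / (4 * t) ≤ ρ / 4 := by gcongr; linarith
              nlinarith
      _ = _ := by
          have h1 := integral_add (i1.add i2) i3
          simp only [Pi.add_apply] at h1
          rw [h1, integral_add i1 i2, e1, e2, integral_const_mul, hexpI]
  have := mul_le_mul_of_nonneg_left hle hl.le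
  have h1 : l * l⁻¹ = 1 := mul_inv_cancel₀ hl.ne'
  nlinarith

/-- The difference between `κ` and its limit `1/(8π)` as `ε → 0`: with `B = α⁻¹ A₀(ε²)`, it equals
`(1 - B) / (8π B)`. -/
lemma exists_boundaryCoeff_sub_le {α : ℝ} (hα : 0 < α) : ∃ C, 0 < C ∧ ∀ ε, 0 < ε → ε ≤ 1 / 2 →
    |boundaryCoeff α ε - 1 / (8 * Real.pi)| ≤ C * (ε ^ 2 * |Real.log ε|) := by
  have hμ := inv_pos.2 hα
  set μ := α⁻¹ with hμd
  have hA := besselInt_pos 0 hμ (show (0 : ℝ) < 1 / 4 by norm_num)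
  set A := μ * besselInt 0 μ (1 / 4) with hAd
  have hA0 : 0 < A := mul_pos hμ hA
  refine ⟨2 * (μ + μ / 4 + 1) / (8 * Real.pi * A), by positivity, fun ε hε hε1 => ?_⟩
  have hρ : 0 < ε ^ 2 := by positivity
  have hρ1 : ε ^ 2 ≤ 1 / 4 := by nlinarith
  have hAB : A ≤ μ * besselInt 0 μ (ε ^ 2) :=
    mul_le_mul_of_nonneg_left (besselInt_zero_antitone hμ hρ hρ1) hμ.le
  have hB1 := besselInt_zero_le hμ hρ
  have hB2 := one_sub_besselInt_zero_le hμ hρ (by linarith)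
  have h2 := mul_besselInt_two hμ hρ
  set B := μ * besselInt 0 μ (ε ^ 2) with hB
  have hB0 : 0 < B := hA0.trans_le hAB
  have e : boundaryCoeff α ε - 1 / (8 * Real.pi) = (1 - B) / (8 * Real.pi * B) := by
    rw [boundaryCoeff, ← hμd, mul_assoc (2 * Real.pi), h2]
    field_simp
    ring
  have hlog : |Real.log (ε ^ 2)| = 2 * |Real.log ε| := by
    rw [Real.log_pow, abs_mul]; norm_num
  have hlog1 : 1 ≤ 2 * |Real.log ε| := by
    rw [← hlog, abs_of_nonpos (Real.log_nonpos hρ.le (by linarith)), ← Real.log_inv,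
      Real.le_log_iff_exp_le (by positivity)]
    have h4 : (4 : ℝ) ≤ (ε ^ 2)⁻¹ := by
      rw [le_inv_comm₀ (by norm_num) hρ]; linarith
    have := Real.exp_one_lt_d9
    linarith
  rw [hlog] at hB2
  have hnum : 1 - B ≤ (μ + μ / 4 + 1) * (ε ^ 2 * (2 * |Real.log ε|)) := by
    have h5 : ε ^ 2 ≤ ε ^ 2 * (2 * |Real.log ε|) := le_mul_of_one_le_right hρ.le hlog1
    nlinarith
  have hden : 8 * Real.pi * A ≤ 8 * Real.pi * B := by gcongr
  rw [e, abs_of_nonneg (div_nonneg (by linarith) (by positivity))]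
  calc (1 - B) / (8 * Real.pi * B) ≤ (1 - B) / (8 * Real.pi * A) := by
        have : 0 ≤ 1 - B := by linarith
        gcongr
    _ ≤ ((μ + μ / 4 + 1) * (ε ^ 2 * (2 * |Real.log ε|))) / (8 * Real.pi * A) := by gcongr
    _ = _ := by ring

/-- The field `A₂(|x|²) x^⊥` and its gradient are bounded by a multiple of `|x|^{-2}`. For small `|x|` this
is sharp for the gradient. -/
lemma exists_norm_besselInt_perp_le (hl : 0 < l) : ∃ M, 0 < M ∧ ∀ x : Plane, x ≠ 0 →
    ‖besselInt 2 l (‖x‖ ^ 2) • powField zCoord Complex.I 1 x‖ ≤ M * (‖x‖ ^ 2)⁻¹ ∧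
    ∀ i, ‖pderiv i (fun y => besselInt 2 l (‖y‖ ^ 2) • powField zCoord Complex.I 1 y) x‖ ≤
      M * (‖x‖ ^ 2)⁻¹ := by
  obtain ⟨C1, hC1, h1⟩ := besselInt_le 1 (N := 1) le_rfl hl
  obtain ⟨C2, hC2, h2⟩ := besselInt_le 2 (N := 2) le_rfl hl
  refine ⟨4 + C2 + 2 * (4 + l * C1), by positivity, fun x hx => ?_⟩
  have hr : 0 < ‖x‖ := norm_pos_iff.2 hx
  have hρ := norm_sq_pos hx
  have n2 := besselInt_nonneg 2 l (‖x‖ ^ 2)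
  have n3 := besselInt_nonneg 3 l (‖x‖ ^ 2)
  have hA2 : besselInt 2 l (‖x‖ ^ 2) ≤ 4 * (‖x‖ ^ 2)⁻¹ := by
    rw [← div_eq_mul_inv, le_div_iff₀ hρ, mul_comm, mul_besselInt_two hl hρ]
    linarith [besselInt_zero_le hl hρ]
  have hA3 : ‖x‖ ^ 2 * besselInt 3 l (‖x‖ ^ 2) ≤ 4 * (4 + l * C1) * (‖x‖ ^ 2)⁻¹ := by
    have h3 := besselInt_recurrence 1 hl hρ
    have h4 := h1 _ hρ
    rw [pow_one] at h4
    push_cast at h3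
    have h5 := mul_le_mul_of_nonneg_left h4 hl.le
    linarith
  have hnorm : ‖powField zCoord Complex.I 1 x‖ = ‖x‖ := by rw [← perp_eq_powField, norm_perp]
  refine ⟨?_, fun i => ?_⟩
  · rw [norm_smul, Real.norm_of_nonneg n2, hnorm]
    -- the bounds `4/ρ` and `C₂/ρ²` are combined for `r ≤ 1` and `r ≥ 1`
    rcases le_total ‖x‖ 1 with h | h
    · calc besselInt 2 l (‖x‖ ^ 2) * ‖x‖ ≤ (4 * (‖x‖ ^ 2)⁻¹) * 1 := by gcongr
        _ ≤ _ := by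
          rw [mul_one]
          gcongr
          have : 0 < C2 + 2 * (4 + l * C1) := by positivity
          linarith
    · have h5 := h2 _ hρ
      calc besselInt 2 l (‖x‖ ^ 2) * ‖x‖ ≤ (C2 * ((‖x‖ ^ 2) ^ 2)⁻¹) * ‖x‖ := by gcongr
        _ ≤ (C2 * ((‖x‖ ^ 2) ^ 2)⁻¹) * ‖x‖ ^ 2 := by gcongr; nlinarith
        _ = C2 * (‖x‖ ^ 2)⁻¹ := by field_simp
        _ ≤ _ := by
          gcongr
          have : 0 < 4 + 2 * (4 + l * C1) := by positivity
          linarith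
  · rw [pderiv_radial_smul (hasDerivAt_besselInt 2 hl hρ).differentiableAt
      ((contDiff_powField _ _ _).differentiable (by simp) x), deriv_besselInt 2 hl hρ, pderiv_powField]
    refine (norm_add_le _ _).trans ?_
    have e1 : ‖powField zCoord (Complex.I * (1 : ℕ) * zCoord (stdVec i)) (1 - 1) x‖ = 1 := by
      rw [← norm_toC, toC_powField]
      simp [norm_zCoord, norm_stdVec]
    rw [norm_smul, norm_smul, e1, hnorm, Real.norm_of_nonneg n2, Real.norm_eq_abs, abs_mul, abs_mul,
      abs_neg, abs_two, abs_of_nonneg (by positivity : 0 ≤ besselInt (2 + 1) l (‖x‖ ^ 2) / 4)]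
    have hxi := abs_coord_le x i
    have h6 : 2 * |x i| * (besselInt 3 l (‖x‖ ^ 2) / 4) * ‖x‖ ≤
        2 * ‖x‖ * (besselInt 3 l (‖x‖ ^ 2) / 4) * ‖x‖ := by gcongr
    have h7 : 0 ≤ C2 * (‖x‖ ^ 2)⁻¹ := by positivity
    norm_num only [Nat.reduceAdd]
    nlinarith

open scoped Pointwise in
lemma smul_extDisk_one {ε : ℝ} (hε : 0 < ε) : ε • extDisk 1 = extDisk ε := by
  ext x
  rw [Set.mem_smul_set_iff_inv_smul_mem₀ hε.ne']
  simp only [extDisk, Set.mem_ofPred_eq, norm_smul, norm_inv, Real.norm_of_nonneg hε.le]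
  rw [inv_mul_eq_div, one_lt_div hε]

/-- By scaling, the `L²` norm of `|x|^{-2}` outside the disk of radius `ε` is a multiple of `1/ε`. -/
lemma exists_eLpNorm_inv_sq_eq : ∃ J, 0 ≤ J ∧ ∀ ε, 0 < ε →
    eLpNorm (fun x : Plane => (‖x‖ ^ 2)⁻¹) 2 (volume.restrict (extDisk ε)) =
      ENNReal.ofReal (J * ε⁻¹) := by
  set I := ∫ x in extDisk 1, ‖(‖x‖ ^ 2)⁻¹‖ ^ (2 : ℝ≥0∞).toReal with hI
  have hI0 : 0 ≤ I := integral_nonneg fun x => by positivity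
  refine ⟨Real.sqrt I, Real.sqrt_nonneg _, fun ε hε => ?_⟩
  rw [(memLp_inv_norm_pow hε (by simp) (by norm_num)).eLpNorm_eq_integral_rpow_norm (by simp) (by simp)]
  congr 1
  have h := Measure.setIntegral_comp_smul_of_pos volume
    (fun x : Plane => ‖(‖x‖ ^ 2)⁻¹‖ ^ (2 : ℝ≥0∞).toReal) (extDisk 1) hε
  rw [smul_extDisk_one hε] at h
  have e : ∀ x : Plane, ‖(‖ε • x‖ ^ 2)⁻¹‖ ^ (2 : ℝ≥0∞).toReal =
      (ε ^ 4)⁻¹ * ‖(‖x‖ ^ 2)⁻¹‖ ^ (2 : ℝ≥0∞).toReal := by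
    intro x
    rw [norm_smul, Real.norm_of_nonneg hε.le, ENNReal.toReal_ofNat, Real.rpow_two, Real.rpow_two,
      Real.norm_of_nonneg (by positivity), Real.norm_of_nonneg (by positivity), mul_pow, mul_inv,
      mul_pow]
    congr 1
    rw [← inv_pow, ← inv_pow]
    ring
  simp_rw [e] at h
  rw [integral_const_mul, ← hI, finrank_euclideanSpace_fin, smul_eq_mul] at h
  have h' : ∫ x in extDisk ε, ‖(‖x‖ ^ 2)⁻¹‖ ^ (2 : ℝ≥0∞).toReal = I * (ε⁻¹) ^ 2 := by
    have : (∫ x in extDisk ε, ‖(‖x‖ ^ 2)⁻¹‖ ^ (2 : ℝ≥0∞).toReal) =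
        ε ^ 2 * ((ε ^ 2)⁻¹ * ∫ x in extDisk ε, ‖(‖x‖ ^ 2)⁻¹‖ ^ (2 : ℝ≥0∞).toReal) := by
      field_simp
    rw [this, ← h]
    field_simp
  rw [h', ENNReal.toReal_ofNat, ← one_div (2 : ℝ), ← Real.sqrt_eq_rpow, Real.sqrt_mul hI0,
    Real.sqrt_sq (by positivity)]

/-- The norm is an infimum over weak gradients, so any weak gradient gives an upper bound. -/
lemma h1Norm_le {Ω : Set Plane} {w : Plane → Plane} {D : Fin 2 → Plane → Plane} {B : ℝ}
    (hD : ∀ i, HasWeakPartial Ω i w (D i))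
    (hw : eLpNorm w 2 (volume.restrict Ω) ≤ ENNReal.ofReal B)
    (hDn : ∀ i, eLpNorm (D i) 2 (volume.restrict Ω) ≤ ENNReal.ofReal B) :
    h1Norm Ω w ≤ ENNReal.ofReal (2 * B) := by
  have h : (eLpNorm w 2 (volume.restrict Ω)) ^ 2 +
      ∑ i, (eLpNorm (D i) 2 (volume.restrict Ω)) ^ 2 ≤ ENNReal.ofReal (2 * B) ^ (2 : ℝ) := by
    rw [Fin.sum_univ_two]
    have e : ENNReal.ofReal (2 * B) ^ (2 : ℝ) = 4 * ENNReal.ofReal B ^ 2 := by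
      rw [ENNReal.rpow_two, ENNReal.ofReal_mul zero_le_two, mul_pow, ENNReal.ofReal_ofNat]
      norm_num
    rw [e]
    calc _ ≤ ENNReal.ofReal B ^ 2 + (ENNReal.ofReal B ^ 2 + ENNReal.ofReal B ^ 2) := by
          gcongr
          · exact hDn 0
          · exact hDn 1
      _ = 3 * ENNReal.ofReal B ^ 2 := by ring
      _ ≤ _ := by gcongr; norm_num
  refine (iInf₂_le D hD).trans ((ENNReal.rpow_le_rpow h (by norm_num)).trans (le_of_eq ?_))
  rw [← ENNReal.rpow_mul]
  norm_num

/-- The difference is `-(κ - 1/(8π)) A₂(|x|²) x^⊥`, of size `ε² |log ε| · ε⁻¹` in `H¹`. -/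
lemma exists_h1Norm_le {α : ℝ} (hα : 0 < α) : ∃ C, 0 < C ∧ ∀ ε, 0 < ε → ε ≤ 1 / 2 →
    h1Norm (extDisk ε) (fun x => resolventField α ε x - smoothedField α x) ≤
      ENNReal.ofReal (C * (ε * |Real.log ε|)) := by
  have hμ := inv_pos.2 hα
  obtain ⟨C, hC, hδ⟩ := exists_boundaryCoeff_sub_le hα
  obtain ⟨M, hM, hb⟩ := exists_norm_besselInt_perp_le hμ
  obtain ⟨J, hJ, hn⟩ := exists_eLpNorm_inv_sq_eq
  refine ⟨2 * (C * M * J) + 1, by positivity, fun ε hε hε1 => ?_⟩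
  set δ := boundaryCoeff α ε - 1 / (8 * Real.pi) with hδd
  set g : Plane → Plane := fun y => besselInt 2 α⁻¹ (‖y‖ ^ 2) • powField zCoord Complex.I 1 y with hg
  have hgs : ContDiffOn ℝ ∞ g {0}ᶜ :=
    (contDiffOn_radial (contDiffOn_besselInt 2 hμ)).smul (contDiff_powField _ _ _).contDiffOn
  set V : Plane → Plane := fun x => (-δ) • g x with hV
  have hVs : ContDiffOn ℝ ∞ V (extDisk ε) := (hgs.const_smul (-δ)).mono (extDisk_subset hε)
  have heq : Set.EqOn (fun x => resolventField α ε x - smoothedField α x) V (extDisk ε) := by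
    intro x hx
    simp only [hV, hg]
    rw [smoothedField_eq hα (ne_zero_of_mem_extDisk hε hx), resolventField, resolventProfile_eq,
      perp_eq_powField, ← sub_smul, smul_smul]
    congr 1
    rw [hδd]
    ring
  have hbound : ∀ {f : Plane → Plane}, (∀ x ∈ extDisk ε, ‖f x‖ ≤ |δ| * (M * (‖x‖ ^ 2)⁻¹)) →
      eLpNorm f 2 (volume.restrict (extDisk ε)) ≤ ENNReal.ofReal (|δ| * M * (J * ε⁻¹)) := by
    intro f hf
    rw [ENNReal.ofReal_mul (by positivity), ← hn ε hε]
    refine eLpNorm_le_mul_eLpNorm_of_ae_le_mul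
      ((ae_restrict_iff' (measurableSet_extDisk ε)).2 (ae_of_all _ fun x hx => ?_)) 2
    rw [Real.norm_of_nonneg (by positivity), mul_assoc]
    exact hf x hx
  have hpV : ∀ i, ∀ x ∈ extDisk ε, pderiv i V x = (-δ) • pderiv i g x := by
    intro i x hx
    have hx0 := ne_zero_of_mem_extDisk hε hx
    have hd : DifferentiableAt ℝ g x :=
      (hgs.contDiffAt (isOpen_punctured.mem_nhds hx0)).differentiableAt (by simp)
    simp only [hV, pderiv]
    rw [fderiv_fun_const_smul hd]
    rfl
  refine (h1Norm_le (D := fun i => pderiv i V) (B := |δ| * M * (J * ε⁻¹)) (fun i => ?_)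
    (hbound fun x hx => ?_) (fun i => hbound fun x hx => ?_)).trans (ENNReal.ofReal_le_ofReal ?_)
  · exact (hasWeakPartial_pderiv (isOpen_extDisk ε) hVs i).congr (measurableSet_extDisk ε)
      ((hVs.continuousOn.congr heq).locallyIntegrableOn (measurableSet_extDisk ε)) heq
  · rw [show resolventField α ε x - smoothedField α x = V x from heq hx, hV, norm_smul, norm_neg,
      Real.norm_eq_abs]
    gcongr
    exact (hb x (ne_zero_of_mem_extDisk hε hx)).1
  · rw [hpV i x hx, norm_smul, norm_neg, Real.norm_eq_abs]
    gcongr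
    exact (hb x (ne_zero_of_mem_extDisk hε hx)).2 i
  · have h1 := hδ ε hε hε1
    have h2 : 0 ≤ ε * |Real.log ε| := by positivity
    calc 2 * (|δ| * M * (J * ε⁻¹)) ≤ 2 * (C * (ε ^ 2 * |Real.log ε|) * M * (J * ε⁻¹)) := by gcongr
      _ = 2 * (C * M * J) * (ε * |Real.log ε|) := by field_simp
      _ ≤ _ := by nlinarith

end Estimate

end StokesExterior

open StokesExterior
theorem mainTheorem3 (α : ℝ) (hα : 0 < α) :
    ∃ C : ℝ, 0 < C ∧ ∀ ε : ℝ, 0 < ε → ε ≤ 1 / 2 →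
      ∃ u : Plane → Plane,
        (∀ p : ℝ≥0∞, 2 < p → p ≠ ⊤ →
          IsStokesResolvent α ε p harmonicField u ∧
          ∀ v, IsStokesResolvent α ε p harmonicField v →
            v =ᵐ[volume.restrict (extDisk ε)] u) ∧
        h1Norm (extDisk ε) (fun x => u x - smoothedField α x) ≤
          ENNReal.ofReal (C * (ε * |Real.log ε|)) := by
  obtain ⟨C, hC, hest⟩ := exists_h1Norm_le hα
  refine ⟨C, hC, fun ε hε hε1 => ⟨resolventField α ε, fun p hp2 hp => ?_, hest ε hε hε1⟩⟩
  have hu := isStokesResolvent_resolventField hα hε hp2 hp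
  exact ⟨hu, fun v hv => hu.ae_unique hα hε (ENNReal.one_lt_two.trans hp2) hp hv⟩
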